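/- Setting. Let $n\ge 1$, let $\mathcal Y\subset\mathbb R^d$ be closed and convex, and consider $$\min_{x\in\mathbb R^p}\max_{y\in\mathcal Y} f(x,y)=\frac1n\sum_{i=1}^n f_i(x,y),\qquad f_i(x,y)=\mathbb E_{\xi\sim\mathcal D_i}[F_i(x,y;\xi)].$$ Assume that, for constants $\mu,L,C>0$ and all $i$, all $x,x'\in\mathbb R^p$ and all $y,y'\in\mathcal Y$: (1) $f_i(x,y)-f_i(x,y')\ge\langle\nabla_y f_i(x,y),y-y'\rangle+\frac\mu2\|y-y'\|^2$; (2) for $z\in\{x,y\}$, $\|\nabla_zf_i(x,y)-\nabla_zf_i(x',y')\|^2\le L^2(\|x-x'\|^2+\|y-y'\|^2)$, and the same bound holds for $\nabla^2_{zy}f_i$; (3) for $z\in\{x,y\}$, $\mathbb E_{\xi}[\nabla_zF_i(x,y;\xi)]=\nabla_zf_i(x,y)$ and $\|\nabla_zF_i(x,y;\xi)\|\le C$ almost surely; (4) $W\in\mathbb R^{n\times n}$ is doubly stochastic and $\rho_W:=\|W-\frac1n\mathbf 1\mathbf 1^T\|_2^2<1$. Let $y^*(x)=\arg\max_{y\in\mathcal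 Y}f(x,y)$, $\Phi(x)=f(x,y^*(x))$, $\kappa=L/\mu$, and assume that $\Phi$ is bounded, with $\sup\Phi-\inf\Phi\le M$. Algorithm (D-AdaST). Given $\gamma_x,\gamma_y,c>0$, exponents $0<\beta<\alpha<1$, initial points $x_{i,0}\in\mathbb R^p$, $y_{i,0}\in\mathcal Y$ and $m^x_{i,0}=m^y_{i,0}=c$, at every iteration $k=0,1,\dots$ each node $i$ draws $g^x_{i,k}=\nabla_xF_i(x_{i,k},y_{i,k};\xi^x_{i,k})$ and $g^y_{i,k}=\nabla_yF_i(x_{i,k},y_{i,k};\xi^y_{i,k})$, where all the samples $\xi^x_{i,k},\xi^y_{i,k}\sim\mathcal D_i$ are independent, and computes, for $z\in\{x,y\}$, $$\hat m^z_i=m^z_{i,k}+\|g^z_{i,k}\|^2,\quad \psi_i=\frac{(\hat m^x_i)^\alpha}{\max\{(\hat m^x_i)^\alpha,(\hat m^y_i)^\alpha\}},\quad \hat x_i=x_{i,k}-\gamma_x\psi_i(\hat m^x_i)^{-\alpha}g^x_{i,k},\quad \hat y_i=y_{i,k}+\gamma_y(\hat m^y_i)^{-\beta}g^y_{i,k},$$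 $$m^z_{i,k+1}=\sum_jW_{ij}\hat m^z_j,\qquad x_{i,k+1}=\sum_jW_{ij}\hat x_j,\qquad y_{i,k+1}=\mathcal P_{\mathcal Y}\Big(\sum_jW_{ij}\hat y_j\Big).$$ Let $\bar x_k=\frac1n\sum_ix_{i,k}$ and assume $\|x_{i,0}-\bar x_0\|\le R$ for all $i$. Theorem. (a) The maximizer $y^*(x)$ exists and is unique for every $x$, $\Phi$ is differentiable, and $\|\nabla\Phi(\bar x_k)\|^2$ is integrable for every $k$. Let $0<\beta<\alpha<1$ and $a>0$. There are constants $B$ and $q\in\mathbb N$, depending only on $\alpha,\beta,\gamma_x,\gamma_y,c,a,n,\mu,L,C,M,R$ (and not on the problem, the dimensions $p,d$, the matrix $W$ or $\rho_W$, or $K$), such that for every integer $$K\ge a\max\left\{\left(\frac{\gamma_x^2\kappa^4}{\gamma_y^2}\right)^{\frac1{\alpha-\beta}},\ \left(\frac1{(1-\rho_W)^2}\right)^{\max\{\frac1\alpha,\frac1\beta\}}\right\}$$ one has $$\frac1K\sum_{k=0}^{K-1}\mathbb E\big[\|\nabla\Phi(\bar x_k)\|^2\big]\le B(1+\log K)^q\left(\frac1{K^{1-\alpha}}+\frac1{(1-\rho_W)^\alpha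 K^\alpha}+\frac1{K^{1-\beta}}+\frac1{(1-\rho_W)K^\beta}\right).$$ (b) Let $\delta>0$, $r<1$, $\alpha=\frac12+\frac\delta{8+2\delta}$ and $\beta=\frac12-\frac\delta{8+2\delta}$. There are constants $B$ and $q\in\mathbb N$, depending only on $\delta,r,\gamma_x,\gamma_y,c,n,\mu,L,C,M,R$, such that for every $\varepsilon\in(0,1)$ there is an integer $K_0\geq 1$ for which the total number $2nK_0$ of samples drawn in $K_0$ iterations is at most $B\,\varepsilon^{-(4+\delta)}(1+\log\frac1\varepsilon)^q$, and, whenever $\rho_W\le r$, $\frac1K\sum_{k=0}^{K-1}\mathbb E[\|\nabla\Phi(\bar x_k)\|^2]\le\varepsilon^2$ for all $K\ge K_0$. The parameters $\gamma_x,\gamma_y,c>0$ are arbitrary, and the choice of $\alpha,\beta$ depends on $\delta$ only, so no knowledge of $\mu$, $L$, $C$ or $\rho_W$ is used by the algorithm. -/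

import Mathlib

open MeasureTheory ProbabilityTheory

noncomputable section

namespace DAdaST

/-- The Euclidean space `ℝ^m`. -/
abbrev Euc (m : ℕ) : Type := EuclideanSpace ℝ (Fin m)

/-! ### Partial derivatives and Euclidean operations -/

/-- The partial gradient `∇_x h (x, y)`. -/
def gradX {p d : ℕ} (h : Euc p → Euc d → ℝ) (x : Euc p) (y : Euc d) : Euc p :=
  gradient (fun x' => h x' y) x

/-- The partial gradient `∇_y h (x, y)`. -/
def gradY {p d : ℕ} (h : Euc p → Euc d → ℝ) (x : Euc p) (y : Euc d) : Euc d :=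
  gradient (fun y' => h x y') y

/-- The mixed second derivative `∇²_{xy} h (x, y)`: the derivative in `y` of `∇_x h`. -/
def hessXY {p d : ℕ} (h : Euc p → Euc d → ℝ) (x : Euc p) (y : Euc d) : Euc d →L[ℝ] Euc p :=
  fderiv ℝ (fun y' => gradX h x y') y

/-- The second derivative `∇²_{yy} h (x, y)`: the derivative in `y` of `∇_y h`. -/
def hessYY {p d : ℕ} (h : Euc p → Euc d → ℝ) (x : Euc p) (y : Euc d) : Euc d →L[ℝ] Euc d :=
  fderiv ℝ (fun y' => gradY h x y') y

/-- The Euclidean projection onto `Y`: a nearest point of `Y`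
(it exists and is unique when `Y` is nonempty, closed and convex). -/
def proj {d : ℕ} (Y : Set (Euc d)) (q : Euc d) : Euc d :=
  Classical.epsilon fun y => y ∈ Y ∧ ∀ z ∈ Y, ‖q - y‖ ≤ ‖q - z‖

/-- The average of `n` vectors. -/
def nodeMean {n m : ℕ} (v : Fin n → Euc m) : Euc m := (1 / (n : ℝ)) • ∑ i, v i

/-- `ρ_W = ‖W - J‖₂²`, the squared spectral norm, with `J = 𝟏𝟏ᵀ / n`. -/
def rho {n : ℕ} (W : Matrix (Fin n) (Fin n) ℝ) : ℝ :=
  ‖Matrix.toEuclideanCLM (n := Fin n) (𝕜 := ℝ) (W - Matrix.of fun _ _ => 1 / (n : ℝ))‖ ^ 2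

/-! ### The minimax problem -/

/-- The data of `min_{x ∈ ℝ^p} max_{y ∈ Y} (1/n) ∑ i, E_{ξ ∼ dist i} F i (x, y; ξ)`. -/
structure Problem (n p d : ℕ) (Ξ : Type*) [MeasurableSpace Ξ] where
  /-- the sample losses of the nodes -/
  F : Fin n → Euc p → Euc d → Ξ → ℝ
  /-- the data distributions of the nodes -/
  dist : Fin n → Measure Ξ
  /-- the domain of the dual variable -/
  Y : Set (Euc d)

namespace Problem

variable {n p d : ℕ} {Ξ : Type*} [MeasurableSpace Ξ]

/-- The local objective `f_i (x, y) = E_ξ F_i (x, y; ξ)`. -/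
def localObj (A : Problem n p d Ξ) (i : Fin n) (x : Euc p) (y : Euc d) : ℝ :=
  ∫ s, A.F i x y s ∂(A.dist i)

/-- The global objective `f = (1/n) ∑ i, f_i`. -/
def obj (A : Problem n p d Ξ) (x : Euc p) (y : Euc d) : ℝ :=
  (1 / (n : ℝ)) * ∑ i, A.localObj i x y

/-- `y*(x)`, a maximizer of `f (x, ·)` over `Y`. -/
def yStar (A : Problem n p d Ξ) (x : Euc p) : Euc d :=
  Classical.epsilon fun y => y ∈ A.Y ∧ IsMaxOn (A.obj x) A.Y y

/-- The primal function `Φ (x) = f (x, y*(x))`. -/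
def Phi (A : Problem n p d Ξ) (x : Euc p) : ℝ := A.obj x (A.yStar x)

/-- The stochastic gradient `∇_x F_i (x, y; s)`. -/
def sgradX (A : Problem n p d Ξ) (i : Fin n) (x : Euc p) (y : Euc d) (s : Ξ) : Euc p :=
  gradX (fun x' y' => A.F i x' y' s) x y

/-- The stochastic gradient `∇_y F_i (x, y; s)`. -/
def sgradY (A : Problem n p d Ξ) (i : Fin n) (x : Euc p) (y : Euc d) (s : Ξ) : Euc d :=
  gradY (fun x' y' => A.F i x' y' s) x y

/-- The standing setting: `Y` is closed and convex, the `dist i` are probability measures, the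
expectations defining `f_i` exist, and the stochastic gradients are measurable. -/
structure WellPosed (A : Problem n p d Ξ) : Prop where
  isClosed : IsClosed A.Y
  convex : Convex ℝ A.Y
  prob : ∀ i, IsProbabilityMeasure (A.dist i)
  integrable : ∀ i x, ∀ y ∈ A.Y, Integrable (A.F i x y) (A.dist i)
  measurableX : ∀ i, Measurable fun q : Euc p × A.Y × Ξ => A.sgradX i q.1 q.2.1 q.2.2
  measurableY : ∀ i, Measurable fun q : Euc p × A.Y × Ξ => A.sgradY i q.1 q.2.1 q.2.2

/-- Every `f_i` is `μ`-strongly concave in `y`. -/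
def StronglyConcave (A : Problem n p d Ξ) (μ : ℝ) : Prop :=
  ∀ i x, ∀ y ∈ A.Y, ∀ y' ∈ A.Y,
    inner ℝ (gradY (A.localObj i) x y) (y - y') + μ / 2 * ‖y - y'‖ ^ 2
      ≤ A.localObj i x y - A.localObj i x y'

/-- Every `f_i` is differentiable in `x` and in `y`, its partial gradients are differentiable in
`y`, and all these derivatives are `L`-Lipschitz on `ℝ^p × Y`. -/
structure Smooth (A : Problem n p d Ξ) (L : ℝ) : Prop where
  diffX : ∀ i x, ∀ y ∈ A.Y, DifferentiableAt ℝ (fun x' => A.localObj i x' y) x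
  diffY : ∀ i x, ∀ y ∈ A.Y, DifferentiableAt ℝ (fun y' => A.localObj i x y') y
  diffXY : ∀ i x, ∀ y ∈ A.Y, DifferentiableAt ℝ (fun y' => gradX (A.localObj i) x y') y
  diffYY : ∀ i x, ∀ y ∈ A.Y, DifferentiableAt ℝ (fun y' => gradY (A.localObj i) x y') y
  lipX : ∀ i x x', ∀ y ∈ A.Y, ∀ y' ∈ A.Y,
    ‖gradX (A.localObj i) x y - gradX (A.localObj i) x' y'‖ ^ 2
      ≤ L ^ 2 * (‖x - x'‖ ^ 2 + ‖y - y'‖ ^ 2)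
  lipY : ∀ i x x', ∀ y ∈ A.Y, ∀ y' ∈ A.Y,
    ‖gradY (A.localObj i) x y - gradY (A.localObj i) x' y'‖ ^ 2
      ≤ L ^ 2 * (‖x - x'‖ ^ 2 + ‖y - y'‖ ^ 2)
  lipXY : ∀ i x x', ∀ y ∈ A.Y, ∀ y' ∈ A.Y,
    ‖hessXY (A.localObj i) x y - hessXY (A.localObj i) x' y'‖ ^ 2
      ≤ L ^ 2 * (‖x - x'‖ ^ 2 + ‖y - y'‖ ^ 2)
  lipYY : ∀ i x x', ∀ y ∈ A.Y, ∀ y' ∈ A.Y,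
    ‖hessYY (A.localObj i) x y - hessYY (A.localObj i) x' y'‖ ^ 2
      ≤ L ^ 2 * (‖x - x'‖ ^ 2 + ‖y - y'‖ ^ 2)

/-- The stochastic gradients exist, are unbiased and are bounded by `C`. -/
structure StochasticGradient (A : Problem n p d Ξ) (C : ℝ) : Prop where
  diffX : ∀ i x, ∀ y ∈ A.Y, ∀ᵐ s ∂(A.dist i), DifferentiableAt ℝ (fun x' => A.F i x' y s) x
  diffY : ∀ i x, ∀ y ∈ A.Y, ∀ᵐ s ∂(A.dist i), DifferentiableAt ℝ (fun y' => A.F i x y' s) y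
  boundX : ∀ i x, ∀ y ∈ A.Y, ∀ᵐ s ∂(A.dist i), ‖A.sgradX i x y s‖ ≤ C
  boundY : ∀ i x, ∀ y ∈ A.Y, ∀ᵐ s ∂(A.dist i), ‖A.sgradY i x y s‖ ≤ C
  unbiasedX : ∀ i x, ∀ y ∈ A.Y, ∫ s, A.sgradX i x y s ∂(A.dist i) = gradX (A.localObj i) x y
  unbiasedY : ∀ i x, ∀ y ∈ A.Y, ∫ s, A.sgradY i x y s ∂(A.dist i) = gradY (A.localObj i) x y

end Problem

/-! ### The algorithm -/

/-- The variables `x_i, y_i, m_i^x, m_i^y` of all nodes at one iteration. -/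
structure State (n p d : ℕ) where
  x : Fin n → Euc p
  y : Fin n → Euc d
  mx : Fin n → ℝ
  my : Fin n → ℝ

/-- One iteration of D-AdaST with weight matrix `W`, given the stochastic gradients `gx, gy`. -/
def step {n p d : ℕ} (W : Matrix (Fin n) (Fin n) ℝ) (Y : Set (Euc d)) (α β γx γy : ℝ)
    (gx : Fin n → Euc p) (gy : Fin n → Euc d) (s : State n p d) : State n p d :=
  -- accumulate the squared gradient norms
  let mx : Fin n → ℝ := fun i => s.mx i + ‖gx i‖ ^ 2
  let my : Fin n → ℝ := fun i => s.my i + ‖gy i‖ ^ 2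
  -- the ratio
  let ψ : Fin n → ℝ := fun i => mx i ^ α / max (mx i ^ α) (my i ^ α)
  -- local updates
  let x : Fin n → Euc p := fun i => s.x i - (γx * ψ i * mx i ^ (-α)) • gx i
  let y : Fin n → Euc d := fun i => s.y i + (γy * my i ^ (-β)) • gy i
  -- communication and projection
  { x := fun i => ∑ j, W i j • x j
    y := fun i => proj Y (∑ j, W i j • y j)
    mx := fun i => ∑ j, W i j * mx j
    my := fun i => ∑ j, W i j * my j }

/-- A problem, a network, initial points, and the random samples used by the nodes. -/
structure Instance (n p d : ℕ) (Ξ Ω : Type*) [MeasurableSpace Ξ] [MeasurableSpace Ω]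
    extends Problem n p d Ξ where
  /-- the weight matrix -/
  W : Matrix (Fin n) (Fin n) ℝ
  /-- initial primal variables -/
  x0 : Fin n → Euc p
  /-- initial dual variables -/
  y0 : Fin n → Euc d
  /-- the underlying probability measure -/
  P : Measure Ω
  /-- `ξx k i` is the sample of node `i` for the `x`-gradient at iteration `k` -/
  ξx : ℕ → Fin n → Ω → Ξ
  /-- `ξy k i` is the sample of node `i` for the `y`-gradient at iteration `k` -/
  ξy : ℕ → Fin n → Ω → Ξ

namespace Instance

variable {n p d : ℕ} {Ξ Ω : Type*} [MeasurableSpace Ξ] [MeasurableSpace Ω]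

/-- The iterates of D-AdaST with buffers initialized at `c`, along the outcome `ω`. -/
def run (I : Instance n p d Ξ Ω) (α β γx γy c : ℝ) (ω : Ω) : ℕ → State n p d
  | 0 => { x := I.x0, y := I.y0, mx := fun _ => c, my := fun _ => c }
  | k + 1 =>
    let s := run I α β γx γy c ω k
    step I.W I.Y α β γx γy
      (fun i => I.sgradX i (s.x i) (s.y i) (I.ξx k i ω))
      (fun i => I.sgradY i (s.x i) (s.y i) (I.ξy k i ω)) s

/-- The averaged primal iterate `x̄_k`. -/
def xbar (I : Instance n p d Ξ Ω) (α β γx γy c : ℝ) (k : ℕ) (ω : Ω) : Euc p :=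
  nodeMean (I.run α β γx γy c ω k).x

/-- `(1/K) ∑_{k<K} E ‖∇Φ(x̄_k)‖²`. -/
def avgGradSq (I : Instance n p d Ξ Ω) (α β γx γy c : ℝ) (K : ℕ) : ℝ :=
  (1 / (K : ℝ)) * ∑ k ∈ Finset.range K,
    ∫ ω, ‖gradient I.Phi (I.xbar α β γx γy c k ω)‖ ^ 2 ∂I.P

/-- The hypotheses on the problem, the network, the initialization and the samples. -/
structure Admissible (I : Instance n p d Ξ Ω) (μ L C M R : ℝ) : Prop where
  wellPosed : I.WellPosed
  stronglyConcave : I.StronglyConcave μ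
  smooth : I.Smooth L
  stochasticGradient : I.StochasticGradient C
  -- `Φ` is bounded above and below, and `sup Φ - inf Φ ≤ M`
  osc : ∀ x x', I.Phi x - I.Phi x' ≤ M
  doublyStochastic : I.W ∈ doublyStochastic ℝ (Fin n)
  rho_lt_one : rho I.W < 1
  y0_mem : ∀ i, I.y0 i ∈ I.Y
  -- the initial primal points are within `R` of their average
  x0_bound : ∀ i, ‖I.x0 i - nodeMean I.x0‖ ≤ R
  prob : IsProbabilityMeasure I.P
  measurable_ξx : ∀ k i, Measurable (I.ξx k i)
  measurable_ξy : ∀ k i, Measurable (I.ξy k i)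
  law_ξx : ∀ k i, I.P.map (I.ξx k i) = I.dist i
  law_ξy : ∀ k i, I.P.map (I.ξy k i) = I.dist i
  -- all samples are mutually independent
  indep : iIndepFun (Sum.elim (fun q : ℕ × Fin n => I.ξx q.1 q.2)
    (fun q : ℕ × Fin n => I.ξy q.1 q.2)) I.P

end Instance

/-- The transient time
`max {(γ_x² κ⁴ / γ_y²)^{1/(α-β)}, (1/(1-ρ)²)^{max {1/α, 1/β}}}`. -/
def transient (α β γx γy κ ρ : ℝ) : ℝ :=
  max ((γx ^ 2 * κ ^ 4 / γy ^ 2) ^ (1 / (α - β)))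
    ((1 / (1 - ρ) ^ 2) ^ max (1 / α) (1 / β))

/-- The rate `K^{-(1-α)} + (1-ρ)^{-α} K^{-α} + K^{-(1-β)} + (1-ρ)^{-1} K^{-β}`. -/
def rate (α β ρ : ℝ) (K : ℕ) : ℝ :=
  (1 / (K : ℝ) ^ (1 - α) + 1 / ((1 - ρ) ^ α * (K : ℝ) ^ α))
    + (1 / (K : ℝ) ^ (1 - β) + 1 / ((1 - ρ) * (K : ℝ) ^ β))

end DAdaST

end

/-!
The proof is a pathwise energy argument; expectations are taken only once, at the end.

*Common stepsizes.* The local buffers deviate from their average by at most `O(1 / (1 - ρ))`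
(`Accumulator.abs_sub_avg_le`). Adding an offset `S` of that order to the averaged buffers gives
common stepsizes `η = γ_x / U ^ α` and `θ = γ_y / V ^ β`, which depend on the past only and never
exceed the local ones; replacing the local stepsizes by them costs second-order terms
(`sum_stepsize_sub_sq_le`). When `S` is a large constant times `1 / (1 - ρ)`, the ratio `η / θ` is
as small as desired from the first iteration on (`exists_offset`), because `β < α`.

*Second-order terms.* All of them are sums of `‖g‖² / m̂ ^ t` over the local buffers. As `W` is
doubly stochastic, Jensen's inequality shows that mixing does not decrease `∑ i, log m_i`, so
`∑ ‖g‖² / m̂` is at most logarithmic in `K` and the other exponents follow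
(`Accumulator.sum_div_le`, `Accumulator.sum_div_rpow_le`).

*Three coupled estimates.* The descent inequality for `Φ`, whose gradient is given by Danskin's
theorem, bounds `‖∇Φ‖²` by the consensus errors and the distance of the dual iterates to the
maximizer. That distance is measured from `y*(w)`, where `w` is a slow tracker of the averaged
primal iterate that moves towards it at the rate `μ θ`. The increment of `w` is of the order
`θ ‖x̄ - w‖` and does not contain the current gradients, so the Lipschitz continuity of `y*`, which
follows from the optimality condition at the maximizer, suffices and `y*` need not be
differentiable. Strong concavity contracts the dual distance (`Problem.Regular.dual_step`), and the
tracking error contracts with a source of relative size `η / θ` (`tracker_step`). For a small ratio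
the three summed estimates can be solved for `∑ ‖∇Φ‖²` (`exists_ratio_combine`).

*Noise.* The remaining terms are inner products of functions of the past with centred stochastic
gradients; their expectation vanishes by independence (`integral_inner_noise`). This gives
`exists_expectation_bound`.

*Rates.* The lower bound on `K` says `(1 / (1 - ρ)) ^ 2 = O(K ^ β)`, with which every term of the
bound is of the order of `K` times the rate, times one logarithm (`exists_rate_bound`). For the
sample complexity `α + β = 1`, so the rate is `O(K ^ (-β))` with `β = 2 / (4 + δ)`, and
`exists_iteration_bound` inverts `(1 + log K) / K ^ β ≤ ε ^ 2`.
-/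

namespace DAdaST

/-! ### Projection, averaging and mixing -/

section Projection

variable {d : ℕ} {Y : Set (Euc d)}

lemma proj_spec (hc : IsClosed Y) (hne : Y.Nonempty) (q : Euc d) :
    proj Y q ∈ Y ∧ ∀ z ∈ Y, ‖q - proj Y q‖ ≤ ‖q - z‖ := by
  obtain ⟨y, hy, h⟩ := hc.exists_infDist_eq_dist hne q
  refine Classical.epsilon_spec (p := fun y => y ∈ Y ∧ ∀ z ∈ Y, ‖q - y‖ ≤ ‖q - z‖) ⟨y, hy, ?_⟩
  intro z hz
  rw [← dist_eq_norm, ← dist_eq_norm, ← h]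
  exact Metric.infDist_le_dist_of_mem hz

lemma inner_sub_proj_nonpos (hc : IsClosed Y) (hv : Convex ℝ Y) (hne : Y.Nonempty) (q : Euc d)
    {z : Euc d} (hz : z ∈ Y) : inner ℝ (q - proj Y q) (z - proj Y q) ≤ 0 := by
  obtain ⟨hm, hle⟩ := proj_spec hc hne q
  refine (norm_eq_iInf_iff_real_inner_le_zero hv hm).1 ?_ z hz
  have : Nonempty Y := hne.to_subtype
  apply le_antisymm
  · exact le_ciInf fun w => hle w w.2
  · exact ciInf_le ⟨0, by rintro _ ⟨w, rfl⟩; positivity⟩ (⟨_, hm⟩ : Y)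

lemma norm_proj_sub_proj_le (hc : IsClosed Y) (hv : Convex ℝ Y) (hne : Y.Nonempty) (u v : Euc d) :
    ‖proj Y u - proj Y v‖ ≤ ‖u - v‖ := by
  have h1 := inner_sub_proj_nonpos hc hv hne u (proj_spec hc hne v).1
  have h2 := inner_sub_proj_nonpos hc hv hne v (proj_spec hc hne u).1
  set a := proj Y u
  set b := proj Y v
  have h3 : ‖a - b‖ ^ 2 ≤ inner ℝ (u - v) (a - b) := by
    rw [← real_inner_self_eq_norm_sq]
    have e1 : inner ℝ (u - a) (b - a) = - inner ℝ (u - a) (a - b) := by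
      rw [← inner_neg_right, neg_sub]
    have e2 : inner ℝ (u - v) (a - b)
        = inner ℝ (u - a) (a - b) - inner ℝ (v - b) (a - b) + inner ℝ (a - b) (a - b) := by
      simp only [inner_sub_left]; ring
    linarith
  have h4 := real_inner_le_norm (u - v) (a - b)
  by_contra hlt
  push Not at hlt
  have : 0 < ‖a - b‖ := (norm_nonneg _).trans_lt hlt
  nlinarith

lemma proj_eq_self (hc : IsClosed Y) {z : Euc d} (hz : z ∈ Y) : proj Y z = z := by
  have := (proj_spec hc ⟨z, hz⟩ z).2 z hz
  rw [sub_self, norm_zero, norm_le_zero_iff, sub_eq_zero] at this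
  exact this.symm

lemma continuous_proj (hc : IsClosed Y) (hv : Convex ℝ Y) (hne : Y.Nonempty) :
    Continuous (proj Y) := by
  refine (LipschitzWith.of_dist_le_mul (K := 1) fun u v => ?_).continuous
  simpa [dist_eq_norm] using norm_proj_sub_proj_le hc hv hne u v

end Projection

section Mixing

variable {n m : ℕ}

lemma smul_nodeMean (hn : 0 < n) (v : Fin n → Euc m) : (n : ℝ) • nodeMean v = ∑ i, v i := by
  have : (n : ℝ) ≠ 0 := by positivity
  rw [nodeMean, smul_smul, mul_one_div_cancel this, one_smul]

/-- The mean minimizes the sum of squared distances; this is the exact decomposition. -/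
lemma sum_norm_sub_sq (hn : 0 < n) (v : Fin n → Euc m) (z : Euc m) :
    ∑ i, ‖v i - z‖ ^ 2 = ∑ i, ‖v i - nodeMean v‖ ^ 2 + n * ‖nodeMean v - z‖ ^ 2 := by
  have h : ∀ i, ‖v i - z‖ ^ 2 = ‖v i - nodeMean v‖ ^ 2
      + 2 * inner ℝ (v i - nodeMean v) (nodeMean v - z) + ‖nodeMean v - z‖ ^ 2 := fun i => by
    rw [← norm_add_sq_real, sub_add_sub_cancel]
  have h0 : ∑ i, (v i - nodeMean v) = 0 := by
    rw [Finset.sum_sub_distrib, ← smul_nodeMean hn]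
    simp [← Nat.cast_smul_eq_nsmul ℝ]
  simp_rw [h, Finset.sum_add_distrib, ← Finset.mul_sum, ← sum_inner, h0]
  simp

lemma sum_norm_sub_nodeMean_sq_le (hn : 0 < n) (v : Fin n → Euc m) (z : Euc m) :
    ∑ i, ‖v i - nodeMean v‖ ^ 2 ≤ ∑ i, ‖v i - z‖ ^ 2 := by
  rw [sum_norm_sub_sq hn v z]
  have : 0 ≤ (n : ℝ) * ‖nodeMean v - z‖ ^ 2 := by positivity
  linarith

lemma norm_nodeMean_sq_le (hn : 0 < n) (v : Fin n → Euc m) :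
    ‖nodeMean v‖ ^ 2 ≤ (1 / (n : ℝ)) * ∑ i, ‖v i‖ ^ 2 := by
  have h := sum_norm_sub_sq hn v 0
  simp only [sub_zero] at h
  have h0 : 0 ≤ ∑ i, ‖v i - nodeMean v‖ ^ 2 := Finset.sum_nonneg fun i _ => by positivity
  have hn' : (0 : ℝ) < n := by positivity
  rw [one_div, ← div_eq_inv_mul, le_div_iff₀ hn']
  linarith

lemma nodeMean_sub (u v : Fin n → Euc m) :
    nodeMean (fun i => u i - v i) = nodeMean u - nodeMean v := by
  simp [nodeMean, Finset.sum_sub_distrib, smul_sub]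

variable {W : Matrix (Fin n) (Fin n) ℝ}

/-- Averaging with a doubly stochastic matrix preserves sums. -/
lemma sum_mix {E : Type*} [AddCommGroup E] [Module ℝ E] (hW : W ∈ doublyStochastic ℝ (Fin n))
    (v : Fin n → E) : ∑ i, ∑ j, W i j • v j = ∑ j, v j := by
  rw [Finset.sum_comm]
  refine Finset.sum_congr rfl fun j _ => ?_
  rw [← Finset.sum_smul, sum_col_of_mem_doublyStochastic hW, one_smul]

lemma nodeMean_mix (hW : W ∈ doublyStochastic ℝ (Fin n)) (v : Fin n → Euc m) :
    nodeMean (fun i => ∑ j, W i j • v j) = nodeMean v := by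
  simp only [nodeMean, sum_mix hW]

/-- Jensen's inequality for a doubly stochastic matrix and a convex function. -/
lemma sum_convex_mix_le {E : Type*} [AddCommGroup E] [Module ℝ E]
    (hW : W ∈ doublyStochastic ℝ (Fin n)) {s : Set E} {φ : E → ℝ} (hφ : ConvexOn ℝ s φ)
    {v : Fin n → E} (hv : ∀ j, v j ∈ s) : ∑ i, φ (∑ j, W i j • v j) ≤ ∑ j, φ (v j) := by
  calc ∑ i, φ (∑ j, W i j • v j) ≤ ∑ i, ∑ j, W i j • φ (v j) := by
        refine Finset.sum_le_sum fun i _ => hφ.map_sum_le (fun j _ => ?_) ?_ fun j _ => hv j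
        · exact nonneg_of_mem_doublyStochastic hW
        · exact sum_row_of_mem_doublyStochastic hW i
    _ = ∑ j, φ (v j) := sum_mix hW _

lemma sum_norm_mix_sub_sq_le (hW : W ∈ doublyStochastic ℝ (Fin n)) (v : Fin n → Euc m)
    (z : Euc m) : ∑ i, ‖∑ j, W i j • v j - z‖ ^ 2 ≤ ∑ j, ‖v j - z‖ ^ 2 := by
  have hφ : ConvexOn ℝ Set.univ fun u : Euc m => ‖u - z‖ ^ 2 := by
    have h1 : ConvexOn ℝ Set.univ fun u : Euc m => ‖u - z‖ := by
      have := (convexOn_norm (E := Euc m) convex_univ).translate_left (-z)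
      simpa [sub_eq_add_neg, Function.comp_def] using this
    exact h1.pow (fun _ _ => norm_nonneg _) 2
  exact sum_convex_mix_le hW hφ fun _ => Set.mem_univ _

lemma rho_nonneg (W : Matrix (Fin n) (Fin n) ℝ) : 0 ≤ rho W := sq_nonneg _

/-- Mixing contracts the deviation from the mean by `ρ_W`. -/
lemma sum_mix_sub_sq_le (hn : 0 < n) (hW : W ∈ doublyStochastic ℝ (Fin n)) (v : Fin n → ℝ) :
    ∑ i, (∑ j, W i j * v j - 1 / (n : ℝ) * ∑ j, v j) ^ 2
      ≤ rho W * ∑ i, (v i - 1 / (n : ℝ) * ∑ j, v j) ^ 2 := by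
  have hn' : (n : ℝ) ≠ 0 := by positivity
  set a := 1 / (n : ℝ) * ∑ j, v j with ha
  set T := Matrix.toEuclideanCLM (n := Fin n) (𝕜 := ℝ) (W - Matrix.of fun _ _ => 1 / (n : ℝ))
  set u : Euc n := WithLp.toLp 2 fun i => v i - a
  have h := T.le_opNorm u
  have hu : ‖u‖ ^ 2 = ∑ i, (v i - a) ^ 2 := by
    rw [EuclideanSpace.norm_sq_eq]; simp [u]
  have hsum : ∑ j, (v j - a) = 0 := by
    rw [Finset.sum_sub_distrib]; simp only [Finset.sum_const, Finset.card_univ, Fintype.card_fin,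
      nsmul_eq_mul, ha]; field_simp; ring
  have hT : ‖T u‖ ^ 2 = ∑ i, (∑ j, W i j * v j - a) ^ 2 := by
    rw [EuclideanSpace.norm_sq_eq]
    refine Finset.sum_congr rfl fun i _ => ?_
    have : (T u) i = ∑ j, W i j * v j - a := by
      change ((W - Matrix.of fun _ _ => 1 / (n : ℝ)).mulVec fun i => v i - a) i = _
      simp only [Matrix.mulVec, dotProduct, Matrix.sub_apply, Matrix.of_apply, sub_mul,
        Finset.sum_sub_distrib, ← Finset.mul_sum, mul_sub, ← Finset.sum_mul,
        sum_row_of_mem_doublyStochastic hW i]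
      rw [Finset.sum_const, Finset.card_univ, Fintype.card_fin, nsmul_eq_mul, ha]
      field_simp
      ring
    rw [this, Real.norm_eq_abs, sq_abs]
  rw [← hT, ← hu, rho, ← mul_pow]
  exact pow_le_pow_left₀ (norm_nonneg _) h 2

/-- One communication round applied to `u + b`, where `b` is a local update: the deviation from
the mean contracts up to the size of the update. -/
lemma sum_mix_add_sub_sq_le (hn : 0 < n) (hW : W ∈ doublyStochastic ℝ (Fin n)) (hρ : rho W < 1)
    (u b : Fin n → ℝ) :
    ∑ i, (∑ j, W i j * (u j + b j) - 1 / (n : ℝ) * ∑ j, (u j + b j)) ^ 2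
      ≤ (1 - (1 - rho W) / 2) * ∑ i, (u i - 1 / (n : ℝ) * ∑ j, u j) ^ 2
        + 2 / (1 - rho W) * ∑ i, b i ^ 2 := by
  have hn' : (n : ℝ) ≠ 0 := by positivity
  have h := sum_mix_sub_sq_le hn hW fun j => u j + b j
  refine h.trans ?_
  have hρ0 := rho_nonneg W
  set ρ := rho W
  set s := 1 - ρ with hs
  have hs0 : 0 < s := by linarith
  set a := 1 / (n : ℝ) * ∑ j, u j with ha
  set a' := 1 / (n : ℝ) * ∑ j, b j with ha'
  have hmean : 1 / (n : ℝ) * ∑ j, (u j + b j) = a + a' := by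
    rw [Finset.sum_add_distrib, mul_add]
  have hvar : ∑ i, (b i - a') ^ 2 ≤ ∑ i, b i ^ 2 := by
    have e : ∀ i, (b i - a') ^ 2 = b i ^ 2 - 2 * a' * b i + a' ^ 2 := fun i => by ring
    have e2 : ∑ j, b j = n * a' := by rw [ha']; field_simp
    simp_rw [e, Finset.sum_add_distrib, Finset.sum_sub_distrib, ← Finset.mul_sum, e2]
    simp only [Finset.sum_const, Finset.card_univ, Fintype.card_fin, nsmul_eq_mul]
    have : 0 ≤ (n : ℝ) * a' ^ 2 := by positivity
    linarith
  have hpt : ∀ i, (u i + b i - (a + a')) ^ 2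
      ≤ (1 + s / 2) * (u i - a) ^ 2 + (1 + 2 / s) * (b i - a') ^ 2 := fun i => by
    have : 0 ≤ (s * (u i - a) - 2 * (b i - a')) ^ 2 / (2 * s) := by positivity
    have e : (1 + s / 2) * (u i - a) ^ 2 + (1 + 2 / s) * (b i - a') ^ 2
        - (u i + b i - (a + a')) ^ 2 = (s * (u i - a) - 2 * (b i - a')) ^ 2 / (2 * s) := by
      field_simp; ring
    linarith
  rw [hmean]
  have hU : 0 ≤ ∑ i, (u i - a) ^ 2 := Finset.sum_nonneg fun i _ => sq_nonneg _
  have hB : 0 ≤ ∑ i, b i ^ 2 := Finset.sum_nonneg fun i _ => sq_nonneg _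
  calc ρ * ∑ i, (u i + b i - (a + a')) ^ 2
      ≤ ρ * ((1 + s / 2) * ∑ i, (u i - a) ^ 2 + (1 + 2 / s) * ∑ i, b i ^ 2) := by
        refine mul_le_mul_of_nonneg_left ?_ hρ0
        calc _ ≤ ∑ i, ((1 + s / 2) * (u i - a) ^ 2 + (1 + 2 / s) * (b i - a') ^ 2) :=
              Finset.sum_le_sum fun i _ => hpt i
          _ = (1 + s / 2) * ∑ i, (u i - a) ^ 2 + (1 + 2 / s) * ∑ i, (b i - a') ^ 2 := by
              rw [Finset.sum_add_distrib, Finset.mul_sum, Finset.mul_sum]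
          _ ≤ _ := by gcongr
    _ = (ρ * (1 + s / 2)) * ∑ i, (u i - a) ^ 2 + (ρ * (1 + 2 / s)) * ∑ i, b i ^ 2 := by ring
    _ ≤ _ := by
        have hρs : ρ = 1 - s := by linarith
        have h1 : ρ * (1 + s / 2) ≤ 1 - s / 2 := by rw [hρs]; nlinarith [sq_nonneg s]
        have h2 : ρ * (1 + 2 / s) ≤ 2 / s := by
          rw [hρs]
          have : (1 - s) * (1 + 2 / s) = 2 / s - 1 - s := by field_simp; ring
          linarith
        gcongr

/-- The vector version of `sum_mix_add_sub_sq_le`. -/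
lemma sum_norm_mix_add_sub_sq_le (hn : 0 < n) (hW : W ∈ doublyStochastic ℝ (Fin n))
    (hρ : rho W < 1) (u b : Fin n → Euc m) :
    ∑ i, ‖∑ j, W i j • (u j + b j) - nodeMean fun j => u j + b j‖ ^ 2
      ≤ (1 - (1 - rho W) / 2) * ∑ i, ‖u i - nodeMean u‖ ^ 2
        + 2 / (1 - rho W) * ∑ i, ‖b i‖ ^ 2 := by
  simp only [EuclideanSpace.norm_sq_eq]
  rw [Finset.sum_comm, Finset.sum_comm (f := fun i l => ‖(u i - nodeMean u).ofLp l‖ ^ 2),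
    Finset.sum_comm (f := fun i l => ‖(b i).ofLp l‖ ^ 2), Finset.mul_sum, Finset.mul_sum,
    ← Finset.sum_add_distrib]
  refine Finset.sum_le_sum fun l _ => ?_
  have := sum_mix_add_sub_sq_le hn hW hρ (fun j => u j l) (fun j => b j l)
  simpa [nodeMean, Real.norm_eq_abs, sq_abs, Finset.sum_add_distrib, mul_add] using this

end Mixing

/-! ### The primal function -/

namespace Problem

variable {n p d : ℕ} {Ξ : Type*} [MeasurableSpace Ξ] {A : Problem n p d Ξ} {μ L C : ℝ}

/-- The assumptions on the minimax problem alone, with a nonempty feasible set and the signs of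
the constants. -/
structure Regular (A : Problem n p d Ξ) (μ L C : ℝ) : Prop where
  wellPosed : A.WellPosed
  stronglyConcave : A.StronglyConcave μ
  smooth : A.Smooth L
  stochasticGradient : A.StochasticGradient C
  nonempty : A.Y.Nonempty
  node_pos : 0 < n
  mu_pos : 0 < μ
  L_pos : 0 < L
  C_pos : 0 < C

namespace Regular

lemma norm_gradX_le (hA : A.Regular μ L C) (i : Fin n) (x : Euc p) {y : Euc d} (hy : y ∈ A.Y) :
    ‖gradX (A.localObj i) x y‖ ≤ C := by
  have := hA.wellPosed.prob i
  rw [← hA.stochasticGradient.unbiasedX i x y hy]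
  simpa using norm_integral_le_of_norm_le_const (hA.stochasticGradient.boundX i x y hy)

lemma norm_gradY_le (hA : A.Regular μ L C) (i : Fin n) (x : Euc p) {y : Euc d} (hy : y ∈ A.Y) :
    ‖gradY (A.localObj i) x y‖ ≤ C := by
  have := hA.wellPosed.prob i
  rw [← hA.stochasticGradient.unbiasedY i x y hy]
  simpa using norm_integral_le_of_norm_le_const (hA.stochasticGradient.boundY i x y hy)

lemma inner_gradY_sub_le (hA : A.Regular μ L C) (i : Fin n) (x : Euc p) {y y' : Euc d}
    (hy : y ∈ A.Y) (hy' : y' ∈ A.Y) :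
    inner ℝ (gradY (A.localObj i) x y - gradY (A.localObj i) x y') (y - y')
      ≤ -(μ * ‖y - y'‖ ^ 2) := by
  have h1 := hA.stronglyConcave i x y hy y' hy'
  have h2 := hA.stronglyConcave i x y' hy' y hy
  rw [norm_sub_rev y' y, ← neg_sub y y', inner_neg_right] at h2
  rw [inner_sub_left]
  linarith

/-- Strong concavity and bounded gradients force `Y` to be bounded. -/
lemma norm_sub_le_of_mem (hA : A.Regular μ L C) {y y' : Euc d} (hy : y ∈ A.Y) (hy' : y' ∈ A.Y) :
    ‖y - y'‖ ≤ 2 * C / μ := by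
  have hμ := hA.mu_pos
  let i : Fin n := ⟨0, hA.node_pos⟩
  have h := hA.inner_gradY_sub_le i 0 hy hy'
  have h1 := abs_le.1 (abs_real_inner_le_norm
    (gradY (A.localObj i) 0 y - gradY (A.localObj i) 0 y') (y - y'))
  have h2 : ‖gradY (A.localObj i) 0 y - gradY (A.localObj i) 0 y'‖ ≤ 2 * C :=
    (norm_sub_le _ _).trans (by
      have := hA.norm_gradY_le i 0 hy; have := hA.norm_gradY_le i 0 hy'; linarith)
  rw [le_div_iff₀ hμ]
  by_contra hlt
  push Not at hlt
  have hC := hA.C_pos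
  have : 0 < ‖y - y'‖ := by
    rcases (norm_nonneg (y - y')).eq_or_lt with h0 | h0
    · rw [← h0] at hlt; linarith
    · exact h0
  nlinarith

lemma norm_gradX_sub_le (hA : A.Regular μ L C) (i : Fin n) (x x' : Euc p) {y y' : Euc d}
    (hy : y ∈ A.Y) (hy' : y' ∈ A.Y) :
    ‖gradX (A.localObj i) x y - gradX (A.localObj i) x' y'‖ ≤ L * (‖x - x'‖ + ‖y - y'‖) := by
  refine abs_le_of_sq_le_sq' ?_ (by have := hA.L_pos; positivity) |>.2
  refine (hA.smooth.lipX i x x' y hy y' hy').trans ?_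
  rw [mul_pow]
  gcongr
  nlinarith [norm_nonneg (x - x'), norm_nonneg (y - y'),
    mul_nonneg (norm_nonneg (x - x')) (norm_nonneg (y - y'))]

lemma norm_gradY_sub_le (hA : A.Regular μ L C) (i : Fin n) (x x' : Euc p) {y y' : Euc d}
    (hy : y ∈ A.Y) (hy' : y' ∈ A.Y) :
    ‖gradY (A.localObj i) x y - gradY (A.localObj i) x' y'‖ ≤ L * (‖x - x'‖ + ‖y - y'‖) := by
  refine abs_le_of_sq_le_sq' ?_ (by have := hA.L_pos; positivity) |>.2
  refine (hA.smooth.lipY i x x' y hy y' hy').trans ?_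
  rw [mul_pow]
  gcongr
  nlinarith [norm_nonneg (x - x'), norm_nonneg (y - y'),
    mul_nonneg (norm_nonneg (x - x')) (norm_nonneg (y - y'))]

/-- The first-order expansion of `f_i` in `x`, with quadratic error. -/
lemma abs_localObj_sub_le (hA : A.Regular μ L C) (i : Fin n) (x x' : Euc p) {y : Euc d}
    (hy : y ∈ A.Y) :
    |A.localObj i x' y - A.localObj i x y - inner ℝ (gradX (A.localObj i) x y) (x' - x)|
      ≤ L * ‖x' - x‖ ^ 2 := by
  have hL := hA.L_pos
  have hd : ∀ u, HasFDerivAt (fun u => A.localObj i u y)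
      (InnerProductSpace.toDual ℝ (Euc p) (gradX (A.localObj i) u y)) u := fun u =>
    (hA.smooth.diffX i u y hy).hasGradientAt.hasFDerivAt
  have h := (convex_segment (𝕜 := ℝ) x x').norm_image_sub_le_of_norm_hasFDerivWithin_le'
    (f := fun u => A.localObj i u y)
    (φ := InnerProductSpace.toDual ℝ (Euc p) (gradX (A.localObj i) x y)) (C := L * ‖x' - x‖)
    (fun u _ => (hd u).hasFDerivWithinAt) (fun u hu => ?_) (left_mem_segment ℝ x x')
    (right_mem_segment ℝ x x')
  · rw [InnerProductSpace.toDual_apply_apply, Real.norm_eq_abs] at h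
    refine h.trans_eq (by ring)
  · rw [← map_sub, LinearIsometryEquiv.norm_map]
    have h1 := hA.norm_gradX_sub_le i u x hy hy
    rw [sub_self, norm_zero, add_zero] at h1
    refine h1.trans (mul_le_mul_of_nonneg_left ?_ hL.le)
    obtain ⟨t, ht, rfl⟩ := (segment_eq_image' ℝ x x') ▸ hu
    rw [add_sub_cancel_left, norm_smul, Real.norm_eq_abs, abs_of_nonneg ht.1]
    exact mul_le_of_le_one_left (norm_nonneg _) ht.2

lemma abs_obj_sub_le (hA : A.Regular μ L C) (x x' : Euc p) {y : Euc d} (hy : y ∈ A.Y) :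
    |A.obj x' y - A.obj x y - inner ℝ (nodeMean fun i => gradX (A.localObj i) x y) (x' - x)|
      ≤ L * ‖x' - x‖ ^ 2 := by
  have hn : (0 : ℝ) < n := by exact_mod_cast hA.node_pos
  have e : A.obj x' y - A.obj x y - inner ℝ (nodeMean fun i => gradX (A.localObj i) x y) (x' - x)
      = 1 / (n : ℝ) * ∑ i, (A.localObj i x' y - A.localObj i x y
          - inner ℝ (gradX (A.localObj i) x y) (x' - x)) := by
    simp only [obj, nodeMean, Finset.sum_sub_distrib, real_inner_smul_left, sum_inner]
    ring
  rw [e, abs_mul, abs_of_pos (by positivity : 0 < 1 / (n : ℝ)), one_div, ← div_eq_inv_mul,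
    div_le_iff₀ hn]
  refine (Finset.abs_sum_le_sum_abs _ _).trans ?_
  refine (Finset.sum_le_sum fun i _ => hA.abs_localObj_sub_le i x x' hy).trans_eq ?_
  simp [mul_comm]

lemma hasGradientAt_obj (hA : A.Regular μ L C) (x : Euc p) {y : Euc d} (hy : y ∈ A.Y) :
    HasGradientAt (A.obj x) (nodeMean fun i => gradY (A.localObj i) x y) y := by
  rw [hasGradientAt_iff_hasFDerivAt]
  have h : ∀ i, HasFDerivAt (A.localObj i x)
      (InnerProductSpace.toDual ℝ (Euc d) (gradY (A.localObj i) x y)) y := fun i =>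
    (hA.smooth.diffY i x y hy).hasGradientAt.hasFDerivAt
  have e : InnerProductSpace.toDual ℝ (Euc d) (nodeMean fun i => gradY (A.localObj i) x y)
      = (1 / (n : ℝ)) • ∑ i, InnerProductSpace.toDual ℝ (Euc d) (gradY (A.localObj i) x y) := by
    simp [nodeMean]
  rw [e]
  exact (HasFDerivAt.fun_sum (u := Finset.univ) fun i _ => h i).const_mul (1 / (n : ℝ))

lemma continuousOn_obj (hA : A.Regular μ L C) (x : Euc p) : ContinuousOn (A.obj x) A.Y :=
  fun _ hy => (hA.hasGradientAt_obj x hy).hasFDerivAt.continuousAt.continuousWithinAt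

/-- The first-order optimality condition of a maximizer over `Y`. -/
lemma inner_nodeMean_gradY_nonpos (hA : A.Regular μ L C) {x : Euc p} {y z : Euc d}
    (hy : y ∈ A.Y) (hmax : IsMaxOn (A.obj x) A.Y y) (hz : z ∈ A.Y) :
    inner ℝ (nodeMean fun i => gradY (A.localObj i) x y) (z - y) ≤ 0 := by
  have h := hmax.localize.hasFDerivWithinAt_nonpos
    (hA.hasGradientAt_obj x hy).hasFDerivAt.hasFDerivWithinAt
    (y := z - y) (sub_mem_posTangentConeAt_of_segment_subset
      (hA.wellPosed.convex.segment_subset hy hz))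
  simpa using h

/-- The maximizer depends Lipschitz continuously on `x`; in particular it is unique. -/
lemma norm_maximizer_sub_le (hA : A.Regular μ L C) {x x' : Euc p} {y y' : Euc d}
    (hy : y ∈ A.Y) (hmax : IsMaxOn (A.obj x) A.Y y)
    (hy' : y' ∈ A.Y) (hmax' : IsMaxOn (A.obj x') A.Y y') :
    ‖y - y'‖ ≤ L / μ * ‖x - x'‖ := by
  have hn : (0 : ℝ) < n := by exact_mod_cast hA.node_pos
  have hμ := hA.mu_pos
  have hL := hA.L_pos
  have h1 := hA.inner_nodeMean_gradY_nonpos hy hmax hy'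
  have h2 := hA.inner_nodeMean_gradY_nonpos hy' hmax' hy
  have h3 : inner ℝ ((nodeMean fun i => gradY (A.localObj i) x y)
      - nodeMean fun i => gradY (A.localObj i) x y') (y - y') ≤ -(μ * ‖y - y'‖ ^ 2) := by
    rw [← nodeMean_sub, nodeMean, real_inner_smul_left, sum_inner, one_div, ← div_eq_inv_mul,
      div_le_iff₀ hn]
    refine (Finset.sum_le_sum fun i _ => hA.inner_gradY_sub_le i x hy hy').trans_eq ?_
    simp [mul_comm]
  have h4 : inner ℝ ((nodeMean fun i => gradY (A.localObj i) x y')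
      - nodeMean fun i => gradY (A.localObj i) x' y') (y - y') ≤ L * ‖x - x'‖ * ‖y - y'‖ := by
    refine (real_inner_le_norm _ _).trans (mul_le_mul_of_nonneg_right ?_ (norm_nonneg _))
    rw [← nodeMean_sub, nodeMean, norm_smul, Real.norm_of_nonneg (by positivity), one_div,
      ← div_eq_inv_mul, div_le_iff₀ hn]
    refine (norm_sum_le _ _).trans
      ((Finset.sum_le_sum fun i _ => hA.norm_gradY_sub_le i x x' hy' hy').trans_eq ?_)
    simp [mul_comm]
  rw [← neg_sub y y', inner_neg_right] at h1
  simp only [inner_sub_left] at h3 h4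
  have h5 : μ * ‖y - y'‖ ^ 2 ≤ L * ‖x - x'‖ * ‖y - y'‖ := by linarith
  rw [div_mul_eq_mul_div, le_div_iff₀ hμ]
  rcases (norm_nonneg (y - y')).eq_or_lt with h0 | h0
  · rw [← h0]; simp; positivity
  · nlinarith

lemma existsUnique_maximizer (hA : A.Regular μ L C) (x : Euc p) :
    ∃! y, y ∈ A.Y ∧ IsMaxOn (A.obj x) A.Y y := by
  obtain ⟨y₀, hy₀⟩ := hA.nonempty
  have hcomp : IsCompact A.Y := Metric.isCompact_of_isClosed_isBounded hA.wellPosed.isClosed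
    (Metric.isBounded_iff.2 ⟨2 * C / μ, fun y hy y' hy' => by
      rw [dist_eq_norm]; exact hA.norm_sub_le_of_mem hy hy'⟩)
  obtain ⟨y, hy, hmax⟩ := hcomp.exists_isMaxOn hA.nonempty (hA.continuousOn_obj x)
  refine ⟨y, ⟨hy, hmax⟩, fun y' ⟨hy', hmax'⟩ => ?_⟩
  have := hA.norm_maximizer_sub_le hy' hmax' hy hmax
  rw [sub_self, norm_zero, mul_zero, norm_le_zero_iff, sub_eq_zero] at this
  exact this

lemma yStar_mem (hA : A.Regular μ L C) (x : Euc p) : A.yStar x ∈ A.Y :=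
  (Classical.epsilon_spec (hA.existsUnique_maximizer x).exists).1

lemma isMaxOn_yStar (hA : A.Regular μ L C) (x : Euc p) : IsMaxOn (A.obj x) A.Y (A.yStar x) :=
  (Classical.epsilon_spec (hA.existsUnique_maximizer x).exists).2

lemma norm_yStar_sub_le (hA : A.Regular μ L C) (x x' : Euc p) :
    ‖A.yStar x - A.yStar x'‖ ≤ L / μ * ‖x - x'‖ :=
  hA.norm_maximizer_sub_le (hA.yStar_mem x) (hA.isMaxOn_yStar x) (hA.yStar_mem x')
    (hA.isMaxOn_yStar x')

lemma continuous_yStar (hA : A.Regular μ L C) : Continuous A.yStar := by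
  have h0 : 0 ≤ L / μ := (div_pos hA.L_pos hA.mu_pos).le
  refine (LipschitzWith.of_dist_le_mul (K := ⟨L / μ, h0⟩) fun u v => ?_).continuous
  rw [dist_eq_norm, dist_eq_norm]
  exact hA.norm_yStar_sub_le u v

lemma sum_inner_gradY_yStar_nonpos (hA : A.Regular μ L C) (x : Euc p) {z : Euc d}
    (hz : z ∈ A.Y) : ∑ i, inner ℝ (gradY (A.localObj i) x (A.yStar x)) (z - A.yStar x) ≤ 0 := by
  have hn : (0 : ℝ) < n := by exact_mod_cast hA.node_pos
  have h := hA.inner_nodeMean_gradY_nonpos (hA.yStar_mem x) (hA.isMaxOn_yStar x) hz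
  rw [nodeMean, real_inner_smul_left, sum_inner] at h
  have : 0 < 1 / (n : ℝ) := by positivity
  by_contra hlt
  push Not at hlt
  exact absurd h (not_le.2 (mul_pos this hlt))

/-- Danskin's theorem with a quadratic error: the maximizer moves by `O(‖x' - x‖)`, and comparing
the values at `x` and `x'` of the two maximizers traps `Φ x' - Φ x` from both sides. -/
lemma abs_Phi_sub_le (hA : A.Regular μ L C) (x x' : Euc p) :
    |A.Phi x' - A.Phi x
        - inner ℝ (nodeMean fun i => gradX (A.localObj i) x (A.yStar x)) (x' - x)|
      ≤ L * (2 + L / μ) * ‖x' - x‖ ^ 2 := by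
  have hL := hA.L_pos
  have hμ := hA.mu_pos
  have hn : (0 : ℝ) < n := by exact_mod_cast hA.node_pos
  set z := A.yStar x with hz
  set z' := A.yStar x' with hz'
  have hzm := hA.yStar_mem x
  have hzm' := hA.yStar_mem x'
  have h1 := abs_le.1 (hA.abs_obj_sub_le x x' hzm)
  have h2 := abs_le.1 (hA.abs_obj_sub_le x x' hzm')
  have h3 : A.obj x' z ≤ A.obj x' z' := hA.isMaxOn_yStar x' hzm
  have h4 : A.obj x z' ≤ A.obj x z := hA.isMaxOn_yStar x hzm'
  have h5 : inner ℝ ((nodeMean fun i => gradX (A.localObj i) x z')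
      - nodeMean fun i => gradX (A.localObj i) x z) (x' - x) ≤ L * (L / μ) * ‖x' - x‖ ^ 2 := by
    refine (real_inner_le_norm _ _).trans ?_
    rw [pow_two, ← mul_assoc]
    refine mul_le_mul_of_nonneg_right ?_ (norm_nonneg _)
    rw [← nodeMean_sub, nodeMean, norm_smul, Real.norm_of_nonneg (by positivity), one_div,
      ← div_eq_inv_mul, div_le_iff₀ hn]
    have : ∀ i, ‖gradX (A.localObj i) x z' - gradX (A.localObj i) x z‖
        ≤ L * (L / μ) * ‖x' - x‖ := fun i => by
      refine (hA.norm_gradX_sub_le i x x hzm' hzm).trans ?_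
      rw [sub_self, norm_zero, zero_add, mul_assoc]
      exact mul_le_mul_of_nonneg_left (hA.norm_yStar_sub_le x' x) hL.le
    refine (norm_sum_le _ _).trans ((Finset.sum_le_sum fun i _ => this i).trans_eq ?_)
    simp [mul_comm]
  rw [inner_sub_left] at h5
  have h6 : L * (2 + L / μ) * ‖x' - x‖ ^ 2
      = 2 * (L * ‖x' - x‖ ^ 2) + L * (L / μ) * ‖x' - x‖ ^ 2 := by ring
  have h7 : 0 ≤ L * ‖x' - x‖ ^ 2 := by positivity
  have h8 : 0 ≤ L * (L / μ) * ‖x' - x‖ ^ 2 := by positivity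
  change |A.obj x' z' - A.obj x z - _| ≤ _
  rw [h6, abs_le]
  constructor <;> linarith [h1.1, h1.2, h2.1, h2.2]

lemma hasGradientAt_Phi (hA : A.Regular μ L C) (x : Euc p) :
    HasGradientAt A.Phi (nodeMean fun i => gradX (A.localObj i) x (A.yStar x)) x := by
  rw [hasGradientAt_iff_isLittleO]
  have hbig : (fun x' => A.Phi x' - A.Phi x
      - inner ℝ (nodeMean fun i => gradX (A.localObj i) x (A.yStar x)) (x' - x))
      =O[nhds x] fun x' => ‖x' - x‖ ^ 2 :=
    Asymptotics.IsBigO.of_bound (L * (2 + L / μ)) (Filter.Eventually.of_forall fun x' => by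
      rw [Real.norm_eq_abs, norm_pow, norm_norm]; exact hA.abs_Phi_sub_le x x')
  refine hbig.trans_isLittleO ?_
  refine (Asymptotics.isLittleO_norm_right (g' := fun x' => x' - x)).1 ?_
  have : Filter.Tendsto (fun x' : Euc p => ‖x' - x‖) (nhds x) (nhds 0) := by
    have h : Continuous fun x' : Euc p => ‖x' - x‖ := by fun_prop
    simpa using h.tendsto x
  have h2 := (Asymptotics.isLittleO_one_iff ℝ).2 this
  simpa [pow_two] using
    h2.mul_isBigO (Asymptotics.isBigO_refl (fun x' : Euc p => ‖x' - x‖) (nhds x))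

lemma gradient_Phi (hA : A.Regular μ L C) (x : Euc p) :
    gradient A.Phi x = nodeMean fun i => gradX (A.localObj i) x (A.yStar x) :=
  (hA.hasGradientAt_Phi x).gradient

lemma differentiable_Phi (hA : A.Regular μ L C) : Differentiable ℝ A.Phi :=
  fun x => (hA.hasGradientAt_Phi x).differentiableAt

lemma Phi_le (hA : A.Regular μ L C) (x x' : Euc p) :
    A.Phi x' ≤ A.Phi x + inner ℝ (gradient A.Phi x) (x' - x)
      + L * (2 + L / μ) * ‖x' - x‖ ^ 2 := by
  have := (abs_le.1 (hA.abs_Phi_sub_le x x')).2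
  rw [hA.gradient_Phi]
  linarith

lemma norm_gradient_Phi_le (hA : A.Regular μ L C) (x : Euc p) : ‖gradient A.Phi x‖ ≤ C := by
  have hn : (0 : ℝ) < n := by exact_mod_cast hA.node_pos
  rw [hA.gradient_Phi, nodeMean, norm_smul, Real.norm_of_nonneg (by positivity), one_div,
      ← div_eq_inv_mul, div_le_iff₀ hn]
  refine (norm_sum_le _ _).trans
    ((Finset.sum_le_sum fun i _ => hA.norm_gradX_le i x (hA.yStar_mem x)).trans_eq ?_)
  simp [mul_comm]

lemma continuous_gradX_localObj (hA : A.Regular μ L C) (i : Fin n) :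
    Continuous fun q : Euc p × A.Y => gradX (A.localObj i) q.1 q.2 := by
  have hL := hA.L_pos
  refine (LipschitzWith.of_dist_le_mul (K := ⟨2 * L, by positivity⟩) fun u v => ?_).continuous
  rw [dist_eq_norm]
  refine (hA.norm_gradX_sub_le i u.1 v.1 u.2.2 v.2.2).trans ?_
  have h1 : ‖u.1 - v.1‖ ≤ Dist.dist u v := by
    rw [← dist_eq_norm, Prod.dist_eq]; exact le_max_left _ _
  have h2 : ‖(u.2 : Euc d) - v.2‖ ≤ Dist.dist u v := by
    rw [← dist_eq_norm, Prod.dist_eq]; exact le_max_right _ _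
  change _ ≤ 2 * L * Dist.dist u v
  nlinarith

lemma continuous_gradY_localObj (hA : A.Regular μ L C) (i : Fin n) :
    Continuous fun q : Euc p × A.Y => gradY (A.localObj i) q.1 q.2 := by
  have hL := hA.L_pos
  refine (LipschitzWith.of_dist_le_mul (K := ⟨2 * L, by positivity⟩) fun u v => ?_).continuous
  rw [dist_eq_norm]
  refine (hA.norm_gradY_sub_le i u.1 v.1 u.2.2 v.2.2).trans ?_
  have h1 : ‖u.1 - v.1‖ ≤ Dist.dist u v := by
    rw [← dist_eq_norm, Prod.dist_eq]; exact le_max_left _ _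
  have h2 : ‖(u.2 : Euc d) - v.2‖ ≤ Dist.dist u v := by
    rw [← dist_eq_norm, Prod.dist_eq]; exact le_max_right _ _
  change _ ≤ 2 * L * Dist.dist u v
  nlinarith

lemma continuous_gradient_Phi (hA : A.Regular μ L C) : Continuous (gradient A.Phi) := by
  have : gradient A.Phi = fun x => nodeMean fun i => gradX (A.localObj i) x (A.yStar x) :=
    funext hA.gradient_Phi
  rw [this]
  simp only [nodeMean]
  have h : ∀ i, Continuous fun x => gradX (A.localObj i) x (A.yStar x) := fun i =>
    (hA.continuous_gradX_localObj i).comp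
      (continuous_id.prodMk (hA.continuous_yStar.subtype_mk hA.yStar_mem))
  fun_prop

end Regular

end Problem

/-! ### Gradient accumulators -/

/-- The average of `n` real numbers. -/
noncomputable def avg {n : ℕ} (v : Fin n → ℝ) : ℝ := 1 / (n : ℝ) * ∑ i, v i

lemma avg_nonneg {n : ℕ} {v : Fin n → ℝ} (hv : ∀ i, 0 ≤ v i) : 0 ≤ avg v :=
  mul_nonneg (by positivity) (Finset.sum_nonneg fun i _ => hv i)

lemma avg_le {n : ℕ} (hn : 0 < n) {v : Fin n → ℝ} {b : ℝ} (hv : ∀ i, v i ≤ b) : avg v ≤ b := by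
  have hn' : (0 : ℝ) < n := by positivity
  rw [avg, one_div, ← div_eq_inv_mul, div_le_iff₀ hn']
  exact (Finset.sum_le_sum fun i _ => hv i).trans_eq (by simp [mul_comm])

lemma le_avg {n : ℕ} (hn : 0 < n) {v : Fin n → ℝ} {b : ℝ} (hv : ∀ i, b ≤ v i) : b ≤ avg v := by
  have hn' : (0 : ℝ) < n := by positivity
  rw [avg, one_div, ← div_eq_inv_mul, le_div_iff₀ hn']
  exact le_of_eq_of_le (by simp [mul_comm]) (Finset.sum_le_sum fun i _ => hv i)

/-- The evolution of one family of AdaGrad buffers `m k i`, with increments `h k i ∈ [0, H]`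
(squared gradient norms) that are added locally before the buffers are mixed by `W`. -/
structure Accumulator {n : ℕ} (W : Matrix (Fin n) (Fin n) ℝ) (c H : ℝ)
    (m h : ℕ → Fin n → ℝ) : Prop where
  node_pos : 0 < n
  doublyStochastic : W ∈ doublyStochastic ℝ (Fin n)
  rho_lt_one : rho W < 1
  c_pos : 0 < c
  zero : ∀ i, m 0 i = c
  succ : ∀ k i, m (k + 1) i = ∑ j, W i j * (m k j + h k j)
  nonneg : ∀ k i, 0 ≤ h k i
  le : ∀ k i, h k i ≤ H

namespace Accumulator

variable {n : ℕ} {W : Matrix (Fin n) (Fin n) ℝ} {c H : ℝ} {m h : ℕ → Fin n → ℝ}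

lemma H_nonneg (hm : Accumulator W c H m h) : 0 ≤ H :=
  (hm.nonneg 0 ⟨0, hm.node_pos⟩).trans (hm.le 0 ⟨0, hm.node_pos⟩)

lemma c_le (hm : Accumulator W c H m h) (k : ℕ) (i : Fin n) : c ≤ m k i := by
  induction k generalizing i with
  | zero => rw [hm.zero]
  | succ k ih =>
    rw [hm.succ, ← one_mul c, ← sum_row_of_mem_doublyStochastic hm.doublyStochastic i,
      Finset.sum_mul]
    exact Finset.sum_le_sum fun j _ => mul_le_mul_of_nonneg_left
      (by linarith [ih j, hm.nonneg k j]) (nonneg_of_mem_doublyStochastic hm.doublyStochastic)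

lemma le_add_mul (hm : Accumulator W c H m h) (k : ℕ) (i : Fin n) : m k i ≤ c + k * H := by
  induction k generalizing i with
  | zero => rw [hm.zero]; simp
  | succ k ih =>
    rw [hm.succ, ← one_mul (c + _), ← sum_row_of_mem_doublyStochastic hm.doublyStochastic i,
      Finset.sum_mul]
    refine Finset.sum_le_sum fun j _ => mul_le_mul_of_nonneg_left ?_
      (nonneg_of_mem_doublyStochastic hm.doublyStochastic)
    push_cast
    linarith [ih j, hm.le k j]

lemma avg_succ (hm : Accumulator W c H m h) (k : ℕ) :
    avg (m (k + 1)) = avg (m k) + avg (h k) := by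
  have := sum_mix hm.doublyStochastic fun j => m k j + h k j
  simp only [smul_eq_mul] at this
  simp only [avg, hm.succ]
  rw [this, Finset.sum_add_distrib, mul_add]

lemma avg_le_succ (hm : Accumulator W c H m h) (k : ℕ) : avg (m k) ≤ avg (m (k + 1)) := by
  rw [hm.avg_succ]
  linarith [avg_nonneg (hm.nonneg k)]

lemma avg_succ_le (hm : Accumulator W c H m h) (k : ℕ) : avg (m (k + 1)) ≤ avg (m k) + H := by
  rw [hm.avg_succ]
  linarith [avg_le hm.node_pos (hm.le k)]

lemma c_le_avg (hm : Accumulator W c H m h) (k : ℕ) : c ≤ avg (m k) :=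
  le_avg hm.node_pos (hm.c_le k)

lemma avg_le_add_mul (hm : Accumulator W c H m h) (k : ℕ) : avg (m k) ≤ c + k * H :=
  avg_le hm.node_pos (hm.le_add_mul k)

/-- The buffers stay within `O(1 / (1 - ρ))` of their average. -/
lemma abs_sub_avg_le (hm : Accumulator W c H m h) (k : ℕ) (i : Fin n) :
    |m k i - avg (m k)| ≤ 2 * n * H / (1 - rho W) := by
  have hs : 0 < 1 - rho W := by linarith [hm.rho_lt_one]
  have hn : (1 : ℝ) ≤ n := by exact_mod_cast hm.node_pos
  have hH := hm.H_nonneg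
  set s := 1 - rho W with hsdef
  have hb : ∑ i, (m k i - avg (m k)) ^ 2 ≤ 4 * n * H ^ 2 / s ^ 2 := by
    induction k with
    | zero =>
      have : ∀ i, m 0 i - avg (m 0) = 0 := fun i => by
        have h1 := le_antisymm (avg_le hm.node_pos fun i => (hm.zero i).le)
          (le_avg hm.node_pos fun i => (hm.zero i).ge)
        rw [hm.zero, h1, sub_self]
      simp only [this]
      simp only [ne_eq, OfNat.ofNat_ne_zero, not_false_eq_true, zero_pow, Finset.sum_const_zero]
      positivity
    | succ k ih =>
      have h1 := sum_mix_add_sub_sq_le hm.node_pos hm.doublyStochastic hm.rho_lt_one (m k) (h k)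
      have e : ∑ i, (m (k + 1) i - avg (m (k + 1))) ^ 2
          = ∑ i, (∑ j, W i j * (m k j + h k j) - 1 / (n : ℝ) * ∑ j, (m k j + h k j)) ^ 2 := by
        refine Finset.sum_congr rfl fun i _ => ?_
        rw [hm.succ, hm.avg_succ, avg, avg, Finset.sum_add_distrib, mul_add]
      have h2 : ∑ i, h k i ^ 2 ≤ n * H ^ 2 := by
        refine (Finset.sum_le_sum fun i _ =>
          pow_le_pow_left₀ (hm.nonneg k i) (hm.le k i) 2).trans_eq ?_
        simp
      have hs1 : s ≤ 1 := by have := rho_nonneg W; linarith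
      rw [e]
      refine h1.trans ?_
      calc _ ≤ (1 - s / 2) * (4 * n * H ^ 2 / s ^ 2) + 2 / s * (n * H ^ 2) := by
            have : 0 ≤ 1 - s / 2 := by linarith
            gcongr
            exact ih
        _ = _ := by field_simp; ring
  have h3 : (m k i - avg (m k)) ^ 2 ≤ (2 * n * H / s) ^ 2 := by
    refine (Finset.single_le_sum (f := fun i => (m k i - avg (m k)) ^ 2)
      (fun i _ => sq_nonneg _) (Finset.mem_univ i)).trans (hb.trans ?_)
    rw [div_pow, mul_pow, mul_pow]
    gcongr
    · norm_num
    · nlinarith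
  exact abs_le_of_sq_le_sq h3 (by positivity)

/-- The logarithmic potential `∑ i, log m_i` does not decrease when the buffers are mixed, so it
controls the increments relative to the *local* buffers, uniformly in the network. -/
lemma sum_div_le (hm : Accumulator W c H m h) (K : ℕ) :
    ∑ k ∈ Finset.range K, ∑ i, h k i / (m k i + h k i) ≤ n * Real.log ((c + K * H) / c) := by
  have hc := hm.c_pos
  have hpos : ∀ k i, 0 < m k i := fun k i => hc.trans_le (hm.c_le k i)
  have hpos' : ∀ k i, 0 < m k i + h k i := fun k i => by linarith [hpos k i, hm.nonneg k i]
  have key : ∀ k, ∑ i, h k i / (m k i + h k i)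
      ≤ ∑ i, Real.log (m (k + 1) i) - ∑ i, Real.log (m k i) := fun k => by
    have h1 : ∑ i, -Real.log (m (k + 1) i) ≤ ∑ j, -Real.log (m k j + h k j) := by
      have := sum_convex_mix_le hm.doublyStochastic (φ := fun u => -Real.log u)
        strictConcaveOn_log_Ioi.concaveOn.neg (v := fun j => m k j + h k j) fun j => hpos' k j
      simpa only [hm.succ, smul_eq_mul] using this
    have h2 : ∀ i, h k i / (m k i + h k i) ≤ Real.log (m k i + h k i) - Real.log (m k i) := by
      intro i
      rw [← Real.log_div (hpos' k i).ne' (hpos k i).ne']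
      have := Real.one_sub_inv_le_log_of_pos (div_pos (hpos' k i) (hpos k i))
      refine le_trans (le_of_eq ?_) this
      have := (hpos k i).ne'
      have := (hpos' k i).ne'
      field_simp
      ring
    have h3 := Finset.sum_le_sum fun i (_ : i ∈ Finset.univ) => h2 i
    rw [Finset.sum_sub_distrib] at h3
    rw [Finset.sum_neg_distrib, Finset.sum_neg_distrib] at h1
    linarith
  refine (Finset.sum_le_sum fun k _ => key k).trans ?_
  rw [Finset.sum_range_sub fun k => ∑ i, Real.log (m k i)]
  have h0 : ∑ i, Real.log (m 0 i) = n * Real.log c := by simp [hm.zero]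
  have hK : ∑ i, Real.log (m K i) ≤ n * Real.log (c + K * H) := by
    refine (Finset.sum_le_sum fun i _ => Real.log_le_log (hpos K i) (hm.le_add_mul K i)).trans_eq ?_
    simp
  have hH := hm.H_nonneg
  rw [Real.log_div (by positivity) hc.ne']
  linarith

lemma sum_div_rpow_le (hm : Accumulator W c H m h) (t : ℝ) (K : ℕ) :
    ∑ k ∈ Finset.range K, ∑ i, h k i / (m k i + h k i) ^ t
      ≤ n * Real.log ((c + K * H) / c) * (c ^ (1 - t) + (c + K * H) ^ (1 - t)) := by
  have hc := hm.c_pos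
  have hH := hm.H_nonneg
  refine le_trans ?_ (mul_le_mul_of_nonneg_right (hm.sum_div_le K) (by positivity))
  rw [Finset.sum_mul]
  refine Finset.sum_le_sum fun k hk => ?_
  rw [Finset.sum_mul]
  refine Finset.sum_le_sum fun i _ => ?_
  have hlow : c ≤ m k i + h k i := by linarith [hm.c_le k i, hm.nonneg k i]
  have hpos := hc.trans_le hlow
  have hup : m k i + h k i ≤ c + K * H := by
    have h1 : ((k : ℝ) + 1) ≤ K := by exact_mod_cast Finset.mem_range.1 hk
    have := mul_le_mul_of_nonneg_right h1 hH
    linarith [hm.le_add_mul k i, hm.le k i]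
  have e : h k i / (m k i + h k i) ^ t
      = h k i / (m k i + h k i) * (m k i + h k i) ^ (1 - t) := by
    rw [Real.rpow_sub hpos, Real.rpow_one]
    field_simp
  rw [e]
  refine mul_le_mul_of_nonneg_left ?_ (div_nonneg (hm.nonneg k i) hpos.le)
  have h1 : 0 ≤ c ^ (1 - t) := by positivity
  have h2 : 0 ≤ (c + K * H) ^ (1 - t) := by positivity
  rcases le_total 0 (1 - t) with ht | ht
  · exact (Real.rpow_le_rpow hpos.le hup ht).trans (by linarith)
  · exact (Real.rpow_le_rpow_of_nonpos hc hlow ht).trans (by linarith)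

end Accumulator

/-! ### One iteration -/

section Stepsizes

variable {n : ℕ} {t S γ V : ℝ} {m v h : Fin n → ℝ}

lemma rpow_sub_rpow_le {a b : ℝ} (ht0 : 0 ≤ t) (ht1 : t ≤ 1) (ha : 0 ≤ a) (hS : 0 ≤ S)
    (hb : b ≤ a + 2 * S) (hb0 : 0 ≤ b) : b ^ t ≤ a ^ t + (2 * S) ^ t :=
  (Real.rpow_le_rpow hb0 hb ht0).trans
    (Real.rpow_add_le_add_rpow ha (by positivity) ht0 ht1)

/-- Replacing the local stepsizes `γ / v_i ^ t` by the common one `γ / V ^ t` costs a second-order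
term, because `V ^ t - v_i ^ t ≤ (2 S) ^ t`. -/
lemma sum_stepsize_sub_sq_le (ht0 : 0 ≤ t) (ht1 : t ≤ 1) (hS : 0 ≤ S) (hγ : 0 < γ)
    (hm : ∀ i, 0 < m i) (hmv : ∀ i, m i ≤ v i) (hvV : ∀ i, v i ≤ V) (hV : 0 < V)
    (hVv : ∀ i, V ≤ v i + 2 * S) (hh : ∀ i, 0 ≤ h i) :
    ∑ i, (γ / v i ^ t - γ / V ^ t) ^ 2 * h i
      ≤ (γ / V ^ t) ^ 2 * ((2 * S) ^ (2 * t) * ∑ i, h i / m i ^ (2 * t)) := by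
  rw [Finset.mul_sum, Finset.mul_sum]
  refine Finset.sum_le_sum fun i _ => ?_
  have hv : 0 < v i := (hm i).trans_le (hmv i)
  have hvt : 0 < v i ^ t := Real.rpow_pos_of_pos hv t
  have hVt : 0 < V ^ t := Real.rpow_pos_of_pos hV t
  have h1 : v i ^ t ≤ V ^ t := Real.rpow_le_rpow hv.le (hvV i) ht0
  have h2 := rpow_sub_rpow_le ht0 ht1 hv.le hS (hVv i) hV.le
  have h3 : m i ^ (2 * t) ≤ (v i ^ t) ^ 2 := by
    rw [← Real.rpow_mul_natCast hv.le, mul_comm t]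
    exact Real.rpow_le_rpow (hm i).le (hmv i) (by positivity)
  have hmt : 0 < m i ^ (2 * t) := Real.rpow_pos_of_pos (hm i) _
  have hS2 : ((2 * S) ^ t) ^ 2 = (2 * S) ^ (2 * t) := by
    rw [← Real.rpow_mul_natCast (by positivity), mul_comm t]; norm_num
  have e : (γ / v i ^ t - γ / V ^ t) ^ 2 * h i
      = (γ / V ^ t) ^ 2 * ((V ^ t - v i ^ t) ^ 2 * (h i / (v i ^ t) ^ 2)) := by
    field_simp
  rw [e]
  refine mul_le_mul_of_nonneg_left ?_ (sq_nonneg _)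
  refine mul_le_mul ?_ ?_ (div_nonneg (hh i) (sq_nonneg _)) (by positivity)
  · rw [← hS2]
    exact pow_le_pow_left₀ (by linarith) (by linarith) 2
  · exact div_le_div_of_nonneg_left (hh i) hmt h3

lemma sum_stepsize_sq_le (ht0 : 0 ≤ t)
    (hm : ∀ i, 0 < m i) (hmv : ∀ i, m i ≤ v i) (hh : ∀ i, 0 ≤ h i) :
    ∑ i, (γ / v i ^ t) ^ 2 * h i ≤ γ ^ 2 * ∑ i, h i / m i ^ (2 * t) := by
  rw [Finset.mul_sum]
  refine Finset.sum_le_sum fun i _ => ?_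
  have hv : 0 < v i := (hm i).trans_le (hmv i)
  have h3 : m i ^ (2 * t) ≤ (v i ^ t) ^ 2 := by
    rw [← Real.rpow_mul_natCast hv.le, mul_comm t]
    exact Real.rpow_le_rpow (hm i).le (hmv i) (by positivity)
  have hmt : 0 < m i ^ (2 * t) := Real.rpow_pos_of_pos (hm i) _
  rw [div_pow, div_mul_eq_mul_div, ← mul_div_assoc]
  exact div_le_div_of_nonneg_left (mul_nonneg (sq_nonneg _) (hh i)) hmt h3

lemma sum_stepsize_sq_le_mul (ht0 : 0 ≤ t) (ht1 : t ≤ 1) (hS : 0 ≤ S) (hγ : 0 < γ)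
    (hm : ∀ i, 0 < m i) (hmv : ∀ i, m i ≤ v i) (hV : 0 < V)
    (hVv : ∀ i, V ≤ v i + 2 * S) (hh : ∀ i, 0 ≤ h i) :
    ∑ i, (γ / v i ^ t) ^ 2 * h i
      ≤ γ / V ^ t * (γ * (∑ i, h i / m i ^ t + (2 * S) ^ t * ∑ i, h i / m i ^ (2 * t))) := by
  rw [Finset.mul_sum, ← Finset.sum_add_distrib, Finset.mul_sum, Finset.mul_sum]
  refine Finset.sum_le_sum fun i _ => ?_
  have hv : 0 < v i := (hm i).trans_le (hmv i)
  have hvt : 0 < v i ^ t := Real.rpow_pos_of_pos hv t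
  have hVt : 0 < V ^ t := Real.rpow_pos_of_pos hV t
  have h2 := rpow_sub_rpow_le ht0 ht1 hv.le hS (hVv i) hV.le
  have h3 : m i ^ (2 * t) ≤ (v i ^ t) ^ 2 := by
    rw [← Real.rpow_mul_natCast hv.le, mul_comm t]
    exact Real.rpow_le_rpow (hm i).le (hmv i) (by positivity)
  have h4 : m i ^ t ≤ v i ^ t := Real.rpow_le_rpow (hm i).le (hmv i) ht0
  have hmt : 0 < m i ^ (2 * t) := Real.rpow_pos_of_pos (hm i) _
  have hmt' : 0 < m i ^ t := Real.rpow_pos_of_pos (hm i) _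
  have hi := hh i
  calc (γ / v i ^ t) ^ 2 * h i = γ / V ^ t * (γ * (h i * V ^ t / (v i ^ t) ^ 2)) := by field_simp
    _ ≤ γ / V ^ t * (γ * (h i * (v i ^ t + (2 * S) ^ t) / (v i ^ t) ^ 2)) := by gcongr
    _ = γ / V ^ t * (γ * (h i / v i ^ t + (2 * S) ^ t * (h i / (v i ^ t) ^ 2))) := by field_simp
    _ ≤ _ := by gcongr

end Stepsizes

namespace Problem.Regular

variable {n p d : ℕ} {Ξ : Type*} [MeasurableSpace Ξ] {A : Problem n p d Ξ} {μ L C : ℝ}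

/-- The descent inequality for `Φ`, divided by the common stepsize `η`. The increment of the
averaged iterate is `-(η • g + e)`, where `G` is the conditional expectation of `g`. -/
lemma descent_step (hA : A.Regular μ L C) {x x' g G e : Euc p} {η : ℝ} (hη : 0 < η)
    (hx' : x' = x - (η • g + e)) :
    1 / 4 * ‖gradient A.Phi x‖ ^ 2
      ≤ 1 / 2 * ‖gradient A.Phi x - G‖ ^ 2 + 1 / η * (A.Phi x - A.Phi x') + ‖e‖ ^ 2 / η ^ 2
        + L * (2 + L / μ) * (‖η • g + e‖ ^ 2 / η) - inner ℝ (gradient A.Phi x) (g - G) := by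
  have h := hA.Phi_le x x'
  set D := gradient A.Phi x
  set c := L * (2 + L / μ)
  have e1 : x' - x = -(η • g + e) := by rw [hx']; abel
  rw [e1, norm_neg, inner_neg_right, inner_add_right, real_inner_smul_right] at h
  have h1 : inner ℝ D g ≤ 1 / η * (A.Phi x - A.Phi x') - inner ℝ D e / η
      + c * (‖η • g + e‖ ^ 2 / η) := by
    have : η * inner ℝ D g ≤ η * (1 / η * (A.Phi x - A.Phi x') - inner ℝ D e / η
      + c * (‖η • g + e‖ ^ 2 / η)) := by
      have : η * (1 / η * (A.Phi x - A.Phi x') - inner ℝ D e / η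
        + c * (‖η • g + e‖ ^ 2 / η)) = (A.Phi x - A.Phi x') - inner ℝ D e
          + c * ‖η • g + e‖ ^ 2 := by field_simp
      rw [this]; linarith
    exact le_of_mul_le_mul_left this hη
  have h2 : -(inner ℝ D e / η) ≤ 1 / 4 * ‖D‖ ^ 2 + ‖e‖ ^ 2 / η ^ 2 := by
    have h3 := (abs_le.1 (abs_real_inner_le_norm D e)).1
    have h4 : -(inner ℝ D e / η) ≤ ‖D‖ * (‖e‖ / η) := by
      rw [← neg_div, ← mul_div_assoc]
      exact div_le_div_of_nonneg_right (by linarith) hη.le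
    rw [← div_pow]
    nlinarith [sq_nonneg (1 / 2 * ‖D‖ - ‖e‖ / η)]
  have h5 : ‖D - G‖ ^ 2 = ‖D‖ ^ 2 - 2 * inner ℝ D G + ‖G‖ ^ 2 := norm_sub_sq_real D G
  rw [inner_sub_right]
  nlinarith [sq_nonneg ‖G‖]

/-- The average of the local `x`-gradients approximates `∇Φ` at the averaged iterate. -/
lemma norm_gradient_Phi_sub_sq_le (hA : A.Regular μ L C) (x : Fin n → Euc p) (y : Fin n → Euc d)
    (hy : ∀ i, y i ∈ A.Y) (w : Euc p) :
    ‖gradient A.Phi (nodeMean x) - nodeMean fun i => gradX (A.localObj i) (x i) (y i)‖ ^ 2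
      ≤ L ^ 2 / n * (∑ i, ‖x i - nodeMean x‖ ^ 2 + 2 * ∑ i, ‖y i - A.yStar w‖ ^ 2
        + 2 * n * (L / μ) ^ 2 * ‖nodeMean x - w‖ ^ 2) := by
  have hn : (0 : ℝ) < n := by exact_mod_cast hA.node_pos
  have hL := hA.L_pos
  rw [hA.gradient_Phi, ← nodeMean_sub]
  refine (norm_nodeMean_sq_le hA.node_pos _).trans ?_
  have h1 : ∀ i, ‖gradX (A.localObj i) (nodeMean x) (A.yStar (nodeMean x))
      - gradX (A.localObj i) (x i) (y i)‖ ^ 2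
      ≤ L ^ 2 * (‖x i - nodeMean x‖ ^ 2 + 2 * ‖y i - A.yStar w‖ ^ 2
        + 2 * (L / μ) ^ 2 * ‖nodeMean x - w‖ ^ 2) := fun i => by
    refine (hA.smooth.lipX i _ _ _ (hA.yStar_mem _) _ (hy i)).trans ?_
    refine mul_le_mul_of_nonneg_left ?_ (sq_nonneg _)
    have h2 := norm_add_le (A.yStar (nodeMean x) - A.yStar w) (A.yStar w - y i)
    rw [sub_add_sub_cancel] at h2
    have h3 := hA.norm_yStar_sub_le (nodeMean x) w
    rw [norm_sub_rev (nodeMean x) (x i), norm_sub_rev (y i)]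
    have h4 : ‖A.yStar (nodeMean x) - y i‖
        ≤ L / μ * ‖nodeMean x - w‖ + ‖A.yStar w - y i‖ := by linarith
    have h5 := pow_le_pow_left₀ (norm_nonneg _) h4 2
    nlinarith [sq_nonneg (L / μ * ‖nodeMean x - w‖ - ‖A.yStar w - y i‖)]
  refine (mul_le_mul_of_nonneg_left (Finset.sum_le_sum fun i _ => h1 i)
    (by positivity)).trans_eq ?_
  simp only [← Finset.mul_sum, Finset.sum_add_distrib, Finset.sum_const, Finset.card_univ,
    Fintype.card_fin, nsmul_eq_mul]
  field_simp

/-- The drift of the dual iterates towards the maximizer `z = y*(w)` of a reference point `w`. The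
last sum appears because only the average of the local gradients satisfies the optimality
condition at `z`, and the condition is tested at the average of the `y i`. -/
lemma sum_inner_gradY_le (hA : A.Regular μ L C) (x : Fin n → Euc p) (y : Fin n → Euc d)
    (hy : ∀ i, y i ∈ A.Y) (w : Euc p) :
    ∑ i, inner ℝ (gradY (A.localObj i) (x i) (y i)) (y i - A.yStar w)
      ≤ -(3 * μ / 4) * ∑ i, ‖y i - A.yStar w‖ ^ 2
        + (2 * L ^ 2 / μ + L / 2) * (∑ i, ‖x i - w‖ ^ 2 + ∑ i, ‖y i - nodeMean y‖ ^ 2)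
        + ∑ i, ‖gradY (A.localObj i) (x i) (y i)‖ * ‖y i - nodeMean y‖ := by
  have hμ := hA.mu_pos
  have hL := hA.L_pos
  have hn : (0 : ℝ) < n := by exact_mod_cast hA.node_pos
  set z := A.yStar w with hz
  have hzm : z ∈ A.Y := hA.yStar_mem w
  have hbar : nodeMean y ∈ A.Y := by
    rw [nodeMean, Finset.smul_sum]
    refine hA.wellPosed.convex.sum_mem (fun i _ => by positivity) ?_ fun i _ => hy i
    simp only [Finset.sum_const, Finset.card_univ, Fintype.card_fin, nsmul_eq_mul]
    field_simp
  have hvi := hA.sum_inner_gradY_yStar_nonpos w hbar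
  have hpt : ∀ i, inner ℝ (gradY (A.localObj i) (x i) (y i)) (y i - z)
      ≤ inner ℝ (gradY (A.localObj i) w z) (nodeMean y - z)
        + (-(3 * μ / 4) * ‖y i - z‖ ^ 2
          + (2 * L ^ 2 / μ + L / 2) * (‖x i - w‖ ^ 2 + ‖y i - nodeMean y‖ ^ 2)
          + ‖gradY (A.localObj i) (x i) (y i)‖ * ‖y i - nodeMean y‖) := fun i => by
    set a := gradY (A.localObj i) (x i) (y i)
    set b := gradY (A.localObj i) w (y i)
    set c := gradY (A.localObj i) w z
    have h1 : inner ℝ (a - b) (y i - z) ≤ L * ‖x i - w‖ * ‖y i - z‖ := by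
      refine (real_inner_le_norm _ _).trans (mul_le_mul_of_nonneg_right ?_ (norm_nonneg _))
      simpa using hA.norm_gradY_sub_le i (x i) w (hy i) (hy i)
    have h2 : inner ℝ (b - c) (y i - z) ≤ -(μ * ‖y i - z‖ ^ 2) :=
      hA.inner_gradY_sub_le i w (hy i) hzm
    have h3 : inner ℝ c (y i - nodeMean y)
        ≤ (‖a‖ + L * (‖x i - w‖ + ‖y i - z‖)) * ‖y i - nodeMean y‖ := by
      refine (real_inner_le_norm _ _).trans (mul_le_mul_of_nonneg_right ?_ (norm_nonneg _))
      have h4 := hA.norm_gradY_sub_le i (x i) w (hy i) hzm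
      have h5 := norm_sub_norm_le c a
      rw [norm_sub_rev] at h5
      linarith
    have e : inner ℝ a (y i - z) = inner ℝ (a - b) (y i - z) + inner ℝ (b - c) (y i - z)
        + inner ℝ c (y i - nodeMean y) + inner ℝ c (nodeMean y - z) := by
      simp only [inner_sub_left, inner_sub_right]; ring
    set X := ‖x i - w‖
    set E := ‖y i - z‖
    set D := ‖y i - nodeMean y‖
    have q1 : L * X * E ≤ μ / 8 * E ^ 2 + 2 * L ^ 2 / μ * X ^ 2 := by
      have : μ / 8 * E ^ 2 + 2 * L ^ 2 / μ * X ^ 2 - L * X * E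
          = (μ * E - 4 * L * X) ^ 2 / (8 * μ) := by field_simp; ring
      have : 0 ≤ (μ * E - 4 * L * X) ^ 2 / (8 * μ) := by positivity
      linarith
    have q2 : L * E * D ≤ μ / 8 * E ^ 2 + 2 * L ^ 2 / μ * D ^ 2 := by
      have : μ / 8 * E ^ 2 + 2 * L ^ 2 / μ * D ^ 2 - L * E * D
          = (μ * E - 4 * L * D) ^ 2 / (8 * μ) := by field_simp; ring
      have : 0 ≤ (μ * E - 4 * L * D) ^ 2 / (8 * μ) := by positivity
      linarith
    have q3 : L * X * D ≤ L / 2 * (X ^ 2 + D ^ 2) := by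
      nlinarith [mul_nonneg hL.le (sq_nonneg (X - D))]
    rw [e]
    nlinarith
  refine (Finset.sum_le_sum fun i _ => hpt i).trans ?_
  rw [Finset.sum_add_distrib]
  have e2 : ∑ i, (-(3 * μ / 4) * ‖y i - z‖ ^ 2
      + (2 * L ^ 2 / μ + L / 2) * (‖x i - w‖ ^ 2 + ‖y i - nodeMean y‖ ^ 2)
      + ‖gradY (A.localObj i) (x i) (y i)‖ * ‖y i - nodeMean y‖)
      = -(3 * μ / 4) * ∑ i, ‖y i - z‖ ^ 2
        + (2 * L ^ 2 / μ + L / 2) * (∑ i, ‖x i - w‖ ^ 2 + ∑ i, ‖y i - nodeMean y‖ ^ 2)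
        + ∑ i, ‖gradY (A.localObj i) (x i) (y i)‖ * ‖y i - nodeMean y‖ := by
    simp only [Finset.sum_add_distrib, ← Finset.mul_sum]
  rw [e2]
  linarith

end Problem.Regular

/-- The distance `r` between the averaged iterate and its slow tracker contracts. -/
lemma tracker_step {p : ℕ} {r g G e : Euc p} {η θ l : ℝ} (hη : 0 < η) (hθ : 0 < θ)
    (hl : 0 < l) (hlθ : l * θ ≤ 1) :
    1 / θ * ‖(1 - l * θ) • r - (η • g + e)‖ ^ 2
      ≤ (1 / θ - l / 2) * ‖r‖ ^ 2 + 4 / l * ((η / θ) ^ 2 * ‖G‖ ^ 2 + ‖e‖ ^ 2 / θ ^ 2)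
        + ‖η • g + e‖ ^ 2 / θ - 2 * (1 - l * θ) * (η / θ) * inner ℝ r (g - G) := by
  set D := η • g + e
  have hD : D = η • (g - G) + (η • G + e) := by
    simp only [D, smul_sub]; abel
  have h1 : ‖(1 - l * θ) • r - D‖ ^ 2
      = (1 - l * θ) ^ 2 * ‖r‖ ^ 2 - 2 * (1 - l * θ) * (η * inner ℝ r (g - G)
        + inner ℝ r (η • G + e)) + ‖D‖ ^ 2 := by
    rw [norm_sub_sq_real, norm_smul, mul_pow, Real.norm_eq_abs, sq_abs, real_inner_smul_left,
      show inner ℝ r D = inner ℝ r (η • (g - G) + (η • G + e)) by rw [← hD],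
      inner_add_right, real_inner_smul_right]
    ring
  have hlθ0 : 0 < l * θ := by positivity
  have h2 : -(2 * (1 - l * θ) * inner ℝ r (η • G + e))
      ≤ l * θ / 2 * ‖r‖ ^ 2 + 4 / (l * θ) * (η ^ 2 * ‖G‖ ^ 2 + ‖e‖ ^ 2) := by
    have h3 := (abs_le.1 (abs_real_inner_le_norm r (η • G + e))).1
    set N := ‖η • G + e‖
    have hN : N ^ 2 ≤ 2 * (η ^ 2 * ‖G‖ ^ 2 + ‖e‖ ^ 2) := by
      have h4 : N ≤ η * ‖G‖ + ‖e‖ := (norm_add_le _ _).trans_eq (by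
        rw [norm_smul, Real.norm_of_nonneg hη.le])
      have h5 := pow_le_pow_left₀ (norm_nonneg _) h4 2
      nlinarith [sq_nonneg (η * ‖G‖ - ‖e‖)]
    have h6 : -(2 * (1 - l * θ) * inner ℝ r (η • G + e)) ≤ 2 * (‖r‖ * N) := by
      have : 0 ≤ ‖r‖ * N := by positivity
      nlinarith
    have h7 : 2 * (‖r‖ * N) ≤ l * θ / 2 * ‖r‖ ^ 2 + 2 / (l * θ) * N ^ 2 := by
      have : l * θ / 2 * ‖r‖ ^ 2 + 2 / (l * θ) * N ^ 2 - 2 * (‖r‖ * N)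
          = (l * θ * ‖r‖ - 2 * N) ^ 2 / (2 * (l * θ)) := by field_simp; ring
      have : 0 ≤ (l * θ * ‖r‖ - 2 * N) ^ 2 / (2 * (l * θ)) := by positivity
      linarith
    have h8 : 2 / (l * θ) * N ^ 2 ≤ 4 / (l * θ) * (η ^ 2 * ‖G‖ ^ 2 + ‖e‖ ^ 2) := by
      calc 2 / (l * θ) * N ^ 2 ≤ 2 / (l * θ) * (2 * (η ^ 2 * ‖G‖ ^ 2 + ‖e‖ ^ 2)) := by gcongr
        _ = _ := by ring
    linarith
  have h9 : (1 - l * θ) ^ 2 * ‖r‖ ^ 2 ≤ (1 - l * θ) * ‖r‖ ^ 2 := by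
    refine mul_le_mul_of_nonneg_right ?_ (sq_nonneg _)
    nlinarith
  have h10 : ‖(1 - l * θ) • r - D‖ ^ 2 ≤ (1 - l * θ / 2) * ‖r‖ ^ 2
      + 4 / (l * θ) * (η ^ 2 * ‖G‖ ^ 2 + ‖e‖ ^ 2) + ‖D‖ ^ 2
      - 2 * (1 - l * θ) * η * inner ℝ r (g - G) := by
    rw [h1]; linarith
  refine (mul_le_mul_of_nonneg_left h10 (by positivity)).trans_eq ?_
  field_simp

/-- The arithmetic that combines the dual step with the move of the reference point. -/
lemma dual_combine {μ θ E E₁ E₂ B M Q P R : ℝ} (hμ : 0 < μ) (hθ : 0 < θ) (hμθ : μ * θ ≤ 1)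
    (hE : 0 ≤ E) (hB : 0 ≤ B) (hQ : 0 ≤ Q) (hP : 0 ≤ P)
    (h1 : E₁ ≤ (1 - 5 / 4 * (μ * θ)) * E + 2 * θ * B + 2 * θ * M + 4 / (μ * θ) * Q + P)
    (h2 : E₂ ≤ (1 + μ * θ / 4) * E₁ + μ * θ * R) :
    1 / θ * E₂ ≤ (1 / θ - μ) * E + 4 * B + 8 / μ * (Q / θ ^ 2) + 2 * (P / θ) + μ * R
      + 2 * (1 + μ * θ / 4) * M := by
  have hμθ0 : 0 < μ * θ := by positivity
  have h3 : (1 + μ * θ / 4) * E₁ ≤ (1 - μ * θ) * E + 4 * θ * B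
      + 2 * (1 + μ * θ / 4) * θ * M + 8 / (μ * θ) * Q + 2 * P := by
    have h1 := mul_le_mul_of_nonneg_left h1 (by positivity : 0 ≤ 1 + μ * θ / 4)
    have h2 : (1 + μ * θ / 4) * ((1 - 5 / 4 * (μ * θ)) * E) ≤ (1 - μ * θ) * E := by
      rw [← mul_assoc]
      refine mul_le_mul_of_nonneg_right ?_ hE
      nlinarith
    have h3 : (1 + μ * θ / 4) * (2 * θ * B + 4 / (μ * θ) * Q + P)
        ≤ 2 * (2 * θ * B + 4 / (μ * θ) * Q + P) :=
      mul_le_mul_of_nonneg_right (by linarith) (by positivity)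
    have e : 2 * (4 / (μ * θ) * Q) = 8 / (μ * θ) * Q := by ring
    linarith
  have h4 : E₂ ≤ (1 - μ * θ) * E + 4 * θ * B
      + 2 * (1 + μ * θ / 4) * θ * M + 8 / (μ * θ) * Q + 2 * P + μ * θ * R := by linarith
  refine (mul_le_mul_of_nonneg_left h4 (by positivity : 0 ≤ 1 / θ)).trans_eq ?_
  field_simp
  ring

namespace Problem.Regular

variable {n p d : ℕ} {Ξ : Type*} [MeasurableSpace Ξ] {A : Problem n p d Ξ} {μ L C : ℝ}

/-- One dual step, measured from the maximizers `y*(w)` and `y*(w')` of the slow tracker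
`w' = w + μ θ (x̄ - w)`, divided by the common stepsize `θ`. The last sum has conditional
expectation zero. -/
lemma dual_step (hA : A.Regular μ L C) {W : Matrix (Fin n) (Fin n) ℝ}
    (hW : W ∈ doublyStochastic ℝ (Fin n)) (x : Fin n → Euc p) (y g y' : Fin n → Euc d)
    (hy : ∀ i, y i ∈ A.Y) (θj : Fin n → ℝ) (w w' : Euc p) {θ b : ℝ} (hθ : 0 < θ) (hb : 0 < b)
    (hμθ : μ * θ ≤ 1) (hw' : w' = w + (μ * θ) • (nodeMean x - w))
    (hy' : ∀ i, y' i = proj A.Y (∑ j, W i j • (y j + θj j • g j))) :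
    1 / θ * ∑ i, ‖y' i - A.yStar w'‖ ^ 2
      ≤ (1 / θ - μ) * ∑ i, ‖y i - A.yStar w‖ ^ 2
        + 4 * ((2 * L ^ 2 / μ + L / 2) * (2 * ∑ i, ‖x i - nodeMean x‖ ^ 2
            + 2 * n * ‖nodeMean x - w‖ ^ 2 + ∑ i, ‖y i - nodeMean y‖ ^ 2)
          + (1 / (2 * b) * ∑ i, ‖g i‖ ^ 2 + b / 2 * ∑ i, ‖y i - nodeMean y‖ ^ 2))
        + 8 / μ * ((∑ i, (θj i - θ) ^ 2 * ‖g i‖ ^ 2) / θ ^ 2)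
        + 2 * ((∑ i, θj i ^ 2 * ‖g i‖ ^ 2) / θ)
        + 8 * n * (L / μ) ^ 2 * μ * ‖nodeMean x - w‖ ^ 2
        + 2 * (1 + μ * θ / 4) * ∑ i, inner ℝ (y i - A.yStar w
            - (1 / b) • gradY (A.localObj i) (x i) (y i))
            (g i - gradY (A.localObj i) (x i) (y i)) := by
  have hμ := hA.mu_pos
  have hL := hA.L_pos
  have hn : (0 : ℝ) < n := by exact_mod_cast hA.node_pos
  set z := A.yStar w with hz
  set z' := A.yStar w' with hz'
  have hzm : z ∈ A.Y := hA.yStar_mem w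
  set G : Fin n → Euc d := fun i => gradY (A.localObj i) (x i) (y i) with hG
  set E := ∑ i, ‖y i - z‖ ^ 2 with hE
  set DX := ∑ i, ‖x i - nodeMean x‖ ^ 2 with hDX
  set DY := ∑ i, ‖y i - nodeMean y‖ ^ 2 with hDY
  set R := ‖nodeMean x - w‖ ^ 2 with hR
  set H := ∑ i, ‖g i‖ ^ 2 with hH
  set Q := ∑ i, (θj i - θ) ^ 2 * ‖g i‖ ^ 2 with hQ
  set P := ∑ i, θj i ^ 2 * ‖g i‖ ^ 2 with hP
  set cL := 2 * L ^ 2 / μ + L / 2 with hcL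
  set MM := ∑ i, inner ℝ (y i - z - (1 / b) • G i) (g i - G i) with hMM
  have hE0 : 0 ≤ E := Finset.sum_nonneg fun i _ => by positivity
  have hDX0 : 0 ≤ DX := Finset.sum_nonneg fun i _ => by positivity
  have hDY0 : 0 ≤ DY := Finset.sum_nonneg fun i _ => by positivity
  have hR0 : 0 ≤ R := by positivity
  have hH0 : 0 ≤ H := Finset.sum_nonneg fun i _ => by positivity
  have hQ0 : 0 ≤ Q := Finset.sum_nonneg fun i _ => by positivity
  have hP0 : 0 ≤ P := Finset.sum_nonneg fun i _ => by positivity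
  have hcL0 : 0 ≤ cL := by positivity
  -- the projected and mixed iterates, relative to the old reference point
  have s1 : ∑ i, ‖y' i - z‖ ^ 2 ≤ ∑ i, ‖y i + θj i • g i - z‖ ^ 2 := by
    refine le_trans (Finset.sum_le_sum fun i _ => ?_)
      (sum_norm_mix_sub_sq_le hW (fun i => y i + θj i • g i) z)
    refine pow_le_pow_left₀ (norm_nonneg _) ?_ 2
    have := norm_proj_sub_proj_le hA.wellPosed.isClosed hA.wellPosed.convex hA.nonempty
      (∑ j, W i j • (y j + θj j • g j)) z
    rwa [proj_eq_self hA.wellPosed.isClosed hzm, ← hy' i] at this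
  have s2 : ∑ i, ‖y i + θj i • g i - z‖ ^ 2 ≤ (1 + μ * θ / 4) * E
      + 2 * θ * ∑ i, inner ℝ (g i) (y i - z) + 4 / (μ * θ) * Q + P := by
    have hpt : ∀ i, ‖y i + θj i • g i - z‖ ^ 2 ≤ (1 + μ * θ / 4) * ‖y i - z‖ ^ 2
        + 2 * θ * inner ℝ (g i) (y i - z) + 4 / (μ * θ) * ((θj i - θ) ^ 2 * ‖g i‖ ^ 2)
        + θj i ^ 2 * ‖g i‖ ^ 2 := fun i => by
      have e1 : y i + θj i • g i - z = (y i - z) + θj i • g i := by abel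
      rw [e1, norm_add_sq_real, norm_smul, mul_pow, Real.norm_eq_abs, sq_abs,
        real_inner_smul_right, real_inner_comm]
      have h1 : (θj i - θ) * inner ℝ (g i) (y i - z) ≤ |θj i - θ| * ‖g i‖ * ‖y i - z‖ := by
        refine (le_abs_self _).trans ?_
        rw [abs_mul, mul_assoc]
        exact mul_le_mul_of_nonneg_left (abs_real_inner_le_norm _ _) (abs_nonneg _)
      have h2 : 2 * (|θj i - θ| * ‖g i‖ * ‖y i - z‖) ≤ μ * θ / 4 * ‖y i - z‖ ^ 2
          + 4 / (μ * θ) * ((θj i - θ) ^ 2 * ‖g i‖ ^ 2) := by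
        have e2 : (θj i - θ) ^ 2 * ‖g i‖ ^ 2 = (|θj i - θ| * ‖g i‖) ^ 2 := by
          rw [mul_pow, sq_abs]
        rw [e2]
        set a := |θj i - θ| * ‖g i‖
        have : μ * θ / 4 * ‖y i - z‖ ^ 2 + 4 / (μ * θ) * a ^ 2 - 2 * (a * ‖y i - z‖)
            = (μ * θ * ‖y i - z‖ - 4 * a) ^ 2 / (4 * (μ * θ)) := by field_simp; ring
        have : 0 ≤ (μ * θ * ‖y i - z‖ - 4 * a) ^ 2 / (4 * (μ * θ)) := by positivity
        linarith
      linarith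
    refine (Finset.sum_le_sum fun i _ => hpt i).trans_eq ?_
    simp only [Finset.sum_add_distrib, ← Finset.mul_sum]
    rfl
  have s4 : ∑ i, ‖x i - w‖ ^ 2 = DX + n * R := sum_norm_sub_sq hA.node_pos x w
  have s3 : ∑ i, inner ℝ (G i) (y i - z) ≤ -(3 * μ / 4) * E + cL * (DX + n * R + DY)
      + ∑ i, ‖G i‖ * ‖y i - nodeMean y‖ := by
    have := hA.sum_inner_gradY_le x y hy w
    rw [s4] at this
    exact this
  -- Young's inequality, with `‖G‖²` replaced by `‖g‖²` at the price of noise: only `‖g‖²` is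
  -- controlled by the buffers
  have s5 : ∑ i, ‖G i‖ * ‖y i - nodeMean y‖
      ≤ 1 / (2 * b) * H - 1 / b * ∑ i, inner ℝ (G i) (g i - G i) + b / 2 * DY := by
    have hpt : ∀ i, ‖G i‖ * ‖y i - nodeMean y‖ ≤ 1 / (2 * b) * ‖g i‖ ^ 2
        - 1 / b * inner ℝ (G i) (g i - G i) + b / 2 * ‖y i - nodeMean y‖ ^ 2 := fun i => by
      have h1 : ‖G i‖ ^ 2 ≤ ‖g i‖ ^ 2 - 2 * inner ℝ (G i) (g i - G i) := by
        have := norm_add_sq_real (G i) (g i - G i)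
        rw [add_sub_cancel] at this
        nlinarith [sq_nonneg ‖g i - G i‖]
      have h2 : ‖G i‖ * ‖y i - nodeMean y‖
          ≤ 1 / (2 * b) * ‖G i‖ ^ 2 + b / 2 * ‖y i - nodeMean y‖ ^ 2 := by
        have : 1 / (2 * b) * ‖G i‖ ^ 2 + b / 2 * ‖y i - nodeMean y‖ ^ 2
            - ‖G i‖ * ‖y i - nodeMean y‖ = (‖G i‖ - b * ‖y i - nodeMean y‖) ^ 2 / (2 * b) := by
          field_simp; ring
        have : 0 ≤ (‖G i‖ - b * ‖y i - nodeMean y‖) ^ 2 / (2 * b) := by positivity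
        linarith
      have h3 := mul_le_mul_of_nonneg_left h1 (by positivity : 0 ≤ 1 / (2 * b))
      have e3 : 1 / (2 * b) * (‖g i‖ ^ 2 - 2 * inner ℝ (G i) (g i - G i))
          = 1 / (2 * b) * ‖g i‖ ^ 2 - 1 / b * inner ℝ (G i) (g i - G i) := by field_simp
      linarith
    refine (Finset.sum_le_sum fun i _ => hpt i).trans_eq ?_
    simp only [Finset.sum_add_distrib, Finset.sum_sub_distrib, ← Finset.mul_sum]
    rfl
  have s6 : ∑ i, inner ℝ (g i) (y i - z) = ∑ i, inner ℝ (G i) (y i - z) + MM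
      + 1 / b * ∑ i, inner ℝ (G i) (g i - G i) := by
    rw [hMM, Finset.mul_sum, ← Finset.sum_add_distrib, ← Finset.sum_add_distrib]
    refine Finset.sum_congr rfl fun i _ => ?_
    rw [inner_sub_left (y i - z), real_inner_smul_left, inner_sub_right (y i - z),
      real_inner_comm (y i - z), real_inner_comm (y i - z)]
    ring
  clear_value E DX DY R H Q P cL MM
  have hBr0 : 0 ≤ cL * (2 * DX + 2 * n * R + DY) + (1 / (2 * b) * H + b / 2 * DY) := by
    positivity
  set Br := cL * (2 * DX + 2 * n * R + DY) + (1 / (2 * b) * H + b / 2 * DY) with hBr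
  clear_value Br
  have s7 : ∑ i, inner ℝ (g i) (y i - z) ≤ -(3 * μ / 4) * E + Br + MM := by
    rw [s6, hBr]
    have : cL * (DX + n * R + DY) ≤ cL * (2 * DX + 2 * n * R + DY) := by
      refine mul_le_mul_of_nonneg_left ?_ hcL0
      have : 0 ≤ (n : ℝ) * R := by positivity
      linarith
    linarith
  have s8 : ∑ i, ‖y' i - z‖ ^ 2 ≤ (1 - 5 / 4 * (μ * θ)) * E + 2 * θ * Br + 2 * θ * MM
      + 4 / (μ * θ) * Q + P := by
    have := mul_le_mul_of_nonneg_left s7 (by positivity : 0 ≤ 2 * θ)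
    linarith
  -- moving the reference point
  have hμθ0 : 0 < μ * θ := by positivity
  have s9 : ∑ i, ‖y' i - z'‖ ^ 2 ≤ (1 + μ * θ / 4) * ∑ i, ‖y' i - z‖ ^ 2
      + 8 * n * (L / μ) ^ 2 * (μ * θ) * R := by
    have hzz : ‖z - z'‖ ^ 2 ≤ (L / μ) ^ 2 * (μ * θ) ^ 2 * R := by
      have h1 := hA.norm_yStar_sub_le w w'
      have h2 : ‖w - w'‖ = μ * θ * ‖nodeMean x - w‖ := by
        rw [hw', sub_add_cancel_left, norm_neg, norm_smul, Real.norm_of_nonneg hμθ0.le]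
      rw [h2] at h1
      refine (pow_le_pow_left₀ (norm_nonneg _) h1 2).trans_eq ?_
      rw [hR]; ring
    have hpt : ∀ i, ‖y' i - z'‖ ^ 2
        ≤ (1 + μ * θ / 4) * ‖y' i - z‖ ^ 2 + (1 + 4 / (μ * θ)) * ‖z - z'‖ ^ 2 := fun i => by
      have h1 := norm_add_le (y' i - z) (z - z')
      rw [sub_add_sub_cancel] at h1
      refine (pow_le_pow_left₀ (norm_nonneg _) h1 2).trans ?_
      have : (1 + μ * θ / 4) * ‖y' i - z‖ ^ 2 + (1 + 4 / (μ * θ)) * ‖z - z'‖ ^ 2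
          - (‖y' i - z‖ + ‖z - z'‖) ^ 2
          = (μ * θ * ‖y' i - z‖ - 4 * ‖z - z'‖) ^ 2 / (4 * (μ * θ)) := by field_simp; ring
      have : 0 ≤ (μ * θ * ‖y' i - z‖ - 4 * ‖z - z'‖) ^ 2 / (4 * (μ * θ)) := by positivity
      linarith
    refine (Finset.sum_le_sum fun i _ => hpt i).trans ?_
    rw [Finset.sum_add_distrib, ← Finset.mul_sum]
    simp only [Finset.sum_const, Finset.card_univ, Fintype.card_fin, nsmul_eq_mul]
    have h2 : (1 + 4 / (μ * θ)) * ‖z - z'‖ ^ 2 ≤ 8 * (L / μ) ^ 2 * (μ * θ) * R := by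
      have h3 : 1 + 4 / (μ * θ) ≤ 8 / (μ * θ) := by
        have : 1 ≤ 1 / (μ * θ) := by rw [le_div_iff₀ hμθ0]; linarith
        have e : 8 / (μ * θ) = 8 * (1 / (μ * θ)) := by ring
        have e' : 4 / (μ * θ) = 4 * (1 / (μ * θ)) := by ring
        rw [e, e']; linarith
      calc (1 + 4 / (μ * θ)) * ‖z - z'‖ ^ 2
          ≤ 8 / (μ * θ) * ((L / μ) ^ 2 * (μ * θ) ^ 2 * R) := by gcongr
        _ = _ := by field_simp
    have h4 := mul_le_mul_of_nonneg_left h2 hn.le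
    linarith
  have s9' : ∑ i, ‖y' i - z'‖ ^ 2 ≤ (1 + μ * θ / 4) * ∑ i, ‖y' i - z‖ ^ 2
      + μ * θ * (8 * n * (L / μ) ^ 2 * R) := s9.trans_eq (by ring)
  refine (dual_combine hμ hθ hμθ hE0 hBr0 hQ0 hP0 s8 s9').trans_eq ?_
  ring

end Problem.Regular

/-! ### Inequalities along a trajectory -/

/-- A run `s` of the algorithm in which the gradients `gx k i`, `gy k i` are arbitrary vectors of
norm at most `C`. -/
structure Trajectory {n p d : ℕ} {Ξ : Type*} [MeasurableSpace Ξ] (A : Problem n p d Ξ)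
    (W : Matrix (Fin n) (Fin n) ℝ) (α β γx γy c μ L C : ℝ) (s : ℕ → State n p d)
    (gx : ℕ → Fin n → Euc p) (gy : ℕ → Fin n → Euc d) : Prop where
  regular : A.Regular μ L C
  doublyStochastic : W ∈ doublyStochastic ℝ (Fin n)
  rho_lt_one : rho W < 1
  β_pos : 0 < β
  β_lt_α : β < α
  α_lt_one : α < 1
  γx_pos : 0 < γx
  γy_pos : 0 < γy
  c_pos : 0 < c
  step_eq : ∀ k, s (k + 1) = step W A.Y α β γx γy (gx k) (gy k) (s k)
  mx_zero : ∀ i, (s 0).mx i = c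
  my_zero : ∀ i, (s 0).my i = c
  y_mem : ∀ k i, (s k).y i ∈ A.Y
  norm_gx_le : ∀ k i, ‖gx k i‖ ≤ C
  norm_gy_le : ∀ k i, ‖gy k i‖ ≤ C

/-- The requirements on the offset `S` that is added to the averaged buffers: it dominates the
disagreement between the nodes, and makes the common stepsizes small, slowly varying, and well
separated (`η / θ ≤ ε`). -/
structure Offset (n : ℕ) (ρ α β γx γy μ C ε S : ℝ) : Prop where
  one_le : 1 ≤ S
  disagreement : 2 * n * C ^ 2 / (1 - ρ) + C ^ 2 ≤ S
  growth : 4 * C ^ 2 ≤ (1 - ρ) * S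
  small : μ * γy ≤ S ^ β
  slow : C ^ 2 * S ^ (β - 1) ≤ γy * μ / 4
  ratio : γx / γy * S ^ (β - α) ≤ ε

/-- The averaged dual buffer plus the offset, written `V` in comments. By the choice of `S` it
dominates every local buffer. -/
noncomputable def offsetY {n p d : ℕ} (S : ℝ) (s : State n p d) : ℝ := S + avg s.my

/-- The maximum of the averaged buffers plus the offset, written `U` in comments. -/
noncomputable def offsetX {n p d : ℕ} (S : ℝ) (s : State n p d) : ℝ :=
  S + max (avg s.mx) (avg s.my)

/-- The common primal stepsize `η`, which depends on the past samples only. -/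
noncomputable def etaC {n p d : ℕ} (α γx S : ℝ) (s : State n p d) : ℝ := γx / offsetX S s ^ α

/-- The common dual stepsize `θ`, which depends on the past samples only. -/
noncomputable def thetaC {n p d : ℕ} (β γy S : ℝ) (s : State n p d) : ℝ := γy / offsetY S s ^ β

/-- The slow tracker `w` of the averaged primal iterate: it moves towards it at the dual rate.
The dual iterates are compared with `y*(w)` instead of `y*(x̄)`: the increments of `w` carry no
fresh gradient noise, so the Lipschitz continuity of `y*` is enough. -/
noncomputable def tracker {n p d : ℕ} (β γy μ S : ℝ) (s : ℕ → State n p d) : ℕ → Euc p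
  | 0 => nodeMean (s 0).x
  | k + 1 => tracker β γy μ S s k
      + (μ * thetaC β γy S (s k)) • (nodeMean (s k).x - tracker β γy μ S s k)

/-- The sum over the nodes of the squared gradient norms relative to the local buffers. -/
noncomputable def relSq {n m : ℕ} (t : ℝ) (b : Fin n → ℝ) (g : Fin n → Euc m) : ℝ :=
  ∑ i, ‖g i‖ ^ 2 / (b i + ‖g i‖ ^ 2) ^ t

/-- The second-order error of one iteration, which includes the price of replacing the local
stepsizes of exponent `t` by the common one. -/
noncomputable def stepErr {n m : ℕ} (t S : ℝ) (b : Fin n → ℝ) (g : Fin n → Euc m) : ℝ :=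
  relSq t b g + (2 * S) ^ (2 * t) * relSq (2 * t) b g

/-- The consensus error. -/
noncomputable def spread {n m : ℕ} (v : Fin n → Euc m) : ℝ := ∑ i, ‖v i - nodeMean v‖ ^ 2

lemma spread_nonneg {n m : ℕ} (v : Fin n → Euc m) : 0 ≤ spread v :=
  Finset.sum_nonneg fun i _ => by positivity

namespace Trajectory

variable {n p d : ℕ} {Ξ : Type*} [MeasurableSpace Ξ] {A : Problem n p d Ξ}
  {W : Matrix (Fin n) (Fin n) ℝ} {α β γx γy c μ L C : ℝ} {s : ℕ → State n p d}
  {gx : ℕ → Fin n → Euc p} {gy : ℕ → Fin n → Euc d} {ε S : ℝ}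

lemma accX (T : Trajectory A W α β γx γy c μ L C s gx gy) :
    Accumulator W c (C ^ 2) (fun k => (s k).mx) fun k i => ‖gx k i‖ ^ 2 where
  node_pos := T.regular.node_pos
  doublyStochastic := T.doublyStochastic
  rho_lt_one := T.rho_lt_one
  c_pos := T.c_pos
  zero := T.mx_zero
  succ k i := by rw [T.step_eq]; rfl
  nonneg k i := by positivity
  le k i := pow_le_pow_left₀ (norm_nonneg _) (T.norm_gx_le k i) 2

lemma accY (T : Trajectory A W α β γx γy c μ L C s gx gy) :
    Accumulator W c (C ^ 2) (fun k => (s k).my) fun k i => ‖gy k i‖ ^ 2 where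
  node_pos := T.regular.node_pos
  doublyStochastic := T.doublyStochastic
  rho_lt_one := T.rho_lt_one
  c_pos := T.c_pos
  zero := T.my_zero
  succ k i := by rw [T.step_eq]; rfl
  nonneg k i := by positivity
  le k i := pow_le_pow_left₀ (norm_nonneg _) (T.norm_gy_le k i) 2

lemma mx_pos (T : Trajectory A W α β γx γy c μ L C s gx gy) (k : ℕ) (i : Fin n) :
    0 < (s k).mx i + ‖gx k i‖ ^ 2 :=
  add_pos_of_pos_of_nonneg (T.c_pos.trans_le (T.accX.c_le k i)) (by positivity)

lemma my_pos (T : Trajectory A W α β γx γy c μ L C s gx gy) (k : ℕ) (i : Fin n) :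
    0 < (s k).my i + ‖gy k i‖ ^ 2 :=
  add_pos_of_pos_of_nonneg (T.c_pos.trans_le (T.accY.c_le k i)) (by positivity)

lemma relSq_x_nonneg (T : Trajectory A W α β γx γy c μ L C s gx gy) (t : ℝ) (k : ℕ) :
    0 ≤ relSq t (s k).mx (gx k) :=
  Finset.sum_nonneg fun i _ => by have := T.mx_pos k i; positivity

lemma relSq_y_nonneg (T : Trajectory A W α β γx γy c μ L C s gx gy) (t : ℝ) (k : ℕ) :
    0 ≤ relSq t (s k).my (gy k) :=
  Finset.sum_nonneg fun i _ => by have := T.my_pos k i; positivity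

lemma S_le_offsetY (T : Trajectory A W α β γx γy c μ L C s gx gy) (k : ℕ) :
    S ≤ offsetY S (s k) := by
  have := T.accY.c_le_avg k; have := T.c_pos; rw [offsetY]; linarith

lemma offsetY_le_offsetX (k : ℕ) : offsetY S (s k) ≤ offsetX S (s k) :=
  by rw [offsetY, offsetX]; gcongr; exact le_max_right _ _

lemma my_le_offsetY (T : Trajectory A W α β γx γy c μ L C s gx gy)
    (O : Offset n (rho W) α β γx γy μ C ε S) (k : ℕ) (i : Fin n) :
    (s k).my i + ‖gy k i‖ ^ 2 ≤ offsetY S (s k) := by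
  have h1 := (abs_le.1 (T.accY.abs_sub_avg_le k i)).2
  have h2 := T.accY.le k i
  have h3 := O.disagreement
  rw [offsetY]; linarith

lemma offsetY_le_my (T : Trajectory A W α β γx γy c μ L C s gx gy)
    (O : Offset n (rho W) α β γx γy μ C ε S) (k : ℕ) (i : Fin n) :
    offsetY S (s k) ≤ (s k).my i + ‖gy k i‖ ^ 2 + 2 * S := by
  have h1 := (abs_le.1 (T.accY.abs_sub_avg_le k i)).1
  have h2 := T.accY.nonneg k i
  have h3 := O.disagreement
  have h4 : 0 ≤ C ^ 2 := by positivity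
  rw [offsetY]; linarith

lemma max_le_offsetX (T : Trajectory A W α β γx γy c μ L C s gx gy)
    (O : Offset n (rho W) α β γx γy μ C ε S) (k : ℕ) (i : Fin n) :
    max ((s k).mx i + ‖gx k i‖ ^ 2) ((s k).my i + ‖gy k i‖ ^ 2) ≤ offsetX S (s k) := by
  have h1 := (abs_le.1 (T.accX.abs_sub_avg_le k i)).2
  have h2 := T.accX.le k i
  have h3 := O.disagreement
  refine max_le ?_ ((T.my_le_offsetY O k i).trans (offsetY_le_offsetX k))
  have := le_max_left (avg (s k).mx) (avg (s k).my)
  rw [offsetX]; linarith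

lemma offsetX_le_max (T : Trajectory A W α β γx γy c μ L C s gx gy)
    (O : Offset n (rho W) α β γx γy μ C ε S) (k : ℕ) (i : Fin n) :
    offsetX S (s k)
      ≤ max ((s k).mx i + ‖gx k i‖ ^ 2) ((s k).my i + ‖gy k i‖ ^ 2) + 2 * S := by
  have h1 := (abs_le.1 (T.accX.abs_sub_avg_le k i)).1
  have h2 := T.accX.nonneg k i
  have h3 := O.disagreement
  have h4 : 0 ≤ C ^ 2 := by positivity
  have h5 := T.offsetY_le_my O k i
  have h6 := le_max_left ((s k).mx i + ‖gx k i‖ ^ 2) ((s k).my i + ‖gy k i‖ ^ 2)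
  have h7 := le_max_right ((s k).mx i + ‖gx k i‖ ^ 2) ((s k).my i + ‖gy k i‖ ^ 2)
  rw [offsetY] at h5
  rw [offsetX]
  rcases max_cases (avg (s k).mx) (avg (s k).my) with h | h <;> rw [h.1] <;> linarith

lemma offsetY_pos (T : Trajectory A W α β γx γy c μ L C s gx gy)
    (O : Offset n (rho W) α β γx γy μ C ε S) (k : ℕ) : 0 < offsetY S (s k) :=
  (zero_lt_one.trans_le O.one_le).trans_le (T.S_le_offsetY k)

lemma offsetX_pos (T : Trajectory A W α β γx γy c μ L C s gx gy)
    (O : Offset n (rho W) α β γx γy μ C ε S) (k : ℕ) : 0 < offsetX S (s k) :=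
  (T.offsetY_pos O k).trans_le (offsetY_le_offsetX k)

lemma etaC_pos (T : Trajectory A W α β γx γy c μ L C s gx gy)
    (O : Offset n (rho W) α β γx γy μ C ε S) (k : ℕ) : 0 < etaC α γx S (s k) :=
  div_pos T.γx_pos (Real.rpow_pos_of_pos (T.offsetX_pos O k) _)

lemma thetaC_pos (T : Trajectory A W α β γx γy c μ L C s gx gy)
    (O : Offset n (rho W) α β γx γy μ C ε S) (k : ℕ) : 0 < thetaC β γy S (s k) :=
  div_pos T.γy_pos (Real.rpow_pos_of_pos (T.offsetY_pos O k) _)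

lemma mu_mul_thetaC_le (T : Trajectory A W α β γx γy c μ L C s gx gy)
    (O : Offset n (rho W) α β γx γy μ C ε S) (k : ℕ) : μ * thetaC β γy S (s k) ≤ 1 := by
  have hS := zero_lt_one.trans_le O.one_le
  rw [thetaC, ← mul_div_assoc, div_le_one (Real.rpow_pos_of_pos (T.offsetY_pos O k) _)]
  exact O.small.trans (Real.rpow_le_rpow hS.le (T.S_le_offsetY k) T.β_pos.le)

lemma etaC_div_thetaC_le (T : Trajectory A W α β γx γy c μ L C s gx gy)
    (O : Offset n (rho W) α β γx γy μ C ε S) (k : ℕ) :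
    etaC α γx S (s k) / thetaC β γy S (s k) ≤ ε := by
  have hS := zero_lt_one.trans_le O.one_le
  have hU := T.offsetX_pos O k
  have hV := T.offsetY_pos O k
  have hVU : offsetY S (s k) ≤ offsetX S (s k) := offsetY_le_offsetX k
  have := T.γx_pos
  have := T.γy_pos
  refine le_trans ?_ O.ratio
  calc etaC α γx S (s k) / thetaC β γy S (s k)
      = γx / γy * (offsetY S (s k) ^ β / offsetX S (s k) ^ α) := by
        rw [etaC, thetaC]; field_simp
    _ ≤ γx / γy * (offsetX S (s k) ^ β / offsetX S (s k) ^ α) := by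
        have := T.β_pos
        gcongr
    _ = γx / γy * offsetX S (s k) ^ (β - α) := by rw [Real.rpow_sub hU]
    _ ≤ γx / γy * S ^ (β - α) := by
        refine mul_le_mul_of_nonneg_left ?_ (by positivity)
        exact Real.rpow_le_rpow_of_nonpos hS ((T.S_le_offsetY k).trans hVU)
          (by linarith [T.β_lt_α])

lemma offsetY_succ_le (T : Trajectory A W α β γx γy c μ L C s gx gy) (k : ℕ) :
    offsetY S (s (k + 1)) ≤ offsetY S (s k) + C ^ 2 := by
  have := T.accY.avg_succ_le k
  rw [offsetY, offsetY]; linarith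

lemma offsetX_le_succ (T : Trajectory A W α β γx γy c μ L C s gx gy) (k : ℕ) :
    offsetX S (s k) ≤ offsetX S (s (k + 1)) := by
  have h1 := T.accY.avg_le_succ k
  have h2 := T.accX.avg_le_succ k
  rw [offsetX, offsetX]
  gcongr

lemma offsetX_le (T : Trajectory A W α β γx γy c μ L C s gx gy) (k : ℕ) :
    offsetX S (s k) ≤ S + (c + k * C ^ 2) := by
  rw [offsetX]
  gcongr
  exact max_le (T.accX.avg_le_add_mul k) (T.accY.avg_le_add_mul k)

/-- Bernoulli's inequality for the growth of `V ^ β` over one iteration. -/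
lemma offsetY_rpow_succ_le (T : Trajectory A W α β γx γy c μ L C s gx gy)
    (O : Offset n (rho W) α β γx γy μ C ε S) (k : ℕ) :
    offsetY S (s (k + 1)) ^ β
      ≤ offsetY S (s k) ^ β * (1 + C ^ 2 / offsetY S (s k)) := by
  have hV := T.offsetY_pos O k
  have hV' := T.offsetY_pos O (k + 1)
  have h0 : 0 ≤ C ^ 2 / offsetY S (s k) := by positivity
  have hβ1 : β ≤ 1 := by linarith [T.β_lt_α, T.α_lt_one]
  calc offsetY S (s (k + 1)) ^ β ≤ (offsetY S (s k) + C ^ 2) ^ β :=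
        Real.rpow_le_rpow hV'.le (T.offsetY_succ_le k) T.β_pos.le
    _ = offsetY S (s k) ^ β * (1 + C ^ 2 / offsetY S (s k)) ^ β := by
        rw [← Real.mul_rpow hV.le (by positivity)]; congr 1; field_simp
    _ ≤ offsetY S (s k) ^ β * (1 + C ^ 2 / offsetY S (s k)) := by
        refine mul_le_mul_of_nonneg_left ?_ (by positivity)
        exact (Real.rpow_le_rpow_of_exponent_le (by linarith) hβ1).trans_eq (Real.rpow_one _)

/-- The inverse dual stepsize grows so slowly that strong concavity absorbs its increments. -/
lemma inv_thetaC_succ_le (T : Trajectory A W α β γx γy c μ L C s gx gy)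
    (O : Offset n (rho W) α β γx γy μ C ε S) (k : ℕ) :
    1 / thetaC β γy S (s (k + 1)) ≤ 1 / thetaC β γy S (s k) + μ / 4 := by
  have hS := zero_lt_one.trans_le O.one_le
  have hV := T.offsetY_pos O k
  have hγ := T.γy_pos
  have h1 := T.offsetY_rpow_succ_le O k
  have h2 : offsetY S (s k) ^ β * (C ^ 2 / offsetY S (s k)) ≤ γy * μ / 4 := by
    calc offsetY S (s k) ^ β * (C ^ 2 / offsetY S (s k))
        = C ^ 2 * offsetY S (s k) ^ (β - 1) := by
          rw [Real.rpow_sub hV, Real.rpow_one]; ring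
      _ ≤ C ^ 2 * S ^ (β - 1) := by
          refine mul_le_mul_of_nonneg_left ?_ (by positivity)
          exact Real.rpow_le_rpow_of_nonpos hS (T.S_le_offsetY k)
            (by linarith [T.β_lt_α, T.α_lt_one])
      _ ≤ _ := O.slow
  rw [thetaC, thetaC, one_div_div, one_div_div, div_add' _ _ _ hγ.ne']
  refine div_le_div_of_nonneg_right ?_ hγ.le
  linarith

/-! #### The updates -/

/-- The ratio `ψ` turns the exponent-`α` scaling by `m^x` into a scaling by the larger buffer. -/
lemma x_succ (T : Trajectory A W α β γx γy c μ L C s gx gy) (k : ℕ) (i : Fin n) :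
    (s (k + 1)).x i = ∑ j, W i j • ((s k).x j
      - (γx / max ((s k).mx j + ‖gx k j‖ ^ 2) ((s k).my j + ‖gy k j‖ ^ 2) ^ α) • gx k j) := by
  rw [T.step_eq]
  simp only [step]
  refine Finset.sum_congr rfl fun j _ => ?_
  have hx := T.mx_pos k j
  have hy := T.my_pos k j
  have hα : 0 ≤ α := by linarith [T.β_pos, T.β_lt_α]
  congr 3
  have hmax : max (((s k).mx j + ‖gx k j‖ ^ 2) ^ α) (((s k).my j + ‖gy k j‖ ^ 2) ^ α)
      = max ((s k).mx j + ‖gx k j‖ ^ 2) ((s k).my j + ‖gy k j‖ ^ 2) ^ α := by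
    rcases le_total ((s k).mx j + ‖gx k j‖ ^ 2) ((s k).my j + ‖gy k j‖ ^ 2) with h | h
    · rw [max_eq_right h, max_eq_right (Real.rpow_le_rpow hx.le h hα)]
    · rw [max_eq_left h, max_eq_left (Real.rpow_le_rpow hy.le h hα)]
  have := Real.rpow_pos_of_pos hx α
  rw [hmax, Real.rpow_neg hx.le]
  field_simp

lemma y_succ (T : Trajectory A W α β γx γy c μ L C s gx gy) (k : ℕ) (i : Fin n) :
    (s (k + 1)).y i = proj A.Y (∑ j, W i j • ((s k).y j
      + (γy / ((s k).my j + ‖gy k j‖ ^ 2) ^ β) • gy k j)) := by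
  rw [T.step_eq]
  simp only [step]
  congr 1
  refine Finset.sum_congr rfl fun j _ => ?_
  rw [Real.rpow_neg (T.my_pos k j).le, ← div_eq_mul_inv]

/-- The part of the averaged primal update that is due to the disagreement of the stepsizes. -/
noncomputable def xErr (α γx S : ℝ) (s : State n p d) (gx : Fin n → Euc p)
    (gy : Fin n → Euc d) : Euc p :=
  nodeMean fun j => (γx / max (s.mx j + ‖gx j‖ ^ 2) (s.my j + ‖gy j‖ ^ 2) ^ α
    - etaC α γx S s) • gx j

lemma eta_smul_add_xErr (k : ℕ) :
    etaC α γx S (s k) • nodeMean (gx k) + xErr α γx S (s k) (gx k) (gy k)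
      = nodeMean fun j =>
        (γx / max ((s k).mx j + ‖gx k j‖ ^ 2) ((s k).my j + ‖gy k j‖ ^ 2) ^ α) • gx k j := by
  simp only [xErr, nodeMean, sub_smul, Finset.sum_sub_distrib, smul_sub, ← Finset.smul_sum]
  rw [smul_comm]; abel

lemma nodeMean_x_succ (T : Trajectory A W α β γx γy c μ L C s gx gy) (k : ℕ) :
    nodeMean (s (k + 1)).x = nodeMean (s k).x
      - (etaC α γx S (s k) • nodeMean (gx k) + xErr α γx S (s k) (gx k) (gy k)) := by
  rw [eta_smul_add_xErr, ← nodeMean_sub]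
  refine Eq.trans ?_ (nodeMean_mix T.doublyStochastic _)
  congr 1
  funext i
  exact T.x_succ k i

lemma stepErr_x_nonneg (T : Trajectory A W α β γx γy c μ L C s gx gy)
    (O : Offset n (rho W) α β γx γy μ C ε S) (k : ℕ) : 0 ≤ stepErr α S (s k).mx (gx k) := by
  have h1 := T.relSq_x_nonneg α k
  have h2 := T.relSq_x_nonneg (2 * α) k
  have hS := zero_lt_one.trans_le O.one_le
  rw [stepErr]; positivity

lemma two_S_rpow_le (O : Offset n (rho W) α β γx γy μ C ε S) {t : ℝ} (ht : 0 ≤ t) :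
    (2 * S) ^ t ≤ (2 * S) ^ (2 * t) :=
  Real.rpow_le_rpow_of_exponent_le (by linarith [O.one_le]) (by linarith)

lemma norm_xErr_sq_div_le (T : Trajectory A W α β γx γy c μ L C s gx gy)
    (O : Offset n (rho W) α β γx γy μ C ε S) (k : ℕ) :
    ‖xErr α γx S (s k) (gx k) (gy k)‖ ^ 2 / etaC α γx S (s k) ^ 2
      ≤ stepErr α S (s k).mx (gx k) := by
  have hη := T.etaC_pos O k
  have hα0 : 0 ≤ α := by linarith [T.β_pos, T.β_lt_α]
  have hS := zero_lt_one.trans_le O.one_le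
  have hn : (1 : ℝ) ≤ n := by exact_mod_cast T.regular.node_pos
  rw [div_le_iff₀ (by positivity)]
  refine (norm_nodeMean_sq_le T.regular.node_pos _).trans ?_
  have h1 := sum_stepsize_sub_sq_le hα0 T.α_lt_one.le hS.le T.γx_pos (T.mx_pos k)
    (fun i => le_max_left _ ((s k).my i + ‖gy k i‖ ^ 2)) (T.max_le_offsetX O k)
    (T.offsetX_pos O k) (T.offsetX_le_max O k) (h := fun i => ‖gx k i‖ ^ 2)
    (fun i => by positivity)
  have h2 := T.relSq_x_nonneg α k
  have h3 := T.relSq_x_nonneg (2 * α) k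
  simp only [norm_smul, mul_pow, Real.norm_eq_abs, sq_abs]
  calc _ ≤ 1 * ∑ i, (γx / max ((s k).mx i + ‖gx k i‖ ^ 2) ((s k).my i + ‖gy k i‖ ^ 2) ^ α
        - etaC α γx S (s k)) ^ 2 * ‖gx k i‖ ^ 2 := by
        refine mul_le_mul_of_nonneg_right ?_ (Finset.sum_nonneg fun i _ => by positivity)
        rw [div_le_one (by positivity)]; exact hn
    _ ≤ etaC α γx S (s k) ^ 2 * ((2 * S) ^ (2 * α) * relSq (2 * α) (s k).mx (gx k)) := by
        rw [one_mul]; exact h1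
    _ ≤ _ := by
        rw [mul_comm (etaC α γx S (s k) ^ 2), stepErr]
        refine mul_le_mul_of_nonneg_right ?_ (by positivity)
        linarith

lemma sum_primal_sq_le (T : Trajectory A W α β γx γy c μ L C s gx gy)
    (O : Offset n (rho W) α β γx γy μ C ε S) (k : ℕ) :
    ‖etaC α γx S (s k) • nodeMean (gx k) + xErr α γx S (s k) (gx k) (gy k)‖ ^ 2
        / etaC α γx S (s k) ≤ γx * stepErr α S (s k).mx (gx k) := by
  have hη := T.etaC_pos O k
  have hα0 : 0 ≤ α := by linarith [T.β_pos, T.β_lt_α]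
  have hS := zero_lt_one.trans_le O.one_le
  have hn : (1 : ℝ) ≤ n := by exact_mod_cast T.regular.node_pos
  have hγ := T.γx_pos
  rw [div_le_iff₀ hη, eta_smul_add_xErr]
  refine (norm_nodeMean_sq_le T.regular.node_pos _).trans ?_
  have h1 := sum_stepsize_sq_le_mul hα0 T.α_lt_one.le hS.le T.γx_pos (T.mx_pos k)
    (fun i => le_max_left _ ((s k).my i + ‖gy k i‖ ^ 2))
    (T.offsetX_pos O k) (T.offsetX_le_max O k) (h := fun i => ‖gx k i‖ ^ 2)
    (fun i => by positivity)
  have h3 := T.relSq_x_nonneg (2 * α) k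
  simp only [norm_smul, mul_pow, Real.norm_eq_abs, sq_abs]
  calc _ ≤ 1 * ∑ i, (γx / max ((s k).mx i + ‖gx k i‖ ^ 2) ((s k).my i + ‖gy k i‖ ^ 2) ^ α) ^ 2
          * ‖gx k i‖ ^ 2 := by
        refine mul_le_mul_of_nonneg_right ?_ (Finset.sum_nonneg fun i _ => by positivity)
        rw [div_le_one (by positivity)]; exact hn
    _ ≤ etaC α γx S (s k) * (γx * (relSq α (s k).mx (gx k)
          + (2 * S) ^ α * relSq (2 * α) (s k).mx (gx k))) := by
        rw [one_mul]; exact h1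
    _ ≤ etaC α γx S (s k) * (γx * stepErr α S (s k).mx (gx k)) := by
        rw [stepErr]
        have := two_S_rpow_le O hα0
        gcongr
    _ = _ := by ring

lemma sum_dual_sub_sq_le (T : Trajectory A W α β γx γy c μ L C s gx gy)
    (O : Offset n (rho W) α β γx γy μ C ε S) (k : ℕ) :
    (∑ i, (γy / ((s k).my i + ‖gy k i‖ ^ 2) ^ β - thetaC β γy S (s k)) ^ 2 * ‖gy k i‖ ^ 2)
        / thetaC β γy S (s k) ^ 2 ≤ stepErr β S (s k).my (gy k) := by
  have hθ := T.thetaC_pos O k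
  have hβ1 : β ≤ 1 := by linarith [T.α_lt_one, T.β_lt_α]
  have hS := zero_lt_one.trans_le O.one_le
  rw [div_le_iff₀ (by positivity)]
  have h1 := sum_stepsize_sub_sq_le T.β_pos.le hβ1 hS.le T.γy_pos (T.my_pos k)
    (fun i => le_rfl) (T.my_le_offsetY O k)
    (T.offsetY_pos O k) (T.offsetY_le_my O k) (h := fun i => ‖gy k i‖ ^ 2)
    (fun i => by positivity)
  have h2 := T.relSq_y_nonneg β k
  refine h1.trans ?_
  rw [mul_comm]
  refine mul_le_mul_of_nonneg_right ?_ (by positivity)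
  rw [stepErr, relSq, relSq]
  rw [relSq] at h2
  linarith

lemma rpow_mul_sum_dual_sq_le (T : Trajectory A W α β γx γy c μ L C s gx gy)
    (O : Offset n (rho W) α β γx γy μ C ε S) (k : ℕ) :
    offsetY S (s k) ^ β * (∑ i, (γy / ((s k).my i + ‖gy k i‖ ^ 2) ^ β) ^ 2 * ‖gy k i‖ ^ 2)
      ≤ γy ^ 2 * (relSq β (s k).my (gy k) + (2 * S) ^ β * relSq (2 * β) (s k).my (gy k)) := by
  have hV := Real.rpow_pos_of_pos (T.offsetY_pos O k) β
  have hβ1 : β ≤ 1 := by linarith [T.α_lt_one, T.β_lt_α]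
  have hS := zero_lt_one.trans_le O.one_le
  have hγ := T.γy_pos
  have h1 := sum_stepsize_sq_le_mul T.β_pos.le hβ1 hS.le T.γy_pos (T.my_pos k)
    (fun i => le_rfl)
    (T.offsetY_pos O k) (T.offsetY_le_my O k) (h := fun i => ‖gy k i‖ ^ 2)
    (fun i => by positivity)
  refine (mul_le_mul_of_nonneg_left h1 hV.le).trans_eq ?_
  rw [relSq, relSq]
  field_simp

lemma sum_dual_sq_le (T : Trajectory A W α β γx γy c μ L C s gx gy)
    (O : Offset n (rho W) α β γx γy μ C ε S) (k : ℕ) :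
    (∑ i, (γy / ((s k).my i + ‖gy k i‖ ^ 2) ^ β) ^ 2 * ‖gy k i‖ ^ 2)
        / thetaC β γy S (s k) ≤ γy * stepErr β S (s k).my (gy k) := by
  have hγ := T.γy_pos
  have h1 := T.rpow_mul_sum_dual_sq_le O k
  have h2 := two_S_rpow_le O T.β_pos.le
  have h3 := T.relSq_y_nonneg (2 * β) k
  rw [thetaC, div_div_eq_mul_div, div_le_iff₀ hγ, mul_comm]
  refine h1.trans ?_
  rw [stepErr, mul_comm γy, mul_assoc, ← sq, mul_comm _ (γy ^ 2)]
  gcongr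

/-! #### Consensus errors -/

lemma spread_x_succ_le (T : Trajectory A W α β γx γy c μ L C s gx gy) (k : ℕ) :
    spread (s (k + 1)).x ≤ (1 - (1 - rho W) / 2) * spread (s k).x
      + 2 / (1 - rho W) * (γx ^ 2 * relSq (2 * α) (s k).mx (gx k)) := by
  have hs : 0 < 1 - rho W := by linarith [T.rho_lt_one]
  have hα0 : 0 ≤ α := by linarith [T.β_pos, T.β_lt_α]
  have h := sum_norm_mix_add_sub_sq_le T.regular.node_pos T.doublyStochastic T.rho_lt_one (s k).x
    fun j => -((γx / max ((s k).mx j + ‖gx k j‖ ^ 2) ((s k).my j + ‖gy k j‖ ^ 2) ^ α) • gx k j)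
  have e : spread (s (k + 1)).x = ∑ i, ‖∑ j, W i j • ((s k).x j
      + -((γx / max ((s k).mx j + ‖gx k j‖ ^ 2) ((s k).my j + ‖gy k j‖ ^ 2) ^ α) • gx k j))
      - nodeMean fun j => (s k).x j
      + -((γx / max ((s k).mx j + ‖gx k j‖ ^ 2) ((s k).my j + ‖gy k j‖ ^ 2) ^ α) • gx k j)‖ ^ 2 := by
    have : (s (k + 1)).x = fun i => ∑ j, W i j • ((s k).x j
      + -((γx / max ((s k).mx j + ‖gx k j‖ ^ 2) ((s k).my j + ‖gy k j‖ ^ 2) ^ α) • gx k j)) := by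
      funext i
      simp only [← sub_eq_add_neg]
      exact T.x_succ k i
    rw [spread, this, nodeMean_mix T.doublyStochastic]
  rw [e]
  refine h.trans (add_le_add_right (mul_le_mul_of_nonneg_left ?_ (by positivity)) _)
  have h1 := sum_stepsize_sq_le (γ := γx) hα0 (T.mx_pos k)
    (fun i => le_max_left _ ((s k).my i + ‖gy k i‖ ^ 2)) (h := fun i => ‖gx k i‖ ^ 2)
    (fun i => by positivity)
  simpa only [norm_neg, norm_smul, mul_pow, Real.norm_eq_abs, sq_abs, relSq] using h1

lemma spread_y_succ_le_sum (T : Trajectory A W α β γx γy c μ L C s gx gy) (k : ℕ) :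
    spread (s (k + 1)).y ≤ (1 - (1 - rho W) / 2) * spread (s k).y
      + 2 / (1 - rho W)
        * ∑ i, (γy / ((s k).my i + ‖gy k i‖ ^ 2) ^ β) ^ 2 * ‖gy k i‖ ^ 2 := by
  have h := sum_norm_mix_add_sub_sq_le T.regular.node_pos T.doublyStochastic T.rho_lt_one (s k).y
    fun j => (γy / ((s k).my j + ‖gy k j‖ ^ 2) ^ β) • gy k j
  simp only [norm_smul, mul_pow, Real.norm_eq_abs, sq_abs] at h
  refine le_trans ?_ h
  set q := nodeMean fun j => (s k).y j + (γy / ((s k).my j + ‖gy k j‖ ^ 2) ^ β) • gy k j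
  -- the mean of the projected points is at least as good a centre as the projected mean
  refine (sum_norm_sub_nodeMean_sq_le T.regular.node_pos _ (proj A.Y q)).trans ?_
  refine Finset.sum_le_sum fun i _ => pow_le_pow_left₀ (norm_nonneg _) ?_ 2
  rw [T.y_succ]
  exact norm_proj_sub_proj_le T.regular.wellPosed.isClosed T.regular.wellPosed.convex
    T.regular.nonempty _ _

lemma spread_y_succ_le (T : Trajectory A W α β γx γy c μ L C s gx gy) (k : ℕ) :
    spread (s (k + 1)).y ≤ (1 - (1 - rho W) / 2) * spread (s k).y
      + 2 / (1 - rho W) * (γy ^ 2 * relSq (2 * β) (s k).my (gy k)) := by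
  have hs : 0 < 1 - rho W := by linarith [T.rho_lt_one]
  refine (T.spread_y_succ_le_sum k).trans
    (add_le_add_right (mul_le_mul_of_nonneg_left ?_ (by positivity)) _)
  exact sum_stepsize_sq_le T.β_pos.le (T.my_pos k) (fun i => le_rfl) fun i => by positivity

/-- The dual consensus error still contracts after it is weighted by the growing `V ^ β`. -/
lemma weighted_spread_y_succ_le (T : Trajectory A W α β γx γy c μ L C s gx gy)
    (O : Offset n (rho W) α β γx γy μ C ε S) (k : ℕ) :
    offsetY S (s (k + 1)) ^ β * spread (s (k + 1)).y
      ≤ (1 - (1 - rho W) / 4) * (offsetY S (s k) ^ β * spread (s k).y)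
        + 4 / (1 - rho W) * (γy ^ 2 * (relSq β (s k).my (gy k)
          + (2 * S) ^ β * relSq (2 * β) (s k).my (gy k))) := by
  have hs : 0 < 1 - rho W := by linarith [T.rho_lt_one]
  have hs1 : 1 - rho W ≤ 1 := by linarith [rho_nonneg W]
  have hV := T.offsetY_pos O k
  have hVb : 0 < offsetY S (s k) ^ β := Real.rpow_pos_of_pos hV _
  have hγ := T.γy_pos
  have h1 : offsetY S (s (k + 1)) ^ β ≤ offsetY S (s k) ^ β * (1 + (1 - rho W) / 4) := by
    refine (T.offsetY_rpow_succ_le O k).trans (mul_le_mul_of_nonneg_left ?_ hVb.le)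
    gcongr 1 + ?_
    rw [div_le_div_iff₀ hV (by norm_num)]
    have := O.growth
    have := mul_le_mul_of_nonneg_left (T.S_le_offsetY (S := S) k) hs.le
    linarith
  have h2 := T.spread_y_succ_le_sum k
  have h4 := T.rpow_mul_sum_dual_sq_le O k
  set Q := ∑ i, (γy / ((s k).my i + ‖gy k i‖ ^ 2) ^ β) ^ 2 * ‖gy k i‖ ^ 2
  have hQ : 0 ≤ Q := Finset.sum_nonneg fun i _ => by positivity
  have hD := spread_nonneg (s k).y
  set σ := 1 - rho W
  set v := offsetY S (s k) ^ β
  set D := spread (s k).y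
  set F := γy ^ 2 * (relSq β (s k).my (gy k) + (2 * S) ^ β * relSq (2 * β) (s k).my (gy k))
  have hpos : 0 ≤ 1 - σ / 2 := by linarith
  calc offsetY S (s (k + 1)) ^ β * spread (s (k + 1)).y
      ≤ (v * (1 + σ / 4)) * ((1 - σ / 2) * D + 2 / σ * Q) := by
        refine mul_le_mul h1 h2 (spread_nonneg _) (by positivity)
    _ = ((1 + σ / 4) * (1 - σ / 2)) * (v * D) + (1 + σ / 4) * (2 / σ) * (v * Q) := by ring
    _ ≤ (1 - σ / 4) * (v * D) + 4 / σ * F := by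
        have a1 : (1 + σ / 4) * (1 - σ / 2) ≤ 1 - σ / 4 := by nlinarith [sq_nonneg σ]
        have a2 : (1 + σ / 4) * (2 / σ) ≤ 4 / σ := by
          rw [← mul_div_assoc]
          exact div_le_div_of_nonneg_right (by linarith) hs.le
        have hvQ : 0 ≤ v * Q := by positivity
        have hvD : 0 ≤ v * D := by positivity
        have a3 : (1 + σ / 4) * (2 / σ) * (v * Q) ≤ 4 / σ * F :=
          mul_le_mul a2 h4 hvQ (by positivity)
        have a4 := mul_le_mul_of_nonneg_right a1 hvD
        linarith

end Trajectory

/-! ### Summation over the iterations -/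

/-- Summation by parts for a bounded sequence `φ` and nondecreasing weights `a`. -/
lemma sum_weight_mul_sub_le {a φ : ℕ → ℝ} {M : ℝ} (ha : Monotone a) (ha0 : 0 ≤ a 0)
    (hφ : ∀ j k, φ j - φ k ≤ M) (K : ℕ) :
    ∑ k ∈ Finset.range K, a k * (φ k - φ (k + 1)) ≤ M * a K := by
  have h : ∀ l K, ∑ k ∈ Finset.range K, a k * (φ k - φ (k + 1)) + a K * (φ K - φ l)
      ≤ M * a K := by
    intro l K
    induction K with
    | zero =>
      have := mul_le_mul_of_nonneg_left (hφ 0 l) ha0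
      simp only [Finset.range_zero, Finset.sum_empty, zero_add]
      linarith
    | succ K ih =>
      rw [Finset.sum_range_succ]
      have h1 : a K ≤ a (K + 1) := ha (Nat.le_succ K)
      have h2 := mul_le_mul_of_nonneg_left (hφ (K + 1) l) (sub_nonneg.2 h1)
      linarith
  simpa using h K K

/-- Summing a potential inequality. -/
lemma sum_le_of_potential {v u b : ℕ → ℝ} (h : ∀ k, v (k + 1) + u k ≤ v k + b k)
    (hv : ∀ k, 0 ≤ v k) (K : ℕ) :
    ∑ k ∈ Finset.range K, u k ≤ v 0 + ∑ k ∈ Finset.range K, b k := by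
  have h1 : ∑ k ∈ Finset.range K, u k + v K ≤ v 0 + ∑ k ∈ Finset.range K, b k := by
    induction K with
    | zero => simp
    | succ K ih =>
      rw [Finset.sum_range_succ, Finset.sum_range_succ]
      linarith [h K]
  linarith [hv K]

lemma sum_le_of_contraction {v b : ℕ → ℝ} {q : ℝ} (hq : 0 < q)
    (h : ∀ k, v (k + 1) ≤ (1 - q) * v k + b k) (hv : ∀ k, 0 ≤ v k) (K : ℕ) :
    ∑ k ∈ Finset.range K, v k ≤ 1 / q * (v 0 + ∑ k ∈ Finset.range K, b k) := by
  have := sum_le_of_potential (v := v) (u := fun k => q * v k) (b := b)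
    (fun k => by linarith [h k]) hv K
  rw [← Finset.mul_sum] at this
  rw [one_div, ← div_eq_inv_mul, le_div_iff₀ hq]
  linarith

/-- The three coupled estimates for the sums `G` of `‖∇Φ‖²`, `E` of the dual errors and `r` of the
tracking errors close as soon as the ratio `ε` of the stepsizes is small. -/
lemma exists_ratio_combine {a f b μ : ℝ} (ha : 0 < a) (hf : 0 < f) (hb : 0 < b) (hμ : 0 < μ) :
    ∃ ε > 0, ∃ cX ≥ 0, ∃ cA ≥ 0, ∃ cB ≥ 0, ∃ cC ≥ 0, ∀ G X E r A B D : ℝ, 0 ≤ r →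
      1 / 4 * G ≤ a * (X + 2 * E + f * r) + A →
      3 * μ / 4 * E ≤ b * r + B →
      μ / 4 * r ≤ 4 / μ * ε ^ 2 * (2 * G + 4 * (a * (X + 2 * E + f * r))) + D →
      G ≤ cX * X + cA * A + cB * B + cC * D := by
  set f₁ := 8 * a / (3 * μ) with hf₁
  set f₂ := f₁ * b + a * f with hf₂
  have hf₁0 : 0 < f₁ := by positivity
  have hf₂0 : 0 < f₂ := by positivity
  -- `384` makes the terms in `r` on the right of the third estimate add up to `μ / 8 * r`
  set ε := Real.sqrt (μ ^ 2 / (384 * f₂)) with hε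
  have hε2 : ε ^ 2 = μ ^ 2 / (384 * f₂) := Real.sq_sqrt (by positivity)
  have hε0 : 0 < ε := Real.sqrt_pos.2 (by positivity)
  have he : 48 / μ * ε ^ 2 * f₂ = μ / 8 := by rw [hε2]; field_simp; norm_num
  set e₁ := 48 / μ * ε ^ 2 with he₁
  set e₂ := 32 / μ * ε ^ 2 with he₂
  set t := 32 * f₂ / μ with ht
  have he₁0 : 0 < e₁ := by positivity
  have he₂0 : 0 < e₂ := by positivity
  have ht0 : 0 < t := by positivity
  refine ⟨ε, hε0, (4 + t * e₁) * a, by positivity, 4 + t * e₂, by positivity,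
    (4 + t * e₁) * f₁, by positivity, t, by positivity, ?_⟩
  intro G X E r A B D hr h1 h2 h3
  set F := a * (X + 2 * E + f * r) with hF
  have hE : 2 * a * E ≤ f₁ * (b * r + B) := by
    have : f₁ * (3 * μ / 4 * E) = 2 * a * E := by rw [hf₁]; field_simp; ring
    rw [← this]
    exact mul_le_mul_of_nonneg_left h2 hf₁0.le
  have hF' : F ≤ a * X + f₁ * B + f₂ * r := by
    rw [hF, hf₂]; linarith
  have h4 : μ / 4 * r ≤ e₁ * F + e₂ * A + D := by
    have h5 : 2 * G + 4 * F ≤ 12 * F + 8 * A := by linarith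
    have h6 := mul_le_mul_of_nonneg_left h5 (by positivity : 0 ≤ 4 / μ * ε ^ 2)
    have e : 4 / μ * ε ^ 2 * (12 * F + 8 * A) = e₁ * F + e₂ * A := by rw [he₁, he₂]; ring
    linarith
  have h7 := mul_le_mul_of_nonneg_left hF' he₁0.le
  have h8 : e₁ * (f₂ * r) = μ / 8 * r := by rw [← mul_assoc, he]
  have h9 : μ / 8 * r ≤ e₁ * (a * X + f₁ * B) + e₂ * A + D := by linarith
  have h10 : 4 * f₂ * r = t * (μ / 8 * r) := by rw [ht]; field_simp; ring
  have h11 := mul_le_mul_of_nonneg_left h9 ht0.le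
  linarith

/-- The noise in the descent inequality. -/
noncomputable def descentNoise {n p d : ℕ} {Ξ : Type*} [MeasurableSpace Ξ] (A : Problem n p d Ξ)
    (s : State n p d) (g : Fin n → Euc p) : ℝ :=
  inner ℝ (gradient A.Phi (nodeMean s.x))
    (nodeMean g - nodeMean fun i => gradX (A.localObj i) (s.x i) (s.y i))

/-- The noise in the dual step, where `w` is the reference point and `b` the weight of the
consensus error. -/
noncomputable def dualNoise {n p d : ℕ} {Ξ : Type*} [MeasurableSpace Ξ] (A : Problem n p d Ξ)
    (β γy μ S b : ℝ) (w : Euc p) (s : State n p d) (g : Fin n → Euc d) : ℝ :=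
  2 * (1 + μ * thetaC β γy S s / 4) * ∑ i, inner ℝ (s.y i - A.yStar w
    - (1 / (b * offsetY S s ^ β)) • gradY (A.localObj i) (s.x i) (s.y i))
    (g i - gradY (A.localObj i) (s.x i) (s.y i))

/-- The noise in the step of the slow tracker `w`. -/
noncomputable def trackerNoise {n p d : ℕ} {Ξ : Type*} [MeasurableSpace Ξ] (A : Problem n p d Ξ)
    (α β γx γy μ S : ℝ) (w : Euc p) (s : State n p d) (g : Fin n → Euc p) : ℝ :=
  2 * (1 - μ * thetaC β γy S s) * (etaC α γx S s / thetaC β γy S s)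
    * inner ℝ (nodeMean s.x - w)
      (nodeMean g - nodeMean fun i => gradX (A.localObj i) (s.x i) (s.y i))

/-- The squared distance of the dual iterates to the maximizer at the reference point `w`. -/
noncomputable def dualErr {n p d : ℕ} {Ξ : Type*} [MeasurableSpace Ξ] (A : Problem n p d Ξ)
    (w : Euc p) (s : State n p d) : ℝ := ∑ i, ‖s.y i - A.yStar w‖ ^ 2

/-- A bound on `∑ k < K, relSq t`. -/
noncomputable def relBound (n : ℕ) (c C t : ℝ) (K : ℕ) : ℝ :=
  n * Real.log ((c + K * C ^ 2) / c) * (c ^ (1 - t) + (c + K * C ^ 2) ^ (1 - t))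

/-- A bound on `∑ k < K, stepErr t S`. -/
noncomputable def stepBound (n : ℕ) (c C t S : ℝ) (K : ℕ) : ℝ :=
  relBound n c C t K + (2 * S) ^ (2 * t) * relBound n c C (2 * t) K

namespace Trajectory

variable {n p d : ℕ} {Ξ : Type*} [MeasurableSpace Ξ] {A : Problem n p d Ξ}
  {W : Matrix (Fin n) (Fin n) ℝ} {α β γx γy c μ L C : ℝ} {s : ℕ → State n p d}
  {gx : ℕ → Fin n → Euc p} {gy : ℕ → Fin n → Euc d} {ε S M R : ℝ}

lemma sum_relSq_x_le (T : Trajectory A W α β γx γy c μ L C s gx gy) (t : ℝ) (K : ℕ) :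
    ∑ k ∈ Finset.range K, relSq t (s k).mx (gx k) ≤ relBound n c C t K :=
  T.accX.sum_div_rpow_le t K

lemma sum_relSq_y_le (T : Trajectory A W α β γx γy c μ L C s gx gy) (t : ℝ) (K : ℕ) :
    ∑ k ∈ Finset.range K, relSq t (s k).my (gy k) ≤ relBound n c C t K :=
  T.accY.sum_div_rpow_le t K

lemma sum_stepErr_x_le (T : Trajectory A W α β γx γy c μ L C s gx gy)
    (O : Offset n (rho W) α β γx γy μ C ε S) (K : ℕ) :
    ∑ k ∈ Finset.range K, stepErr α S (s k).mx (gx k) ≤ stepBound n c C α S K := by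
  have := O.one_le
  simp only [stepErr, stepBound, Finset.sum_add_distrib, ← Finset.mul_sum]
  gcongr
  · exact T.sum_relSq_x_le α K
  · exact T.sum_relSq_x_le (2 * α) K

lemma sum_stepErr_y_le (T : Trajectory A W α β γx γy c μ L C s gx gy)
    (O : Offset n (rho W) α β γx γy μ C ε S) (K : ℕ) :
    ∑ k ∈ Finset.range K, stepErr β S (s k).my (gy k) ≤ stepBound n c C β S K := by
  have := O.one_le
  simp only [stepErr, stepBound, Finset.sum_add_distrib, ← Finset.mul_sum]
  gcongr
  · exact T.sum_relSq_y_le β K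
  · exact T.sum_relSq_y_le (2 * β) K

lemma spread_y_zero_le (T : Trajectory A W α β γx γy c μ L C s gx gy) :
    spread (s 0).y ≤ n * (2 * C / μ) ^ 2 := by
  refine (sum_norm_sub_nodeMean_sq_le T.regular.node_pos _
    ((s 0).y ⟨0, T.regular.node_pos⟩)).trans ?_
  refine (Finset.sum_le_sum fun i _ => pow_le_pow_left₀ (norm_nonneg _)
    (T.regular.norm_sub_le_of_mem (T.y_mem 0 i) (T.y_mem 0 _)) 2).trans_eq ?_
  simp

lemma sum_spread_x_le (T : Trajectory A W α β γx γy c μ L C s gx gy)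
    (hx0 : ∀ i, ‖(s 0).x i - nodeMean (s 0).x‖ ≤ R) (K : ℕ) :
    ∑ k ∈ Finset.range K, spread (s k).x ≤ 2 / (1 - rho W) * (n * R ^ 2
      + 2 / (1 - rho W) * (γx ^ 2 * relBound n c C (2 * α) K)) := by
  have hs : 0 < 1 - rho W := by linarith [T.rho_lt_one]
  have h := sum_le_of_contraction (v := fun k => spread (s k).x)
    (b := fun k => 2 / (1 - rho W) * (γx ^ 2 * relSq (2 * α) (s k).mx (gx k)))
    (half_pos hs) T.spread_x_succ_le (fun k => spread_nonneg _) K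
  rw [one_div_div] at h
  refine h.trans (mul_le_mul_of_nonneg_left (add_le_add ?_ ?_) (by positivity))
  · refine (Finset.sum_le_sum fun i _ => pow_le_pow_left₀ (norm_nonneg _) (hx0 i) 2).trans_eq ?_
    simp
  · rw [← Finset.mul_sum, ← Finset.mul_sum]
    have := T.sum_relSq_x_le (2 * α) K
    gcongr

lemma sum_spread_y_le (T : Trajectory A W α β γx γy c μ L C s gx gy) (K : ℕ) :
    ∑ k ∈ Finset.range K, spread (s k).y ≤ 2 / (1 - rho W) * (n * (2 * C / μ) ^ 2
      + 2 / (1 - rho W) * (γy ^ 2 * relBound n c C (2 * β) K)) := by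
  have hs : 0 < 1 - rho W := by linarith [T.rho_lt_one]
  have h := sum_le_of_contraction (v := fun k => spread (s k).y)
    (b := fun k => 2 / (1 - rho W) * (γy ^ 2 * relSq (2 * β) (s k).my (gy k)))
    (half_pos hs) T.spread_y_succ_le (fun k => spread_nonneg _) K
  rw [one_div_div] at h
  refine h.trans (mul_le_mul_of_nonneg_left (add_le_add T.spread_y_zero_le ?_) (by positivity))
  rw [← Finset.mul_sum, ← Finset.mul_sum]
  have := T.sum_relSq_y_le (2 * β) K
  gcongr

lemma offsetY_zero (T : Trajectory A W α β γx γy c μ L C s gx gy) : offsetY S (s 0) = S + c := by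
  rw [offsetY, le_antisymm (avg_le T.regular.node_pos fun i => (T.my_zero i).le)
    (le_avg T.regular.node_pos fun i => (T.my_zero i).ge)]

lemma sum_weighted_spread_y_le (T : Trajectory A W α β γx γy c μ L C s gx gy)
    (O : Offset n (rho W) α β γx γy μ C ε S) (K : ℕ) :
    ∑ k ∈ Finset.range K, offsetY S (s k) ^ β * spread (s k).y
      ≤ 4 / (1 - rho W) * ((S + c) ^ β * (n * (2 * C / μ) ^ 2)
        + 4 / (1 - rho W)
          * (γy ^ 2 * (relBound n c C β K + (2 * S) ^ β * relBound n c C (2 * β) K))) := by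
  have hs : 0 < 1 - rho W := by linarith [T.rho_lt_one]
  have h := sum_le_of_contraction (v := fun k => offsetY S (s k) ^ β * spread (s k).y)
    (b := fun k => 4 / (1 - rho W) * (γy ^ 2 * (relSq β (s k).my (gy k)
      + (2 * S) ^ β * relSq (2 * β) (s k).my (gy k))))
    (by positivity : 0 < (1 - rho W) / 4)
    (T.weighted_spread_y_succ_le O)
    (fun k => mul_nonneg (Real.rpow_nonneg (T.offsetY_pos O k).le _) (spread_nonneg _)) K
  rw [one_div_div] at h
  refine h.trans (mul_le_mul_of_nonneg_left (add_le_add ?_ ?_) (by positivity))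
  · have h0 := T.offsetY_pos O 0
    have h1 := T.spread_y_zero_le
    rw [T.offsetY_zero] at *
    gcongr
  · have := T.sum_relSq_y_le β K
    have := T.sum_relSq_y_le (2 * β) K
    have := O.one_le
    simp only [← Finset.mul_sum, Finset.sum_add_distrib]
    gcongr

/-- The descent inequality, summed. The function values are weighted by the nondecreasing `1 / η`,
so summation by parts needs only the oscillation of `Φ`. -/
lemma sum_descent_le (T : Trajectory A W α β γx γy c μ L C s gx gy)
    (O : Offset n (rho W) α β γx γy μ C ε S) (hM : ∀ x x', A.Phi x - A.Phi x' ≤ M) (K : ℕ) :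
    1 / 4 * ∑ k ∈ Finset.range K, ‖gradient A.Phi (nodeMean (s k).x)‖ ^ 2
      ≤ L ^ 2 / (2 * n) * (∑ k ∈ Finset.range K, spread (s k).x
          + 2 * ∑ k ∈ Finset.range K, dualErr A (tracker β γy μ S s k) (s k)
          + 2 * n * (L / μ) ^ 2
            * ∑ k ∈ Finset.range K, ‖nodeMean (s k).x - tracker β γy μ S s k‖ ^ 2)
        + (M * ((S + (c + K * C ^ 2)) ^ α / γx)
          + (1 + L * (2 + L / μ) * γx) * stepBound n c C α S K
          - ∑ k ∈ Finset.range K, descentNoise A (s k) (gx k)) := by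
  have hL := T.regular.L_pos
  have hμ := T.regular.mu_pos
  have hγ := T.γx_pos
  have hα0 : 0 ≤ α := by linarith [T.β_pos, T.β_lt_α]
  have hM0 : 0 ≤ M := by simpa using hM 0 0
  set a : ℕ → ℝ := fun k => 1 / etaC α γx S (s k) with ha
  have ha' : ∀ k, a k = offsetX S (s k) ^ α / γx := fun k => by
    simp only [ha, etaC, one_div_div]
  have ham : Monotone a := monotone_nat_of_le_succ fun k => by
    rw [ha', ha']
    have := T.offsetX_pos O k
    have := T.offsetX_le_succ (S := S) k
    gcongr
  have hstep : ∀ k, 1 / 4 * ‖gradient A.Phi (nodeMean (s k).x)‖ ^ 2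
      ≤ L ^ 2 / (2 * n) * (spread (s k).x + 2 * dualErr A (tracker β γy μ S s k) (s k)
          + 2 * n * (L / μ) ^ 2 * ‖nodeMean (s k).x - tracker β γy μ S s k‖ ^ 2)
        + a k * (A.Phi (nodeMean (s k).x) - A.Phi (nodeMean (s (k + 1)).x))
        + (1 + L * (2 + L / μ) * γx) * stepErr α S (s k).mx (gx k)
        - descentNoise A (s k) (gx k) := fun k => by
    have h1 := T.regular.descent_step (T.etaC_pos O k) (T.nodeMean_x_succ (S := S) k)
      (G := nodeMean fun i => gradX (A.localObj i) ((s k).x i) ((s k).y i))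
    have h2 := T.regular.norm_gradient_Phi_sub_sq_le (s k).x (s k).y (T.y_mem k)
      (tracker β γy μ S s k)
    have h3 := T.norm_xErr_sq_div_le O k
    have h4 := mul_le_mul_of_nonneg_left (T.sum_primal_sq_le O k)
      (by positivity : 0 ≤ L * (2 + L / μ))
    have e : L ^ 2 / (2 * n) * (spread (s k).x + 2 * dualErr A (tracker β γy μ S s k) (s k)
          + 2 * n * (L / μ) ^ 2 * ‖nodeMean (s k).x - tracker β γy μ S s k‖ ^ 2)
        = 1 / 2 * (L ^ 2 / n * (spread (s k).x + 2 * dualErr A (tracker β γy μ S s k) (s k)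
          + 2 * n * (L / μ) ^ 2 * ‖nodeMean (s k).x - tracker β γy μ S s k‖ ^ 2)) := by ring
    rw [e]
    rw [← descentNoise] at h1
    rw [← spread, ← dualErr] at h2
    simp only [ha]
    linarith
  have hsum := Finset.sum_le_sum fun k (_ : k ∈ Finset.range K) => hstep k
  simp only [Finset.sum_sub_distrib, Finset.sum_add_distrib, ← Finset.mul_sum] at hsum
  have hab := sum_weight_mul_sub_le ham (by rw [ha']; have := T.offsetX_pos O 0; positivity)
    (fun j k => hM (nodeMean (s j).x) (nodeMean (s k).x)) K
  have haK : M * a K ≤ M * ((S + (c + K * C ^ 2)) ^ α / γx) := by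
    rw [ha']
    have := T.offsetX_pos O K
    have := T.offsetX_le (S := S) K
    gcongr
  have hE := mul_le_mul_of_nonneg_left (T.sum_stepErr_x_le O K)
    (by positivity : 0 ≤ 1 + L * (2 + L / μ) * γx)
  linarith

/-- The dual steps, summed with the potential `(1 / θ - μ / 4) E`; the weight in the Young
inequality for the consensus error is `(1 - ρ) V ^ β`. -/
lemma sum_dual_le (T : Trajectory A W α β γx γy c μ L C s gx gy)
    (O : Offset n (rho W) α β γx γy μ C ε S) (K : ℕ) :
    3 * μ / 4 * ∑ k ∈ Finset.range K, dualErr A (tracker β γy μ S s k) (s k)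
      ≤ (8 * n * (2 * L ^ 2 / μ + L / 2) + 8 * n * (L / μ) ^ 2 * μ)
          * ∑ k ∈ Finset.range K, ‖nodeMean (s k).x - tracker β γy μ S s k‖ ^ 2
        + ((S + c) ^ β / γy * (n * (2 * C / μ) ^ 2)
          + (2 * L ^ 2 / μ + L / 2) * (8 * ∑ k ∈ Finset.range K, spread (s k).x
            + 4 * ∑ k ∈ Finset.range K, spread (s k).y)
          + 2 / (1 - rho W) * relBound n c C β K
          + 2 * (1 - rho W) * ∑ k ∈ Finset.range K, offsetY S (s k) ^ β * spread (s k).y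
          + (8 / μ + 2 * γy) * stepBound n c C β S K
          + ∑ k ∈ Finset.range K,
              dualNoise A β γy μ S (1 - rho W) (tracker β γy μ S s k) (s k) (gy k)) := by
  have hL := T.regular.L_pos
  have hμ := T.regular.mu_pos
  have hγ := T.γy_pos
  have hs : 0 < 1 - rho W := by linarith [T.rho_lt_one]
  set E : ℕ → ℝ := fun k => dualErr A (tracker β γy μ S s k) (s k) with hE
  have hE0 : ∀ k, 0 ≤ E k := fun k => Finset.sum_nonneg fun i _ => by positivity
  set θ : ℕ → ℝ := fun k => thetaC β γy S (s k) with hθ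
  have hθ0 : ∀ k, 0 < θ k := fun k => T.thetaC_pos O k
  set cL := 2 * L ^ 2 / μ + L / 2 with hcL
  have hcL0 : 0 ≤ cL := by positivity
  set r : ℕ → ℝ := fun k => ‖nodeMean (s k).x - tracker β γy μ S s k‖ ^ 2 with hr
  have hstep : ∀ k, (1 / θ (k + 1) - μ / 4) * E (k + 1) + 3 * μ / 4 * E k
      ≤ (1 / θ k - μ / 4) * E k + ((8 * n * cL + 8 * n * (L / μ) ^ 2 * μ) * r k
        + cL * (8 * spread (s k).x + 4 * spread (s k).y)
        + 2 / (1 - rho W) * relSq β (s k).my (gy k)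
        + 2 * (1 - rho W) * (offsetY S (s k) ^ β * spread (s k).y)
        + (8 / μ + 2 * γy) * stepErr β S (s k).my (gy k)
        + dualNoise A β γy μ S (1 - rho W) (tracker β γy μ S s k) (s k) (gy k)) := fun k => by
    have hV := Real.rpow_pos_of_pos (T.offsetY_pos O k) β
    have h1 := T.regular.dual_step T.doublyStochastic (s k).x (s k).y (gy k) (s (k + 1)).y
      (T.y_mem k) (fun j => γy / ((s k).my j + ‖gy k j‖ ^ 2) ^ β) (tracker β γy μ S s k)
      (tracker β γy μ S s (k + 1)) (hθ0 k) (mul_pos hs hV) (T.mu_mul_thetaC_le O k) rfl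
      (T.y_succ k)
    rw [← dualNoise, ← spread, ← spread, ← dualErr, ← dualErr] at h1
    have h2 := mul_le_mul_of_nonneg_left (T.sum_dual_sub_sq_le O k) (by positivity : 0 ≤ 8 / μ)
    have h3 := mul_le_mul_of_nonneg_left (T.sum_dual_sq_le O k) (by norm_num : (0 : ℝ) ≤ 2)
    have h4 : 4 * (1 / (2 * ((1 - rho W) * offsetY S (s k) ^ β)) * ∑ i, ‖gy k i‖ ^ 2)
        ≤ 2 / (1 - rho W) * relSq β (s k).my (gy k) := by
      have e : 4 * (1 / (2 * ((1 - rho W) * offsetY S (s k) ^ β)) * ∑ i, ‖gy k i‖ ^ 2)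
          = 2 / (1 - rho W) * ∑ i, ‖gy k i‖ ^ 2 / offsetY S (s k) ^ β := by
        rw [← Finset.sum_div]; field_simp; ring
      rw [e]
      refine mul_le_mul_of_nonneg_left (Finset.sum_le_sum fun i _ => ?_) (by positivity)
      refine div_le_div_of_nonneg_left (by positivity)
        (Real.rpow_pos_of_pos (T.my_pos k i) _) ?_
      exact Real.rpow_le_rpow (T.my_pos k i).le (T.my_le_offsetY O k i) T.β_pos.le
    have h5 : (1 / θ (k + 1) - μ / 4) * E (k + 1) ≤ 1 / θ k * E (k + 1) := by
      refine mul_le_mul_of_nonneg_right ?_ (hE0 _)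
      linarith [T.inv_thetaC_succ_le O k]
    change 1 / θ k * E (k + 1) ≤ (1 / θ k - μ) * E k + _ + _ + _ + _ + _ at h1
    have e2 : 4 * ((1 - rho W) * offsetY S (s k) ^ β / 2 * spread (s k).y)
        = 2 * (1 - rho W) * (offsetY S (s k) ^ β * spread (s k).y) := by ring
    change _ ≤ _ + 4 * (cL * (2 * spread (s k).x + 2 * n * r k + spread (s k).y) + _) + _ + _
      + 8 * n * (L / μ) ^ 2 * μ * r k + _ at h1
    rw [mul_add 4, mul_add 4 (_ * ∑ i, ‖gy k i‖ ^ 2)] at h1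
    linarith
  have hv : ∀ k, 0 ≤ (1 / θ k - μ / 4) * E k := fun k => by
    refine mul_nonneg ?_ (hE0 k)
    have h1 : μ ≤ 1 / θ k := by
      rw [le_div_iff₀ (hθ0 k)]; exact T.mu_mul_thetaC_le O k
    linarith
  have hsum := sum_le_of_potential hstep hv K
  simp only [Finset.sum_add_distrib, ← Finset.mul_sum] at hsum
  have h0 : (1 / θ 0 - μ / 4) * E 0 ≤ (S + c) ^ β / γy * (n * (2 * C / μ) ^ 2) := by
    have h1 : (1 / θ 0 - μ / 4) * E 0 ≤ 1 / θ 0 * E 0 :=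
      mul_le_mul_of_nonneg_right (by linarith) (hE0 0)
    have h2 : 1 / θ 0 = (S + c) ^ β / γy := by
      simp only [hθ, thetaC, one_div_div, T.offsetY_zero]
    have h3 : E 0 ≤ n * (2 * C / μ) ^ 2 := by
      refine (Finset.sum_le_sum fun i _ => pow_le_pow_left₀ (norm_nonneg _)
        (T.regular.norm_sub_le_of_mem (T.y_mem 0 i) (T.regular.yStar_mem _)) 2).trans_eq ?_
      simp
    have h4 : 0 ≤ 1 / θ 0 := (one_div_pos.2 (hθ0 0)).le
    rw [← h2]
    exact h1.trans (mul_le_mul_of_nonneg_left h3 h4)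
  have h6 := mul_le_mul_of_nonneg_left (T.sum_relSq_y_le β K)
    (by positivity : 0 ≤ 2 / (1 - rho W))
  have h7 := mul_le_mul_of_nonneg_left (T.sum_stepErr_y_le O K)
    (by positivity : 0 ≤ 8 / μ + 2 * γy)
  linarith

/-- The steps of the slow tracker, summed with the potential `(1 / θ - μ / 4) ‖x̄ - w‖²`. -/
lemma sum_tracker_le (T : Trajectory A W α β γx γy c μ L C s gx gy)
    (O : Offset n (rho W) α β γx γy μ C ε S) (hε : 0 ≤ ε) (K : ℕ) :
    μ / 4 * ∑ k ∈ Finset.range K, ‖nodeMean (s k).x - tracker β γy μ S s k‖ ^ 2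
      ≤ 4 / μ * ε ^ 2 * (2 * ∑ k ∈ Finset.range K, ‖gradient A.Phi (nodeMean (s k).x)‖ ^ 2
          + 4 * (L ^ 2 / (2 * n) * (∑ k ∈ Finset.range K, spread (s k).x
          + 2 * ∑ k ∈ Finset.range K, dualErr A (tracker β γy μ S s k) (s k)
          + 2 * n * (L / μ) ^ 2
            * ∑ k ∈ Finset.range K, ‖nodeMean (s k).x - tracker β γy μ S s k‖ ^ 2)))
        + ((4 / μ * ε ^ 2 + ε * γx) * stepBound n c C α S K
          - ∑ k ∈ Finset.range K,
              trackerNoise A α β γx γy μ S (tracker β γy μ S s k) (s k) (gx k)) := by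
  have hL := T.regular.L_pos
  have hμ := T.regular.mu_pos
  have hγ := T.γx_pos
  set θ : ℕ → ℝ := fun k => thetaC β γy S (s k) with hθ
  have hθ0 : ∀ k, 0 < θ k := fun k => T.thetaC_pos O k
  set r : ℕ → ℝ := fun k => ‖nodeMean (s k).x - tracker β γy μ S s k‖ ^ 2 with hr
  have hr0 : ∀ k, 0 ≤ r k := fun k => by positivity
  set G : ℕ → ℝ := fun k => ‖gradient A.Phi (nodeMean (s k).x)‖ ^ 2 with hG
  have hstep : ∀ k, (1 / θ (k + 1) - μ / 4) * r (k + 1) + μ / 4 * r k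
      ≤ (1 / θ k - μ / 4) * r k + (4 / μ * ε ^ 2 * (2 * G k
        + 4 * (L ^ 2 / (2 * n) * (spread (s k).x + 2 * dualErr A (tracker β γy μ S s k) (s k)
          + 2 * n * (L / μ) ^ 2 * r k)))
        + (4 / μ * ε ^ 2 + ε * γx) * stepErr α S (s k).mx (gx k)
        - trackerNoise A α β γx γy μ S (tracker β γy μ S s k) (s k) (gx k)) := fun k => by
    have hη := T.etaC_pos O k
    set η := etaC α γx S (s k) with hηdef
    set e := xErr α γx S (s k) (gx k) (gy k) with he
    set Gm := nodeMean fun i => gradX (A.localObj i) ((s k).x i) ((s k).y i) with hGm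
    have h1 := tracker_step (r := nodeMean (s k).x - tracker β γy μ S s k) (g := nodeMean (gx k))
      (G := Gm) (e := e) hη (hθ0 k) hμ (T.mu_mul_thetaC_le O k)
    have e1 : nodeMean (s (k + 1)).x - tracker β γy μ S s (k + 1)
        = (1 - μ * θ k) • (nodeMean (s k).x - tracker β γy μ S s k)
          - (η • nodeMean (gx k) + e) := by
      rw [T.nodeMean_x_succ (S := S) k, tracker, sub_smul, one_smul]
      abel
    rw [← e1] at h1
    change 1 / θ k * r (k + 1) ≤ (1 / θ k - μ / 2) * r k + _ + _
      - trackerNoise A α β γx γy μ S (tracker β γy μ S s k) (s k) (gx k) at h1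
    have hq := T.etaC_div_thetaC_le O k
    change η / θ k ≤ ε at hq
    have hq0 : 0 ≤ η / θ k := (div_pos hη (hθ0 k)).le
    have hq2 : (η / θ k) ^ 2 ≤ ε ^ 2 := pow_le_pow_left₀ hq0 hq 2
    have hP0 := T.stepErr_x_nonneg O k
    set PX := stepErr α S (s k).mx (gx k) with hPX
    have h2 : ‖e‖ ^ 2 / θ k ^ 2 ≤ ε ^ 2 * PX := by
      have e2 : ‖e‖ ^ 2 / θ k ^ 2 = (η / θ k) ^ 2 * (‖e‖ ^ 2 / η ^ 2) := by
        have := (hθ0 k).ne'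
        field_simp
      rw [e2]
      exact mul_le_mul hq2 (T.norm_xErr_sq_div_le O k) (by positivity) (by positivity)
    have h3 : ‖η • nodeMean (gx k) + e‖ ^ 2 / θ k ≤ ε * (γx * PX) := by
      have e2 : ‖η • nodeMean (gx k) + e‖ ^ 2 / θ k
          = (η / θ k) * (‖η • nodeMean (gx k) + e‖ ^ 2 / η) := by
        have := (hθ0 k).ne'
        field_simp
      rw [e2]
      exact mul_le_mul hq (T.sum_primal_sq_le O k) (by positivity) hε
    have h4 : ‖Gm‖ ^ 2 ≤ 2 * G k
        + 4 * (L ^ 2 / (2 * n) * (spread (s k).x + 2 * dualErr A (tracker β γy μ S s k) (s k)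
          + 2 * n * (L / μ) ^ 2 * r k)) := by
      have h5 := T.regular.norm_gradient_Phi_sub_sq_le (s k).x (s k).y (T.y_mem k)
        (tracker β γy μ S s k)
      rw [← spread, ← dualErr] at h5
      have h6 := norm_sub_le (gradient A.Phi (nodeMean (s k).x))
        (gradient A.Phi (nodeMean (s k).x) - Gm)
      rw [sub_sub_cancel] at h6
      have h7 := pow_le_pow_left₀ (norm_nonneg _) h6 2
      have h8 : ‖Gm‖ ^ 2 ≤ 2 * G k + 2 * ‖gradient A.Phi (nodeMean (s k).x) - Gm‖ ^ 2 := by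
        simp only [hG]
        nlinarith [sq_nonneg (‖gradient A.Phi (nodeMean (s k).x)‖
          - ‖gradient A.Phi (nodeMean (s k).x) - Gm‖)]
      have e2 : 4 * (L ^ 2 / (2 * n) * (spread (s k).x
          + 2 * dualErr A (tracker β γy μ S s k) (s k) + 2 * n * (L / μ) ^ 2 * r k))
          = 2 * (L ^ 2 / n * (spread (s k).x
          + 2 * dualErr A (tracker β γy μ S s k) (s k) + 2 * n * (L / μ) ^ 2 * r k)) := by ring
      rw [e2]
      linarith
    set B := 2 * G k
        + 4 * (L ^ 2 / (2 * n) * (spread (s k).x + 2 * dualErr A (tracker β γy μ S s k) (s k)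
          + 2 * n * (L / μ) ^ 2 * r k))
    have h5 : (1 / θ (k + 1) - μ / 4) * r (k + 1) ≤ 1 / θ k * r (k + 1) := by
      refine mul_le_mul_of_nonneg_right ?_ (hr0 _)
      linarith [T.inv_thetaC_succ_le O k]
    have h6 : 4 / μ * ((η / θ k) ^ 2 * ‖Gm‖ ^ 2 + ‖e‖ ^ 2 / θ k ^ 2)
        ≤ 4 / μ * (ε ^ 2 * B + ε ^ 2 * PX) := by gcongr
    linarith
  have hv : ∀ k, 0 ≤ (1 / θ k - μ / 4) * r k := fun k => by
    refine mul_nonneg ?_ (hr0 k)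
    have h1 : μ ≤ 1 / θ k := by
      rw [le_div_iff₀ (hθ0 k)]; exact T.mu_mul_thetaC_le O k
    linarith
  have hsum := sum_le_of_potential hstep hv K
  have hr00 : r 0 = 0 := by simp [hr, tracker]
  rw [hr00, mul_zero, zero_add] at hsum
  simp only [Finset.sum_add_distrib, Finset.sum_sub_distrib, ← Finset.mul_sum] at hsum
  have h7 := mul_le_mul_of_nonneg_left (T.sum_stepErr_x_le O K)
    (by positivity : 0 ≤ 4 / μ * ε ^ 2 + ε * γx)
  linarith

end Trajectory

/-- A bound on the summed primal consensus error. -/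
noncomputable def spreadBoundX (n : ℕ) (γx c C R α ρ : ℝ) (K : ℕ) : ℝ :=
  2 / (1 - ρ) * (n * R ^ 2 + 2 / (1 - ρ) * (γx ^ 2 * relBound n c C (2 * α) K))

/-- A bound on the summed dual consensus error. -/
noncomputable def spreadBoundY (n : ℕ) (γy c μ C β ρ : ℝ) (K : ℕ) : ℝ :=
  2 / (1 - ρ) * (n * (2 * C / μ) ^ 2 + 2 / (1 - ρ) * (γy ^ 2 * relBound n c C (2 * β) K))

/-- A bound on the summed dual consensus error with the weights `V ^ β`. -/
noncomputable def weightedSpreadBound (n : ℕ) (γy c μ C β ρ S : ℝ) (K : ℕ) : ℝ :=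
  4 / (1 - ρ) * ((S + c) ^ β * (n * (2 * C / μ) ^ 2)
    + 4 / (1 - ρ) * (γy ^ 2 * (relBound n c C β K + (2 * S) ^ β * relBound n c C (2 * β) K)))

/-- The deterministic error of the summed descent inequality. -/
noncomputable def descentBound (n : ℕ) (γx c μ L C M α S : ℝ) (K : ℕ) : ℝ :=
  M * ((S + (c + K * C ^ 2)) ^ α / γx) + (1 + L * (2 + L / μ) * γx) * stepBound n c C α S K

/-- The deterministic error of the summed dual steps. -/
noncomputable def dualBound (n : ℕ) (γx γy c μ L C R α β ρ S : ℝ) (K : ℕ) : ℝ :=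
  (S + c) ^ β / γy * (n * (2 * C / μ) ^ 2)
    + (2 * L ^ 2 / μ + L / 2) * (8 * spreadBoundX n γx c C R α ρ K
      + 4 * spreadBoundY n γy c μ C β ρ K)
    + 2 / (1 - ρ) * relBound n c C β K
    + 2 * (1 - ρ) * weightedSpreadBound n γy c μ C β ρ S K
    + (8 / μ + 2 * γy) * stepBound n c C β S K

/-- Along every trajectory the sum of `‖∇Φ‖²` is bounded by deterministic quantities, up to noise.
The ratio `ε` and the coefficients do not depend on the trajectory. -/
lemma exists_pathwise_bound (n : ℕ) (hn : 0 < n) (γx μ L : ℝ) (hμ : 0 < μ)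
    (hL : 0 < L) :
    ∃ ε > 0, ∃ cX ≥ 0, ∃ cA ≥ 0, ∃ cB ≥ 0, ∃ cC ≥ 0,
      ∀ (p d : ℕ) (Ξ : Type*) [MeasurableSpace Ξ] (A : Problem n p d Ξ)
        (W : Matrix (Fin n) (Fin n) ℝ) (α β γy c C S M R : ℝ) (s : ℕ → State n p d)
        (gx : ℕ → Fin n → Euc p) (gy : ℕ → Fin n → Euc d),
        Trajectory A W α β γx γy c μ L C s gx gy → Offset n (rho W) α β γx γy μ C ε S →
        (∀ x x', A.Phi x - A.Phi x' ≤ M) →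
        (∀ i, ‖(s 0).x i - nodeMean (s 0).x‖ ≤ R) → ∀ K : ℕ,
        ∑ k ∈ Finset.range K, ‖gradient A.Phi (nodeMean (s k).x)‖ ^ 2
          ≤ cX * spreadBoundX n γx c C R α (rho W) K
            + cA * (descentBound n γx c μ L C M α S K
              - ∑ k ∈ Finset.range K, descentNoise A (s k) (gx k))
            + cB * (dualBound n γx γy c μ L C R α β (rho W) S K
              + ∑ k ∈ Finset.range K,
                dualNoise A β γy μ S (1 - rho W) (tracker β γy μ S s k) (s k) (gy k))
            + cC * ((4 / μ * ε ^ 2 + ε * γx) * stepBound n c C α S K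
              - ∑ k ∈ Finset.range K,
                trackerNoise A α β γx γy μ S (tracker β γy μ S s k) (s k) (gx k)) := by
  have hn' : (0 : ℝ) < n := by exact_mod_cast hn
  obtain ⟨ε, hε, cX, hcX, cA, hcA, cB, hcB, cC, hcC, h⟩ := exists_ratio_combine
    (a := L ^ 2 / (2 * n)) (f := 2 * n * (L / μ) ^ 2)
    (b := 8 * n * (2 * L ^ 2 / μ + L / 2) + 8 * n * (L / μ) ^ 2 * μ)
    (by positivity) (by positivity) (by positivity) hμ
  refine ⟨ε, hε, cX, hcX, cA, hcA, cB, hcB, cC, hcC, ?_⟩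
  intro p d Ξ _ A W α β γy c C S M R s gx gy T O hM hx0 K
  have hs : 0 < 1 - rho W := by linarith [T.rho_lt_one]
  have h1 := h _ _ _ _ _ _ _ (Finset.sum_nonneg fun i _ => by positivity)
    (T.sum_descent_le O hM K) (T.sum_dual_le O K) (T.sum_tracker_le O hε.le K)
  refine h1.trans ?_
  have hX : ∑ k ∈ Finset.range K, spread (s k).x ≤ spreadBoundX n γx c C R α (rho W) K :=
    T.sum_spread_x_le hx0 K
  have hY : ∑ k ∈ Finset.range K, spread (s k).y ≤ spreadBoundY n γy c μ C β (rho W) K :=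
    T.sum_spread_y_le K
  have hW : ∑ k ∈ Finset.range K, offsetY S (s k) ^ β * spread (s k).y
      ≤ weightedSpreadBound n γy c μ C β (rho W) S K := T.sum_weighted_spread_y_le O K
  have h2 := mul_le_mul_of_nonneg_left hX hcX
  have h3 : 0 ≤ 2 * L ^ 2 / μ + L / 2 := by positivity
  rw [descentBound, dualBound]
  gcongr

/-! ### Independence of the samples -/

/-- The noise of a sampled vector `G (q, ξ)` is orthogonal in expectation to every bounded `a`,
when `q` and `a` are independent of the sample `ξ`. -/
lemma integral_inner_noise {Q Ξ Ω : Type*} [MeasurableSpace Q] [MeasurableSpace Ξ]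
    {F mΩ : MeasurableSpace Ω} {m : ℕ} {P : Measure Ω} [IsProbabilityMeasure P] {D : Measure Ξ}
    [IsProbabilityMeasure D] (hF : F ≤ mΩ) {ξ : Ω → Ξ}
    (hξ : Measurable ξ) (hlaw : P.map ξ = D)
    (hind : Indep F (MeasurableSpace.comap ξ inferInstance) P)
    {q : Ω → Q} (hq : Measurable[F] q) {a : Ω → Euc m} (ha : Measurable[F] a)
    {G : Q × Ξ → Euc m} (hG : Measurable G) {B C : ℝ} (hGC : ∀ q, ∀ᵐ s ∂D, ‖G (q, s)‖ ≤ C)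
    (haB : ∀ᵐ ω ∂P, ‖a ω‖ ≤ B) :
    (∀ᵐ ω ∂P, ‖G (q ω, ξ ω)‖ ≤ C) ∧
      Integrable (fun ω => inner ℝ (a ω) (G (q ω, ξ ω) - ∫ s, G (q ω, s) ∂D)) P ∧
      ∫ ω, inner ℝ (a ω) (G (q ω, ξ ω) - ∫ s, G (q ω, s) ∂D) ∂P = 0 := by
  have haq : Measurable[F] fun ω => (a ω, q ω) := ha.prodMk hq
  have haq' : Measurable fun ω => (a ω, q ω) := haq.mono hF le_rfl
  have hI : IndepFun (fun ω => (a ω, q ω)) ξ P := by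
    rw [IndepFun_iff_Indep]
    exact indep_of_indep_of_le_left hind haq.comap_le
  have hmap : P.map (fun ω => ((a ω, q ω), ξ ω)) = (P.map fun ω => (a ω, q ω)).prod D := by
    rw [(indepFun_iff_map_prod_eq_prod_map_map haq'.aemeasurable hξ.aemeasurable).1 hI, hlaw]
  have hjoint : Measurable fun ω => ((a ω, q ω), ξ ω) := haq'.prodMk hξ
  have : IsProbabilityMeasure (P.map fun ω => (a ω, q ω)) :=
    Measure.isProbabilityMeasure_map haq'.aemeasurable
  -- the almost sure bound
  have hGq : Measurable fun z : (Euc m × Q) × Ξ => G (z.1.2, z.2) := by fun_prop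
  have hset : MeasurableSet {z : (Euc m × Q) × Ξ | ‖G (z.1.2, z.2)‖ ≤ C} :=
    measurableSet_le hGq.norm measurable_const
  have hae : ∀ᵐ ω ∂P, ‖G (q ω, ξ ω)‖ ≤ C := by
    have h1 : ∀ᵐ z ∂(P.map fun ω => ((a ω, q ω), ξ ω)), ‖G (z.1.2, z.2)‖ ≤ C := by
      rw [hmap, ae_iff]
      refine (Measure.measure_prod_null hset.compl).2 (Filter.Eventually.of_forall fun z => ?_)
      exact hGC z.2
    exact ae_of_ae_map hjoint.aemeasurable h1
  have hmean : Measurable fun z : Q => ∫ s, G (z, s) ∂D :=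
    (hG.stronglyMeasurable.integral_prod_right').measurable
  have hmeanC : ∀ z, ‖∫ s, G (z, s) ∂D‖ ≤ C := fun z => by
    simpa using norm_integral_le_of_norm_le_const (hGC z)
  set Ψ : (Euc m × Q) × Ξ → ℝ := fun z => inner ℝ z.1.1 (G (z.1.2, z.2) - ∫ s, G (z.1.2, s) ∂D)
    with hΨ
  have hΨm : Measurable Ψ := by
    have h1 : Measurable fun z : (Euc m × Q) × Ξ => ∫ s, G (z.1.2, s) ∂D :=
      hmean.comp (measurable_snd.comp measurable_fst)
    exact (measurable_fst.comp measurable_fst).inner (hGq.sub h1)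
  have hint : Integrable (fun ω => Ψ ((a ω, q ω), ξ ω)) P := by
    refine Integrable.of_bound (hΨm.comp hjoint).aestronglyMeasurable (B * (C + C)) ?_
    filter_upwards [hae, haB] with ω h1 h2
    have hB : 0 ≤ B := (norm_nonneg _).trans h2
    refine (norm_inner_le_norm _ _).trans (mul_le_mul h2 ?_ (norm_nonneg _) hB)
    exact (norm_sub_le _ _).trans (add_le_add h1 (hmeanC _))
  refine ⟨hae, hint, ?_⟩
  have hint' : Integrable Ψ ((P.map fun ω => (a ω, q ω)).prod D) := by
    rw [← hmap]
    exact (integrable_map_measure hΨm.aestronglyMeasurable hjoint.aemeasurable).2 hint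
  calc ∫ ω, Ψ ((a ω, q ω), ξ ω) ∂P = ∫ z, Ψ z ∂(P.map fun ω => ((a ω, q ω), ξ ω)) :=
        (integral_map hjoint.aemeasurable hΨm.aestronglyMeasurable).symm
    _ = ∫ z, ∫ t, Ψ (z, t) ∂D ∂(P.map fun ω => (a ω, q ω)) := by
        rw [hmap, integral_prod _ hint']
    _ = ∫ z, (0 : ℝ) ∂(P.map fun ω => (a ω, q ω)) := by
        congr 1
        funext z
        have hGi : Integrable (fun t => G (z.2, t)) D :=
          Integrable.of_bound (hG.comp measurable_prodMk_left).aestronglyMeasurable C (hGC z.2)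
        have h1 := integral_inner (𝕜 := ℝ) (hGi.sub (integrable_const (∫ s, G (z.2, s) ∂D))) z.1
        simp only [Pi.sub_apply] at h1
        simp only [hΨ]
        rw [h1, integral_sub hGi (integrable_const _)]
        simp
    _ = 0 := by simp

/-- All components of a random state are measurable. -/
structure StateMeasurable {n p d : ℕ} {Ω : Type*} [MeasurableSpace Ω]
    (f : Ω → State n p d) : Prop where
  x : ∀ i, Measurable fun ω => (f ω).x i
  y : ∀ i, Measurable fun ω => (f ω).y i
  mx : ∀ i, Measurable fun ω => (f ω).mx i
  my : ∀ i, Measurable fun ω => (f ω).my i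

namespace StateMeasurable

variable {n p d : ℕ} {Ω : Type*} [MeasurableSpace Ω] {f : Ω → State n p d}

lemma step (hf : StateMeasurable f) {Y : Set (Euc d)} (hY : Continuous (proj Y))
    (W : Matrix (Fin n) (Fin n) ℝ) (α β γx γy : ℝ) {gx : Ω → Fin n → Euc p}
    {gy : Ω → Fin n → Euc d} (hgx : ∀ i, Measurable fun ω => gx ω i)
    (hgy : ∀ i, Measurable fun ω => gy ω i) :
    StateMeasurable fun ω => DAdaST.step W Y α β γx γy (gx ω) (gy ω) (f ω) := by
  obtain ⟨h1, h2, h3, h4⟩ := hf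
  refine ⟨fun i => ?_, fun i => ?_, fun i => ?_, fun i => ?_⟩
  · simp only [DAdaST.step]
    refine Finset.measurable_fun_sum _ fun j _ => ?_
    have := h1 j; have := h3 j; have := h4 j; have := hgx j; have := hgy j
    fun_prop
  · simp only [DAdaST.step]
    refine hY.measurable.comp (Finset.measurable_fun_sum _ fun j _ => ?_)
    have := h2 j; have := h4 j; have := hgy j
    fun_prop
  · simp only [DAdaST.step]
    refine Finset.measurable_fun_sum _ fun j _ => ?_
    have := h3 j; have := hgx j
    fun_prop
  · simp only [DAdaST.step]
    refine Finset.measurable_fun_sum _ fun j _ => ?_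
    have := h4 j; have := hgy j
    fun_prop

lemma nodeMean_x (hf : StateMeasurable f) : Measurable fun ω => nodeMean (f ω).x := by
  simp only [nodeMean]
  have := hf.x
  fun_prop

lemma offsetX (hf : StateMeasurable f) (S : ℝ) : Measurable fun ω => offsetX S (f ω) := by
  have h1 := hf.mx
  have h2 := hf.my
  simp only [DAdaST.offsetX, avg]
  fun_prop

lemma offsetY (hf : StateMeasurable f) (S : ℝ) : Measurable fun ω => offsetY S (f ω) := by
  have h2 := hf.my
  simp only [DAdaST.offsetY, avg]
  fun_prop

lemma etaC (hf : StateMeasurable f) (α γx S : ℝ) : Measurable fun ω => etaC α γx S (f ω) := by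
  have := hf.offsetX S
  simp only [DAdaST.etaC]
  fun_prop

lemma thetaC (hf : StateMeasurable f) (β γy S : ℝ) :
    Measurable fun ω => thetaC β γy S (f ω) := by
  have := hf.offsetY S
  simp only [DAdaST.thetaC]
  fun_prop

end StateMeasurable

lemma measurable_tracker {n p d : ℕ} {Ω : Type*} [MeasurableSpace Ω] {s : ℕ → Ω → State n p d}
    (β γy μ S : ℝ) (k : ℕ) (hs : ∀ j ≤ k, StateMeasurable (s j)) :
    Measurable fun ω => tracker β γy μ S (fun j => s j ω) k := by
  induction k with
  | zero => exact (hs 0 le_rfl).nodeMean_x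
  | succ k ih =>
    have h1 := ih fun j hj => hs j (hj.trans (Nat.le_succ k))
    have h2 := (hs k (Nat.le_succ k)).thetaC β γy S
    have h3 := (hs k (Nat.le_succ k)).nodeMean_x
    simp only [tracker]
    fun_prop

namespace Trajectory

variable {n p d : ℕ} {Ξ : Type*} [MeasurableSpace Ξ] {A : Problem n p d Ξ}
  {W : Matrix (Fin n) (Fin n) ℝ} {α β γx γy c μ L C : ℝ} {s : ℕ → State n p d}
  {gx : ℕ → Fin n → Euc p} {gy : ℕ → Fin n → Euc d} {ε S : ℝ}

/-- A crude bound on the tracking error, used for integrability only. -/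
lemma norm_sub_tracker_le (T : Trajectory A W α β γx γy c μ L C s gx gy)
    (O : Offset n (rho W) α β γx γy μ C ε S) (k : ℕ) :
    ‖nodeMean (s k).x - tracker β γy μ S s k‖ ≤ k * (γx / c ^ α * C) := by
  have hγ := T.γx_pos
  have hc := T.c_pos
  have hC := T.regular.C_pos
  have hn : (0 : ℝ) < n := by exact_mod_cast T.regular.node_pos
  have hα0 : 0 ≤ α := by linarith [T.β_pos, T.β_lt_α]
  induction k with
  | zero => simp [tracker]
  | succ k ih =>
    have hθ := T.mu_mul_thetaC_le O k
    have hθ0 := mul_pos T.regular.mu_pos (T.thetaC_pos O k)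
    have e1 : nodeMean (s (k + 1)).x - tracker β γy μ S s (k + 1)
        = (1 - μ * thetaC β γy S (s k)) • (nodeMean (s k).x - tracker β γy μ S s k)
          - (etaC α γx S (s k) • nodeMean (gx k) + xErr α γx S (s k) (gx k) (gy k)) := by
      rw [T.nodeMean_x_succ (S := S) k, tracker, sub_smul, one_smul]
      abel
    rw [e1, eta_smul_add_xErr]
    refine (norm_sub_le _ _).trans ?_
    have h1 : ‖(1 - μ * thetaC β γy S (s k)) • (nodeMean (s k).x - tracker β γy μ S s k)‖
        ≤ k * (γx / c ^ α * C) := by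
      rw [norm_smul, Real.norm_of_nonneg (by linarith)]
      exact (mul_le_of_le_one_left (norm_nonneg _) (by linarith)).trans ih
    have h2 : ‖nodeMean fun j => (γx / max ((s k).mx j + ‖gx k j‖ ^ 2)
        ((s k).my j + ‖gy k j‖ ^ 2) ^ α) • gx k j‖ ≤ γx / c ^ α * C := by
      rw [nodeMean, norm_smul, Real.norm_of_nonneg (by positivity), one_div, ← div_eq_inv_mul,
        div_le_iff₀ hn]
      refine (norm_sum_le _ _).trans ?_
      have h3 : ∀ j, ‖(γx / max ((s k).mx j + ‖gx k j‖ ^ 2)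
          ((s k).my j + ‖gy k j‖ ^ 2) ^ α) • gx k j‖ ≤ γx / c ^ α * C := fun j => by
        have hcm : c ≤ (s k).mx j + ‖gx k j‖ ^ 2 := by
          have := T.accX.c_le k j
          have : 0 ≤ ‖gx k j‖ ^ 2 := by positivity
          linarith
        have hcv := hcm.trans (le_max_left _ ((s k).my j + ‖gy k j‖ ^ 2))
        have hv := hc.trans_le hcv
        rw [norm_smul, Real.norm_of_nonneg (by positivity)]
        have := T.norm_gx_le k j
        gcongr
      refine (Finset.sum_le_sum fun j _ => h3 j).trans_eq ?_
      simp [mul_comm]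
    push_cast
    linarith

end Trajectory

namespace StateMeasurable

variable {n p d : ℕ} {Ξ Ω : Type*} [MeasurableSpace Ξ] [MeasurableSpace Ω]
  {f : Ω → State n p d} {A : Problem n p d Ξ}

lemma pair (hf : StateMeasurable f) (i : Fin n) {Y : Set (Euc d)} (hY : ∀ ω, (f ω).y i ∈ Y) :
    Measurable fun ω => ((f ω).x i, (⟨(f ω).y i, hY ω⟩ : Y)) :=
  (hf.x i).prodMk ((hf.y i).subtype_mk (h := hY))

lemma sgradX (hf : StateMeasurable f) (hA : A.WellPosed) (i : Fin n)
    (hY : ∀ ω, (f ω).y i ∈ A.Y) {ξ : Ω → Ξ} (hξ : Measurable ξ) :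
    Measurable fun ω => A.sgradX i ((f ω).x i) ((f ω).y i) (ξ ω) :=
  (hA.measurableX i).comp ((hf.x i).prodMk (((hf.y i).subtype_mk (h := hY)).prodMk hξ))

lemma sgradY (hf : StateMeasurable f) (hA : A.WellPosed) (i : Fin n)
    (hY : ∀ ω, (f ω).y i ∈ A.Y) {ξ : Ω → Ξ} (hξ : Measurable ξ) :
    Measurable fun ω => A.sgradY i ((f ω).x i) ((f ω).y i) (ξ ω) :=
  (hA.measurableY i).comp ((hf.x i).prodMk (((hf.y i).subtype_mk (h := hY)).prodMk hξ))

/-- The vector paired with the gradient noise in `descentNoise` is measurable. -/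
lemma descentNoise_coeff (hf : StateMeasurable f) (hA : Continuous (gradient A.Phi)) (r : ℝ) :
    Measurable fun ω => r • gradient A.Phi (DAdaST.nodeMean (f ω).x) :=
  (hA.measurable.comp hf.nodeMean_x).const_smul r

/-- The vector paired with the gradient noise in `trackerNoise` is measurable. -/
lemma trackerNoise_coeff (hf : StateMeasurable f) {w : Ω → Euc p} (hw : Measurable w)
    (α β γx γy μ S r : ℝ) :
    Measurable fun ω => r • ((2 * (1 - μ * DAdaST.thetaC β γy S (f ω))
      * (DAdaST.etaC α γx S (f ω) / DAdaST.thetaC β γy S (f ω)))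
      • (DAdaST.nodeMean (f ω).x - w ω)) := by
  have h1 := hf.nodeMean_x
  have h2 := hf.thetaC β γy S
  have h3 := hf.etaC α γx S
  fun_prop

/-- The vector paired with the gradient noise in `dualNoise` is measurable. -/
lemma dualNoise_coeff (hf : StateMeasurable f) {w : Ω → Euc p} (hw : Measurable w)
    (hy : Continuous A.yStar) (i : Fin n) (hY : ∀ ω, (f ω).y i ∈ A.Y)
    (hG : Continuous fun z : Euc p × A.Y => gradY (A.localObj i) z.1 z.2) (β γy μ S b : ℝ) :
    Measurable fun ω => (2 * (1 + μ * DAdaST.thetaC β γy S (f ω) / 4)) •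
      ((f ω).y i - A.yStar (w ω) - (1 / (b * DAdaST.offsetY S (f ω) ^ β)) •
        gradY (A.localObj i) ((f ω).x i) ((f ω).y i)) := by
  have h1 := hf.thetaC β γy S
  have h2 := hf.offsetY S
  have h3 : Measurable fun ω => A.yStar (w ω) := hy.measurable.comp hw
  have h4 : Measurable fun ω => gradY (A.localObj i) ((f ω).x i) ((f ω).y i) :=
    hG.measurable.comp (hf.pair i hY)
  have h5 := hf.y i
  fun_prop

end StateMeasurable

namespace Instance

variable {n p d : ℕ} {Ξ Ω : Type*} [MeasurableSpace Ξ] [mΩ : MeasurableSpace Ω]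

/-- All the samples, indexed as in the independence assumption. -/
def sample (I : Instance n p d Ξ Ω) : (ℕ × Fin n) ⊕ (ℕ × Fin n) → Ω → Ξ :=
  Sum.elim (fun q => I.ξx q.1 q.2) fun q => I.ξy q.1 q.2

/-- The iteration at which a sample is drawn. -/
def iterOf {n : ℕ} : (ℕ × Fin n) ⊕ (ℕ × Fin n) → ℕ := Sum.elim Prod.fst Prod.fst

/-- The σ-algebra generated by the samples drawn before iteration `k`. -/
@[reducible]
def past (I : Instance n p d Ξ Ω) (k : ℕ) : MeasurableSpace Ω :=
  ⨆ q ∈ {q | iterOf q < k}, MeasurableSpace.comap (I.sample q) inferInstance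

lemma measurable_sample (I : Instance n p d Ξ Ω) {k : ℕ} {q : (ℕ × Fin n) ⊕ (ℕ × Fin n)}
    (hq : iterOf q < k) : Measurable[I.past k] (I.sample q) :=
  measurable_iff_comap_le.2 (le_biSup (fun q => MeasurableSpace.comap (I.sample q) _) hq)

/-- The stochastic gradients of the run. -/
noncomputable def gx (I : Instance n p d Ξ Ω) (α β γx γy c : ℝ) (ω : Ω) (k : ℕ) (i : Fin n) :
    Euc p :=
  I.sgradX i ((I.run α β γx γy c ω k).x i) ((I.run α β γx γy c ω k).y i) (I.ξx k i ω)

/-- The stochastic dual gradients of the run. -/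
noncomputable def gy (I : Instance n p d Ξ Ω) (α β γx γy c : ℝ) (ω : Ω) (k : ℕ) (i : Fin n) :
    Euc d :=
  I.sgradY i ((I.run α β γx γy c ω k).x i) ((I.run α β γx γy c ω k).y i) (I.ξy k i ω)

namespace Admissible

variable {I : Instance n p d Ξ Ω} {μ L C M R : ℝ} {α β γx γy c : ℝ}

lemma regular (hI : I.Admissible μ L C M R) (hn : 0 < n) (hμ : 0 < μ) (hL : 0 < L) (hC : 0 < C) :
    I.toProblem.Regular μ L C where
  wellPosed := hI.wellPosed
  stronglyConcave := hI.stronglyConcave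
  smooth := hI.smooth
  stochasticGradient := hI.stochasticGradient
  nonempty := ⟨_, hI.y0_mem ⟨0, hn⟩⟩
  node_pos := hn
  mu_pos := hμ
  L_pos := hL
  C_pos := hC

lemma measurable_sample (hI : I.Admissible μ L C M R) (q : (ℕ × Fin n) ⊕ (ℕ × Fin n)) :
    Measurable (I.sample q) := by
  rcases q with q | q
  · exact hI.measurable_ξx q.1 q.2
  · exact hI.measurable_ξy q.1 q.2

lemma past_le (hI : I.Admissible μ L C M R) (k : ℕ) : I.past k ≤ mΩ :=
  iSup₂_le fun q _ => (hI.measurable_sample q).comap_le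

lemma indep_past (hI : I.Admissible μ L C M R) {k : ℕ} {q : (ℕ × Fin n) ⊕ (ℕ × Fin n)}
    (hq : k ≤ iterOf q) :
    Indep (I.past k) (MeasurableSpace.comap (I.sample q) inferInstance) I.P := by
  have h := indep_iSup_of_disjoint (fun q => (hI.measurable_sample q).comap_le) hI.indep
    (S := {q | iterOf q < k}) (T := {q}) (by simpa using hq)
  rw [iSup_singleton] at h
  exact h

lemma nonempty_Y (hI : I.Admissible μ L C M R) (hn : 0 < n) : I.Y.Nonempty :=
  ⟨_, hI.y0_mem ⟨0, hn⟩⟩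

lemma run_y_mem (hI : I.Admissible μ L C M R) (α β γx γy c : ℝ) (ω : Ω) (k : ℕ) (i : Fin n) :
    (I.run α β γx γy c ω k).y i ∈ I.Y := by
  cases k with
  | zero => exact hI.y0_mem i
  | succ k =>
    exact (proj_spec hI.wellPosed.isClosed (hI.nonempty_Y (Fin.pos i)) _).1

/-- The state at iteration `k` depends on the past samples only. -/
lemma stateMeasurable_run (hI : I.Admissible μ L C M R) (hn : 0 < n) (α β γx γy c : ℝ) (k : ℕ) :
    ∀ l, k ≤ l → @StateMeasurable n p d Ω (I.past l) fun ω => I.run α β γx γy c ω k := by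
  induction k with
  | zero =>
    intro l _
    exact @StateMeasurable.mk n p d Ω (I.past l) _ (fun _ => measurable_const)
      (fun _ => measurable_const) (fun _ => measurable_const) (fun _ => measurable_const)
  | succ k ih =>
    intro l hl
    have hs := ih l ((Nat.le_succ k).trans hl)
    refine @StateMeasurable.step n p d Ω (I.past l) _ hs I.Y
      (continuous_proj hI.wellPosed.isClosed hI.wellPosed.convex (hI.nonempty_Y hn)) I.W α β γx γy
      (fun ω i => I.gx α β γx γy c ω k i) (fun ω i => I.gy α β γx γy c ω k i) ?_ ?_
    · exact fun i => @StateMeasurable.sgradX n p d Ξ Ω _ (I.past l) _ _ hs hI.wellPosed i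
        (fun ω => hI.run_y_mem α β γx γy c ω k i) _ (I.measurable_sample (q := Sum.inl (k, i)) hl)
    · exact fun i => @StateMeasurable.sgradY n p d Ξ Ω _ (I.past l) _ _ hs hI.wellPosed i
        (fun ω => hI.run_y_mem α β γx γy c ω k i) _ (I.measurable_sample (q := Sum.inr (k, i)) hl)

/-- The noise of one primal stochastic gradient. -/
lemma noise_x (hI : I.Admissible μ L C M R) (hn : 0 < n) (k : ℕ) (i : Fin n) {a : Ω → Euc p}
    (ha : Measurable[I.past k] a) {B : ℝ} (haB : ∀ᵐ ω ∂I.P, ‖a ω‖ ≤ B) :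
    (∀ᵐ ω ∂I.P, ‖I.gx α β γx γy c ω k i‖ ≤ C) ∧
    Integrable (fun ω => inner ℝ (a ω) (I.gx α β γx γy c ω k i - gradX (I.localObj i)
      ((I.run α β γx γy c ω k).x i) ((I.run α β γx γy c ω k).y i))) I.P ∧
    ∫ ω, inner ℝ (a ω) (I.gx α β γx γy c ω k i - gradX (I.localObj i)
      ((I.run α β γx γy c ω k).x i) ((I.run α β γx γy c ω k).y i)) ∂I.P = 0 := by
  have := hI.prob
  have := hI.wellPosed.prob i
  have hs := hI.stateMeasurable_run hn α β γx γy c k k le_rfl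
  have hy := fun ω => hI.run_y_mem α β γx γy c ω k i
  have hG : Measurable fun z : (Euc p × I.Y) × Ξ => I.sgradX i z.1.1 z.1.2 z.2 :=
    (hI.wellPosed.measurableX i).comp (by fun_prop : Measurable fun z : (Euc p × I.Y) × Ξ =>
      (z.1.1, z.1.2, z.2))
  have h := integral_inner_noise (hI.past_le k) (hI.measurable_ξx k i) (hI.law_ξx k i)
    (hI.indep_past (q := Sum.inl (k, i)) le_rfl)
    (q := fun ω => ((I.run α β γx γy c ω k).x i, (⟨_, hy ω⟩ : I.Y)))
    (@StateMeasurable.pair n p d Ω (I.past k) _ hs i _ hy) ha hG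
    (fun z => hI.stochasticGradient.boundX i z.1 z.2 z.2.2) haB
  have e : ∀ ω, ∫ t, I.sgradX i ((I.run α β γx γy c ω k).x i) ((I.run α β γx γy c ω k).y i) t
      ∂(I.dist i) = gradX (I.localObj i)
      ((I.run α β γx γy c ω k).x i) ((I.run α β γx γy c ω k).y i) := fun ω =>
    hI.stochasticGradient.unbiasedX i _ _ (hy ω)
  simp only [e] at h
  exact h

/-- The noise of one dual stochastic gradient. -/
lemma noise_y (hI : I.Admissible μ L C M R) (hn : 0 < n) (k : ℕ) (i : Fin n) {a : Ω → Euc d}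
    (ha : Measurable[I.past k] a) {B : ℝ} (haB : ∀ᵐ ω ∂I.P, ‖a ω‖ ≤ B) :
    (∀ᵐ ω ∂I.P, ‖I.gy α β γx γy c ω k i‖ ≤ C) ∧
    Integrable (fun ω => inner ℝ (a ω) (I.gy α β γx γy c ω k i - gradY (I.localObj i)
      ((I.run α β γx γy c ω k).x i) ((I.run α β γx γy c ω k).y i))) I.P ∧
    ∫ ω, inner ℝ (a ω) (I.gy α β γx γy c ω k i - gradY (I.localObj i)
      ((I.run α β γx γy c ω k).x i) ((I.run α β γx γy c ω k).y i)) ∂I.P = 0 := by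
  have := hI.prob
  have := hI.wellPosed.prob i
  have hs := hI.stateMeasurable_run hn α β γx γy c k k le_rfl
  have hy := fun ω => hI.run_y_mem α β γx γy c ω k i
  have hG : Measurable fun z : (Euc p × I.Y) × Ξ => I.sgradY i z.1.1 z.1.2 z.2 :=
    (hI.wellPosed.measurableY i).comp (by fun_prop : Measurable fun z : (Euc p × I.Y) × Ξ =>
      (z.1.1, z.1.2, z.2))
  have h := integral_inner_noise (hI.past_le k) (hI.measurable_ξy k i) (hI.law_ξy k i)
    (hI.indep_past (q := Sum.inr (k, i)) le_rfl)
    (q := fun ω => ((I.run α β γx γy c ω k).x i, (⟨_, hy ω⟩ : I.Y)))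
    (@StateMeasurable.pair n p d Ω (I.past k) _ hs i _ hy) ha hG
    (fun z => hI.stochasticGradient.boundY i z.1 z.2 z.2.2) haB
  have e : ∀ ω, ∫ t, I.sgradY i ((I.run α β γx γy c ω k).x i) ((I.run α β γx γy c ω k).y i) t
      ∂(I.dist i) = gradY (I.localObj i)
      ((I.run α β γx γy c ω k).x i) ((I.run α β γx γy c ω k).y i) := fun ω =>
    hI.stochasticGradient.unbiasedY i _ _ (hy ω)
  simp only [e] at h
  exact h

/-- Almost every run is a trajectory with bounded gradients. -/
lemma ae_trajectory (hI : I.Admissible μ L C M R) (hn : 0 < n) (hμ : 0 < μ) (hL : 0 < L)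
    (hC : 0 < C) (hβ : 0 < β) (hβα : β < α) (hα : α < 1) (hγx : 0 < γx) (hγy : 0 < γy)
    (hc : 0 < c) :
    ∀ᵐ ω ∂I.P, Trajectory I.toProblem I.W α β γx γy c μ L C (I.run α β γx γy c ω)
      (I.gx α β γx γy c ω) (I.gy α β γx γy c ω) := by
  have h1 : ∀ᵐ ω ∂I.P, ∀ k i, ‖I.gx α β γx γy c ω k i‖ ≤ C :=
    ae_all_iff.2 fun k => ae_all_iff.2 fun i =>
      (hI.noise_x hn k i (a := fun _ => 0) measurable_const (B := 0) (by simp)).1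
  have h2 : ∀ᵐ ω ∂I.P, ∀ k i, ‖I.gy α β γx γy c ω k i‖ ≤ C :=
    ae_all_iff.2 fun k => ae_all_iff.2 fun i =>
      (hI.noise_y hn k i (a := fun _ => 0) measurable_const (B := 0) (by simp)).1
  filter_upwards [h1, h2] with ω hx hy
  exact
    { regular := hI.regular hn hμ hL hC
      doublyStochastic := hI.doublyStochastic
      rho_lt_one := hI.rho_lt_one
      β_pos := hβ
      β_lt_α := hβα
      α_lt_one := hα
      γx_pos := hγx
      γy_pos := hγy
      c_pos := hc
      step_eq := fun k => rfl
      mx_zero := fun i => rfl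
      my_zero := fun i => rfl
      y_mem := fun k i => hI.run_y_mem α β γx γy c ω k i
      norm_gx_le := hx
      norm_gy_le := hy }

/-- `‖∇Φ(x̄_k)‖²` is bounded and measurable. -/
lemma integrable_norm_gradient_Phi_sq (hI : I.Admissible μ L C M R) (hn : 0 < n) (hμ : 0 < μ)
    (hL : 0 < L) (hC : 0 < C) (α β γx γy c : ℝ) (k : ℕ) :
    Integrable (fun ω => ‖gradient I.Phi (I.xbar α β γx γy c k ω)‖ ^ 2) I.P := by
  have := hI.prob
  have hA := hI.regular hn hμ hL hC
  have hs := hI.stateMeasurable_run hn α β γx γy c k k le_rfl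
  have hx : Measurable fun ω => I.xbar α β γx γy c k ω :=
    (@StateMeasurable.nodeMean_x n p d Ω (I.past k) _ hs).mono (hI.past_le k) le_rfl
  refine Integrable.of_bound ((hA.continuous_gradient_Phi.measurable.comp hx).norm.pow_const
    2).aestronglyMeasurable (C ^ 2) (Filter.Eventually.of_forall fun ω => ?_)
  rw [norm_pow, norm_norm]
  exact pow_le_pow_left₀ (norm_nonneg _) (hA.norm_gradient_Phi_le _) 2

section Noise

variable {S ε : ℝ}

lemma measurable_tracker_run (hI : I.Admissible μ L C M R) (hn : 0 < n) (k : ℕ) :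
    Measurable[I.past k] fun ω => tracker β γy μ S (I.run α β γx γy c ω) k :=
  @measurable_tracker n p d Ω (I.past k) (fun j ω => I.run α β γx γy c ω j) β γy μ S k
    fun j hj => hI.stateMeasurable_run hn α β γx γy c j k hj

lemma inner_nodeMean_sub (v : Euc p) (g G : Fin n → Euc p) :
    inner ℝ v (nodeMean g - nodeMean G) = ∑ i, inner ℝ ((1 / (n : ℝ)) • v) (g i - G i) := by
  rw [← nodeMean_sub, nodeMean, real_inner_smul_right, inner_sum, Finset.mul_sum]
  simp only [real_inner_smul_left]

lemma integral_descentNoise (hI : I.Admissible μ L C M R) (hn : 0 < n) (hμ : 0 < μ)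
    (hL : 0 < L) (hC : 0 < C) (k : ℕ) :
    Integrable (fun ω => descentNoise I.toProblem (I.run α β γx γy c ω k)
      (I.gx α β γx γy c ω k)) I.P ∧
    ∫ ω, descentNoise I.toProblem (I.run α β γx γy c ω k) (I.gx α β γx γy c ω k) ∂I.P = 0 := by
  have hA := hI.regular hn hμ hL hC
  have hs := hI.stateMeasurable_run hn α β γx γy c k k le_rfl
  have ha : Measurable[I.past k] fun ω =>
      (1 / (n : ℝ)) • gradient I.Phi (nodeMean (I.run α β γx γy c ω k).x) :=
    @StateMeasurable.descentNoise_coeff n p d Ξ Ω _ (I.past k) _ I.toProblem hs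
      hA.continuous_gradient_Phi _
  have h := fun i => (hI.noise_x (α := α) (β := β) (γx := γx) (γy := γy) (c := c) hn k i ha
    (B := 1 / (n : ℝ) * C) (Filter.Eventually.of_forall fun ω => by
      rw [norm_smul, Real.norm_of_nonneg (by positivity)]
      exact mul_le_mul_of_nonneg_left (hA.norm_gradient_Phi_le _) (by positivity))).2
  simp only [descentNoise, inner_nodeMean_sub]
  refine ⟨integrable_finsetSum _ fun i _ => (h i).1, ?_⟩
  rw [integral_finsetSum _ fun i _ => (h i).1]
  exact Finset.sum_eq_zero fun i _ => (h i).2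

lemma integral_trackerNoise (hI : I.Admissible μ L C M R) (hn : 0 < n) (hμ : 0 < μ)
    (hL : 0 < L) (hC : 0 < C) (hβ : 0 < β) (hβα : β < α) (hα : α < 1) (hγx : 0 < γx)
    (hγy : 0 < γy) (hc : 0 < c) (O : Offset n (rho I.W) α β γx γy μ C ε S) (k : ℕ) :
    Integrable (fun ω => trackerNoise I.toProblem α β γx γy μ S
      (tracker β γy μ S (I.run α β γx γy c ω) k) (I.run α β γx γy c ω k)
      (I.gx α β γx γy c ω k)) I.P ∧
    ∫ ω, trackerNoise I.toProblem α β γx γy μ S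
      (tracker β γy μ S (I.run α β γx γy c ω) k) (I.run α β γx γy c ω k)
      (I.gx α β γx γy c ω k) ∂I.P = 0 := by
  have hs := hI.stateMeasurable_run hn α β γx γy c k k le_rfl
  have hT := hI.ae_trajectory hn hμ hL hC hβ hβα hα hγx hγy hc
  have ha : Measurable[I.past k] fun ω => (1 / (n : ℝ)) •
      ((2 * (1 - μ * thetaC β γy S (I.run α β γx γy c ω k))
        * (etaC α γx S (I.run α β γx γy c ω k) / thetaC β γy S (I.run α β γx γy c ω k)))
      • (nodeMean (I.run α β γx γy c ω k).x - tracker β γy μ S (I.run α β γx γy c ω) k)) :=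
    @StateMeasurable.trackerNoise_coeff n p d Ω (I.past k) _ hs _
      (hI.measurable_tracker_run hn k) _ _ _ _ _ _ _
  have h := fun i => (hI.noise_x (α := α) (β := β) (γx := γx) (γy := γy) (c := c) hn k i ha
    (B := 1 / (n : ℝ) * (2 * ε * (k * (γx / c ^ α * C)))) (by
      filter_upwards [hT] with ω T
      have hθ := T.mu_mul_thetaC_le O k
      have hθ0 := mul_pos hμ (T.thetaC_pos O k)
      have hq := T.etaC_div_thetaC_le O k
      have hq0 := (div_pos (T.etaC_pos O k) (T.thetaC_pos O k)).le
      have hr := T.norm_sub_tracker_le O k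
      rw [norm_smul, Real.norm_of_nonneg (by positivity), norm_smul, Real.norm_of_nonneg
        (mul_nonneg (mul_nonneg two_pos.le (by linarith)) hq0)]
      refine mul_le_mul_of_nonneg_left (mul_le_mul ?_ hr (norm_nonneg _) ?_) (by positivity)
      · exact mul_le_mul (by linarith) hq hq0 two_pos.le
      · exact mul_nonneg two_pos.le (hq0.trans hq))).2
  have e : ∀ ω, trackerNoise I.toProblem α β γx γy μ S
      (tracker β γy μ S (I.run α β γx γy c ω) k) (I.run α β γx γy c ω k)
      (I.gx α β γx γy c ω k) = _ := fun ω => by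
    rw [trackerNoise, ← real_inner_smul_left, inner_nodeMean_sub]
  simp only [e]
  refine ⟨integrable_finsetSum _ fun i _ => (h i).1, ?_⟩
  rw [integral_finsetSum _ fun i _ => (h i).1]
  exact Finset.sum_eq_zero fun i _ => (h i).2

lemma integral_dualNoise (hI : I.Admissible μ L C M R) (hn : 0 < n) (hμ : 0 < μ)
    (hL : 0 < L) (hC : 0 < C) (hβ : 0 < β) (hβα : β < α) (hα : α < 1) (hγx : 0 < γx)
    (hγy : 0 < γy) (hc : 0 < c) (O : Offset n (rho I.W) α β γx γy μ C ε S) (k : ℕ) :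
    Integrable (fun ω => dualNoise I.toProblem β γy μ S (1 - rho I.W)
      (tracker β γy μ S (I.run α β γx γy c ω) k) (I.run α β γx γy c ω k)
      (I.gy α β γx γy c ω k)) I.P ∧
    ∫ ω, dualNoise I.toProblem β γy μ S (1 - rho I.W)
      (tracker β γy μ S (I.run α β γx γy c ω) k) (I.run α β γx γy c ω k)
      (I.gy α β γx γy c ω k) ∂I.P = 0 := by
  have hA := hI.regular hn hμ hL hC
  have hρ : 0 < 1 - rho I.W := by linarith [hI.rho_lt_one]
  have hs := hI.stateMeasurable_run hn α β γx γy c k k le_rfl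
  have hT := hI.ae_trajectory hn hμ hL hC hβ hβα hα hγx hγy hc
  have ha : ∀ i, Measurable[I.past k] fun ω =>
      (2 * (1 + μ * thetaC β γy S (I.run α β γx γy c ω k) / 4)) •
      ((I.run α β γx γy c ω k).y i - I.yStar (tracker β γy μ S (I.run α β γx γy c ω) k)
        - (1 / ((1 - rho I.W) * offsetY S (I.run α β γx γy c ω k) ^ β)) •
          gradY (I.localObj i) ((I.run α β γx γy c ω k).x i) ((I.run α β γx γy c ω k).y i)) :=
    fun i => @StateMeasurable.dualNoise_coeff n p d Ξ Ω _ (I.past k) _ I.toProblem hs _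
      (hI.measurable_tracker_run hn k) hA.continuous_yStar i
      (fun ω => hI.run_y_mem α β γx γy c ω k i) (hA.continuous_gradY_localObj i) _ _ _ _ _
  have h := fun i => (hI.noise_y (α := α) (β := β) (γx := γx) (γy := γy) (c := c) hn k i (ha i)
    (B := 4 * (2 * C / μ + 1 / (1 - rho I.W) * C)) (by
      filter_upwards [hT] with ω T
      have hθ := T.mu_mul_thetaC_le O k
      have hθ0 := mul_pos hμ (T.thetaC_pos O k)
      have hV : 1 ≤ offsetY S (I.run α β γx γy c ω k) ^ β :=
        Real.one_le_rpow (O.one_le.trans (T.S_le_offsetY k)) hβ.le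
      rw [norm_smul, Real.norm_of_nonneg (by linarith)]
      refine mul_le_mul (by linarith) ((norm_sub_le _ _).trans (add_le_add
        (hA.norm_sub_le_of_mem (T.y_mem k i) (hA.yStar_mem _)) ?_)) (norm_nonneg _) (by norm_num)
      rw [norm_smul, Real.norm_of_nonneg (by positivity)]
      refine mul_le_mul ?_ (hA.norm_gradY_le i _ (T.y_mem k i)) (norm_nonneg _) (by positivity)
      refine one_div_le_one_div_of_le hρ ?_
      exact le_mul_of_one_le_right hρ.le hV)).2
  have e : ∀ ω, dualNoise I.toProblem β γy μ S (1 - rho I.W)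
      (tracker β γy μ S (I.run α β γx γy c ω) k) (I.run α β γx γy c ω k)
      (I.gy α β γx γy c ω k) = ∑ i, inner ℝ
        ((2 * (1 + μ * thetaC β γy S (I.run α β γx γy c ω k) / 4)) •
          ((I.run α β γx γy c ω k).y i - I.yStar (tracker β γy μ S (I.run α β γx γy c ω) k)
            - (1 / ((1 - rho I.W) * offsetY S (I.run α β γx γy c ω k) ^ β)) •
              gradY (I.localObj i) ((I.run α β γx γy c ω k).x i) ((I.run α β γx γy c ω k).y i)))
        (I.gy α β γx γy c ω k i - gradY (I.localObj i) ((I.run α β γx γy c ω k).x i)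
          ((I.run α β γx γy c ω k).y i)) := fun ω => by
    rw [dualNoise, Finset.mul_sum]
    exact Finset.sum_congr rfl fun i _ => (real_inner_smul_left _ _ _).symm
  simp only [e]
  refine ⟨integrable_finsetSum _ fun i _ => (h i).1, ?_⟩
  rw [integral_finsetSum _ fun i _ => (h i).1]
  exact Finset.sum_eq_zero fun i _ => (h i).2

end Noise

end Admissible

end Instance

/-- The expectation of the pathwise bound, in which the noise has disappeared. -/
lemma exists_expectation_bound (n : ℕ) (hn : 0 < n) (γx γy c μ L C M R : ℝ) (hγx : 0 < γx)
    (hγy : 0 < γy) (hc : 0 < c) (hμ : 0 < μ) (hL : 0 < L) (hC : 0 < C) :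
    ∃ ε > 0, ∃ cX ≥ 0, ∃ cA ≥ 0, ∃ cB ≥ 0, ∃ cC ≥ 0,
      ∀ (p d : ℕ) (Ξ Ω : Type*) [MeasurableSpace Ξ] [MeasurableSpace Ω]
        (I : Instance n p d Ξ Ω) (α β S : ℝ), I.Admissible μ L C M R →
        0 < β → β < α → α < 1 → Offset n (rho I.W) α β γx γy μ C ε S → ∀ K : ℕ,
        ∑ k ∈ Finset.range K, ∫ ω, ‖gradient I.Phi (I.xbar α β γx γy c k ω)‖ ^ 2 ∂I.P
          ≤ cX * spreadBoundX n γx c C R α (rho I.W) K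
            + cA * descentBound n γx c μ L C M α S K
            + cB * dualBound n γx γy c μ L C R α β (rho I.W) S K
            + cC * ((4 / μ * ε ^ 2 + ε * γx) * stepBound n c C α S K) := by
  obtain ⟨ε, hε, cX, hcX, cA, hcA, cB, hcB, cC, hcC, h⟩ :=
    exists_pathwise_bound n hn γx μ L hμ hL
  refine ⟨ε, hε, cX, hcX, cA, hcA, cB, hcB, cC, hcC, ?_⟩
  intro p d Ξ Ω _ _ I α β S hI hβ hβα hα O K
  have := hI.prob
  have hT := hI.ae_trajectory (γx := γx) (γy := γy) (c := c) hn hμ hL hC hβ hβα hα hγx hγy hc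
  have hN1 := fun k => hI.integral_descentNoise (α := α) (β := β) (γx := γx) (γy := γy) (c := c)
    hn hμ hL hC k
  have hN2 := fun k => hI.integral_dualNoise (γx := γx) (γy := γy) (c := c)
    hn hμ hL hC hβ hβα hα hγx hγy hc O k
  have hN3 := fun k => hI.integral_trackerNoise (γx := γx) (γy := γy) (c := c)
    hn hμ hL hC hβ hβα hα hγx hγy hc O k
  have hG := fun k => hI.integrable_norm_gradient_Phi_sq hn hμ hL hC α β γx γy c k
  have i1 := integrable_finsetSum (Finset.range K) fun k _ => (hN1 k).1
  have i2 := integrable_finsetSum (Finset.range K) fun k _ => (hN2 k).1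
  have i3 := integrable_finsetSum (Finset.range K) fun k _ => (hN3 k).1
  have z1 := integral_finsetSum (Finset.range K) fun k _ => (hN1 k).1
  have z2 := integral_finsetSum (Finset.range K) fun k _ => (hN2 k).1
  have z3 := integral_finsetSum (Finset.range K) fun k _ => (hN3 k).1
  rw [Finset.sum_eq_zero fun k _ => (hN1 k).2] at z1
  rw [Finset.sum_eq_zero fun k _ => (hN2 k).2] at z2
  rw [Finset.sum_eq_zero fun k _ => (hN3 k).2] at z3
  rw [← integral_finsetSum _ fun k _ => hG k]
  set bX := cX * spreadBoundX n γx c C R α (rho I.W) K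
  set bA := descentBound n γx c μ L C M α S K
  set bB := dualBound n γx γy c μ L C R α β (rho I.W) S K
  set bC := (4 / μ * ε ^ 2 + ε * γx) * stepBound n c C α S K
  have j1 := ((integrable_const (μ := I.P) bA).sub i1).const_mul cA
  have j2 := ((integrable_const (μ := I.P) bB).add i2).const_mul cB
  have j3 := ((integrable_const (μ := I.P) bC).sub i3).const_mul cC
  have j0 := integrable_const (μ := I.P) bX
  have e1 := integral_sub (integrable_const (μ := I.P) bA) i1
  have e2 := integral_add (integrable_const (μ := I.P) bB) i2
  have e3 := integral_sub (integrable_const (μ := I.P) bC) i3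
  simp only [z1, z2, z3, integral_const, probReal_univ, one_smul, sub_zero, add_zero] at e1 e2 e3
  calc _ ≤ ∫ ω, (bX + cA * (bA - ∑ k ∈ Finset.range K, descentNoise I.toProblem
              (I.run α β γx γy c ω k) (I.gx α β γx γy c ω k))
            + cB * (bB + ∑ k ∈ Finset.range K, dualNoise I.toProblem β γy μ S (1 - rho I.W)
              (tracker β γy μ S (I.run α β γx γy c ω) k) (I.run α β γx γy c ω k)
              (I.gy α β γx γy c ω k))
            + cC * (bC - ∑ k ∈ Finset.range K, trackerNoise I.toProblem α β γx γy μ S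
              (tracker β γy μ S (I.run α β γx γy c ω) k) (I.run α β γx γy c ω k)
              (I.gx α β γx γy c ω k))) ∂I.P := by
        refine integral_mono_ae (integrable_finsetSum _ fun k _ => hG k)
          (((j0.add j1).add j2).add j3) ?_
        filter_upwards [hT] with ω T
        exact h p d Ξ I.toProblem I.W α β γy c C S M R _ _ _ T O hI.osc hI.x0_bound K
    _ = _ := by
        refine (integral_add ((j0.add j1).add j2) j3).trans ?_
        refine congrArg₂ (· + ·) ((integral_add (j0.add j1) j2).trans ?_)
          ((integral_const_mul _ _).trans (congrArg (cC * ·) e3))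
        refine congrArg₂ (· + ·) ((integral_add j0 j1).trans ?_)
          ((integral_const_mul _ _).trans (congrArg (cB * ·) e2))
        exact congrArg₂ (· + ·) (by simp) ((integral_const_mul _ _).trans (congrArg (cA * ·) e1))

open Filter Asymptotics Topology

/-! ### Orders of magnitude -/

/-- An admissible offset is a large multiple of `1 / (1 - ρ)`. -/
lemma exists_offset (n : ℕ) {α β γx γy μ C ε : ℝ} (hβ : 0 < β) (hβα : β < α) (hα : α < 1)
    (hγx : 0 < γx) (hγy : 0 < γy) (hμ : 0 < μ) (hε : 0 < ε) :
    ∃ b : ℝ, 1 ≤ b ∧ ∀ ρ : ℝ, 0 ≤ ρ → ρ < 1 → Offset n ρ α β γx γy μ C ε (b / (1 - ρ)) := by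
  have h1 : Tendsto (fun b : ℝ => b ^ β) atTop atTop := tendsto_rpow_atTop hβ
  have h2 : Tendsto (fun b : ℝ => C ^ 2 * b ^ (β - 1)) atTop (𝓝 0) := by
    have := (tendsto_rpow_neg_atTop (by linarith : 0 < 1 - β)).const_mul (C ^ 2)
    simpa using this
  have h3 : Tendsto (fun b : ℝ => γx / γy * b ^ (β - α)) atTop (𝓝 0) := by
    have := (tendsto_rpow_neg_atTop (by linarith : 0 < α - β)).const_mul (γx / γy)
    simpa using this
  obtain ⟨b, hb1, hbn, hbC, hb2, hb3, hb4⟩ := ((eventually_ge_atTop (1 : ℝ)).and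
    ((eventually_ge_atTop (2 * n * C ^ 2 + C ^ 2)).and ((eventually_ge_atTop (4 * C ^ 2)).and
    ((h1.eventually_ge_atTop (μ * γy)).and ((h2.eventually_le_const
    (by positivity : 0 < γy * μ / 4)).and (h3.eventually_le_const hε)))))).exists
  refine ⟨b, hb1, fun ρ hρ0 hρ1 => ?_⟩
  have hs : 0 < 1 - ρ := by linarith
  have hb0 : 0 < b := by linarith
  have hle : b ≤ b / (1 - ρ) := le_div_self hb0.le hs (by linarith)
  exact
    { one_le := hb1.trans hle
      disagreement := by
        rw [div_add' _ _ _ hs.ne']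
        refine div_le_div_of_nonneg_right (le_trans ?_ hbn) hs.le
        nlinarith [sq_nonneg C]
      growth := by rwa [mul_div_cancel₀ _ hs.ne']
      small := hb2.trans (Real.rpow_le_rpow hb0.le hle hβ.le)
      slow := le_trans (mul_le_mul_of_nonneg_left
        (Real.rpow_le_rpow_of_nonpos hb0 hle (by linarith)) (sq_nonneg C)) hb3
      ratio := le_trans (mul_le_mul_of_nonneg_left
        (Real.rpow_le_rpow_of_nonpos hb0 hle (by linarith)) (by positivity)) hb4 }

/-- The pairs `(ρ, K)` of a contraction factor and a number of iterations beyond the transient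
phase. -/
def regime (β a : ℝ) : Set (ℝ × ℕ) :=
  {z | 0 ≤ z.1 ∧ z.1 < 1 ∧ 1 ≤ z.2 ∧ a * (1 / (1 - z.1) ^ 2) ^ (1 / β) ≤ z.2}

/-- The target order of the sum of the squared gradients, as a function of `(ρ, K)`: a logarithm
times `K` times the rate. -/
noncomputable def target (α β : ℝ) (z : ℝ × ℕ) : ℝ :=
  (1 + Real.log z.2) * (z.2 * rate α β z.1 z.2)

section Regime

variable {α β a ρ : ℝ} {K : ℕ}

lemma one_le_one_div (hρ0 : 0 ≤ ρ) (hρ1 : ρ < 1) : 1 ≤ 1 / (1 - ρ) := by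
  rw [le_div_iff₀ (by linarith)]; linarith

lemma mul_rate (hρ1 : ρ < 1) (hK : 1 ≤ K) :
    K * rate α β ρ K = (K : ℝ) ^ α + (1 / (1 - ρ)) ^ α * (K : ℝ) ^ (1 - α)
      + ((K : ℝ) ^ β + 1 / (1 - ρ) * (K : ℝ) ^ (1 - β)) := by
  have hK' : (0 : ℝ) < K := by exact_mod_cast hK
  have hs : 0 < 1 - ρ := by linarith
  have h1 := (Real.rpow_pos_of_pos hK' α).ne'
  have h2 := (Real.rpow_pos_of_pos hK' β).ne'
  have h3 := (Real.rpow_pos_of_pos hs α).ne'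
  rw [rate, Real.rpow_sub hK', Real.rpow_sub hK', Real.rpow_one, Real.div_rpow one_pos.le hs.le,
    Real.one_rpow]
  field_simp

lemma rpow_le_mul_rate (hα : 0 ≤ α) (hρ0 : 0 ≤ ρ) (hρ1 : ρ < 1) (hK : 1 ≤ K) :
    (K : ℝ) ^ α ≤ K * rate α β ρ K ∧ (K : ℝ) ^ (1 - α) ≤ K * rate α β ρ K ∧
    (K : ℝ) ^ β ≤ K * rate α β ρ K ∧ 1 / (1 - ρ) * (K : ℝ) ^ (1 - β) ≤ K * rate α β ρ K := by
  have hK' : (0 : ℝ) < K := by exact_mod_cast hK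
  have hσ := one_le_one_div hρ0 hρ1
  have h1 := Real.rpow_pos_of_pos hK' α
  have h2 := Real.rpow_pos_of_pos hK' β
  have h3 := Real.rpow_pos_of_pos hK' (1 - α)
  have h4 := Real.rpow_pos_of_pos hK' (1 - β)
  have h5 := le_mul_of_one_le_left h3.le (Real.one_le_rpow hσ hα)
  have h6 : 0 ≤ 1 / (1 - ρ) * (K : ℝ) ^ (1 - β) := by positivity
  rw [mul_rate hρ1 hK]
  refine ⟨?_, ?_, ?_, ?_⟩ <;> linarith

/-- This is what the lower bound on `K` is used for. -/
lemma sq_le_of_regime (hβ : 0 < β) (ha : 0 < a) (hρ1 : ρ < 1)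
    (h : a * (1 / (1 - ρ) ^ 2) ^ (1 / β) ≤ K) :
    (1 / (1 - ρ)) ^ 2 ≤ (1 / a) ^ β * (K : ℝ) ^ β := by
  have hs : 0 < 1 - ρ := by linarith
  have h1 : (1 / (1 - ρ) ^ 2) ^ (1 / β) ≤ 1 / a * K := by
    rw [one_div a, ← div_eq_inv_mul, le_div_iff₀ ha, mul_comm]; exact h
  have h2 := Real.rpow_le_rpow (by positivity) h1 hβ.le
  rw [← Real.rpow_mul (by positivity), one_div_mul_cancel hβ.ne', Real.rpow_one,
    Real.mul_rpow (by positivity) (by positivity)] at h2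
  rwa [one_div_pow]

end Regime

lemma relBound_isBigO (n : ℕ) {c : ℝ} (hc : 0 < c) (C t : ℝ) :
    (fun K : ℕ => relBound n c C t K) =O[𝓟 {K | 1 ≤ K}]
      fun K : ℕ => (1 + Real.log K) * (1 + (K : ℝ) ^ (1 - t)) := by
  have hlog : ∀ K : ℕ, 1 ≤ K → 0 ≤ Real.log K := fun K hK =>
    Real.log_nonneg (by exact_mod_cast hK)
  have hZ : ∀ K : ℕ, 1 ≤ K → c + K * C ^ 2 ≤ (c + C ^ 2) * K := fun K hK => by
    have : (1 : ℝ) ≤ K := by exact_mod_cast hK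
    nlinarith
  have hcZ : ∀ K : ℕ, c ≤ c + K * C ^ 2 := fun K => le_add_of_nonneg_right (by positivity)
  have h1 : (fun K : ℕ => Real.log ((c + K * C ^ 2) / c)) =O[𝓟 {K | 1 ≤ K}]
      fun K : ℕ => 1 + Real.log K := by
    refine IsBigO.of_bound (1 + Real.log ((c + C ^ 2) / c)) (eventually_principal.2 fun K hK => ?_)
    have hK' : (1 : ℝ) ≤ K := by exact_mod_cast hK
    have h2 : 0 ≤ Real.log ((c + C ^ 2) / c) :=
      Real.log_nonneg (by rw [le_div_iff₀ hc]; nlinarith [sq_nonneg C])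
    have h3 : 0 ≤ Real.log ((c + K * C ^ 2) / c) :=
      Real.log_nonneg (by rw [le_div_iff₀ hc, one_mul]; exact hcZ K)
    have h4 := hlog K hK
    rw [Real.norm_of_nonneg h3, Real.norm_of_nonneg (by linarith)]
    calc Real.log ((c + K * C ^ 2) / c) ≤ Real.log ((c + C ^ 2) / c * K) := by
          refine Real.log_le_log (by positivity) ?_
          rw [div_mul_eq_mul_div]
          exact div_le_div_of_nonneg_right (hZ K hK) hc.le
      _ = Real.log ((c + C ^ 2) / c) + Real.log K :=
          Real.log_mul (by positivity) (by positivity)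
      _ ≤ _ := by nlinarith
  have h2 : (fun K : ℕ => c ^ (1 - t) + (c + K * C ^ 2) ^ (1 - t)) =O[𝓟 {K | 1 ≤ K}]
      fun K : ℕ => 1 + (K : ℝ) ^ (1 - t) := by
    refine IsBigO.of_bound (2 * c ^ (1 - t) + (c + C ^ 2) ^ (1 - t))
      (eventually_principal.2 fun K hK => ?_)
    have hK' : (1 : ℝ) ≤ K := by exact_mod_cast hK
    have hk := Real.rpow_nonneg (by linarith : (0 : ℝ) ≤ K) (1 - t)
    have hc1 := Real.rpow_pos_of_pos hc (1 - t)
    have hc2 := Real.rpow_pos_of_pos (by positivity : 0 < c + C ^ 2) (1 - t)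
    rw [Real.norm_of_nonneg (by positivity), Real.norm_of_nonneg (by positivity)]
    have h5 : (c + K * C ^ 2) ^ (1 - t)
        ≤ c ^ (1 - t) + (c + C ^ 2) ^ (1 - t) * (K : ℝ) ^ (1 - t) := by
      rcases le_total 0 (1 - t) with ht | ht
      · have := Real.rpow_le_rpow (by positivity) (hZ K hK) ht
        rw [Real.mul_rpow (by positivity) (by positivity)] at this
        linarith
      · have := Real.rpow_le_rpow_of_nonpos hc (hcZ K) ht
        have : 0 ≤ (c + C ^ 2) ^ (1 - t) * (K : ℝ) ^ (1 - t) := by positivity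
        linarith
    nlinarith [mul_nonneg hc1.le hk]
  have h3 := (h1.const_mul_left (n : ℝ)).mul h2
  exact h3

section Orders

variable {α β a : ℝ}

lemma isBigO_target_of_le {f : ℝ × ℕ → ℝ} (D : ℝ)
    (h : ∀ z ∈ regime β a, |f z| ≤ D * (z.2 * rate α β z.1 z.2)) (hα : 0 ≤ α) :
    (fun z => (1 + Real.log z.2) * f z) =O[𝓟 (regime β a)] target α β := by
  refine (isBigO_refl _ _).mul (IsBigO.of_bound D (eventually_principal.2 fun z hz => ?_))
  have h5 := h z hz
  obtain ⟨h0, h1, h2, -⟩ := hz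
  have h3 := (rpow_le_mul_rate (β := β) hα h0 h1 h2).1
  have h4 : (0 : ℝ) ≤ (z.2 : ℝ) ^ α := by positivity
  rw [Real.norm_eq_abs, Real.norm_of_nonneg (h4.trans h3)]
  exact h5

/-- The logarithm may be added to a bound for free. -/
lemma isBigO_log_mul (f : ℝ × ℕ → ℝ) :
    f =O[𝓟 (regime β a)] fun z => (1 + Real.log z.2) * f z := by
  refine IsBigO.of_bound 1 (eventually_principal.2 fun z hz => ?_)
  have : 0 ≤ Real.log z.2 := Real.log_nonneg (by exact_mod_cast hz.2.2.1)
  rw [norm_mul, one_mul, Real.norm_of_nonneg (by linarith : 0 ≤ 1 + Real.log z.2)]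
  exact le_mul_of_one_le_left (norm_nonneg _) (by linarith)

lemma relBound_isBigO_regime (n : ℕ) {c : ℝ} (hc : 0 < c) (C t : ℝ) :
    (fun z : ℝ × ℕ => relBound n c C t z.2) =O[𝓟 (regime β a)]
      fun z => (1 + Real.log z.2) * (1 + (z.2 : ℝ) ^ (1 - t)) :=
  (relBound_isBigO n hc C t).comp_tendsto (k := Prod.snd)
    (tendsto_principal_principal.2 fun _ hz => hz.2.2.1)

lemma rpow_isBigO_target (hβ : 0 < β) (hβα : β < α) :
    (fun z : ℝ × ℕ => (z.2 : ℝ) ^ α) =O[𝓟 (regime β a)] target α β := by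
  refine (isBigO_log_mul _).trans (isBigO_target_of_le 1 (fun z hz => ?_) (by linarith))
  rw [abs_of_nonneg (by positivity), one_mul]
  exact (rpow_le_mul_rate (by linarith) hz.1 hz.2.1 hz.2.2.1).1

lemma inv_gap_mul_relBound_isBigO_target (hβ : 0 < β) (hβα : β < α) (hα : α < 1)
    (n : ℕ) {c : ℝ} (hc : 0 < c) (C : ℝ) :
    (fun z : ℝ × ℕ => 1 / (1 - z.1) * relBound n c C β z.2) =O[𝓟 (regime β a)] target α β := by
  refine ((isBigO_refl (fun z : ℝ × ℕ => 1 / (1 - z.1)) _).mul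
    (relBound_isBigO_regime n hc C β)).trans ?_
  refine (isBigO_target_of_le (f := fun z => 1 / (1 - z.1) * (1 + (z.2 : ℝ) ^ (1 - β))) 2
    (fun z hz => ?_) (by linarith)).congr_left fun z => by ring
  obtain ⟨h0, h1, h2, -⟩ := hz
  have hK : (1 : ℝ) ≤ z.2 := by exact_mod_cast h2
  have hσ := one_le_one_div h0 h1
  have h3 := (rpow_le_mul_rate (α := α) (β := β) (by linarith) h0 h1 h2).2.2.2
  have h4 : (1 : ℝ) ≤ (z.2 : ℝ) ^ (1 - β) := Real.one_le_rpow hK (by linarith)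
  rw [abs_of_nonneg (by positivity)]
  nlinarith

lemma inv_gap_isBigO_target (hβ : 0 < β) (hβα : β < α) (hα : α < 1) :
    (fun z : ℝ × ℕ => 1 / (1 - z.1)) =O[𝓟 (regime β a)] target α β := by
  refine (isBigO_log_mul _).trans (isBigO_target_of_le 1 (fun z hz => ?_) (by linarith))
  obtain ⟨h0, h1, h2, -⟩ := hz
  have hK : (1 : ℝ) ≤ z.2 := by exact_mod_cast h2
  have hσ := one_le_one_div h0 h1
  have h3 := (rpow_le_mul_rate (α := α) (β := β) (by linarith) h0 h1 h2).2.2.2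
  have h4 : (1 : ℝ) ≤ (z.2 : ℝ) ^ (1 - β) := Real.one_le_rpow hK (by linarith)
  rw [abs_of_nonneg (by positivity)]
  nlinarith

lemma relBound_isBigO_target (hβ : 0 < β) (hβα : β < α) (hα : α < 1)
    (n : ℕ) {c t : ℝ} (hc : 0 < c) (C : ℝ) (ht : β ≤ t) :
    (fun z : ℝ × ℕ => relBound n c C t z.2) =O[𝓟 (regime β a)] target α β := by
  refine (relBound_isBigO_regime n hc C t).trans ?_
  refine isBigO_target_of_le 2 (fun z hz => ?_) (by linarith)
  obtain ⟨h0, h1, h2, -⟩ := hz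
  have hK : (1 : ℝ) ≤ z.2 := by exact_mod_cast h2
  have hσ := one_le_one_div h0 h1
  have h3 := (rpow_le_mul_rate (α := α) (β := β) (by linarith) h0 h1 h2).2.2.2
  have h4 : (1 : ℝ) ≤ (z.2 : ℝ) ^ (1 - β) := Real.one_le_rpow hK (by linarith)
  have h5 : (z.2 : ℝ) ^ (1 - t) ≤ (z.2 : ℝ) ^ (1 - β) :=
    Real.rpow_le_rpow_of_exponent_le hK (by linarith)
  have h6 : (0 : ℝ) ≤ (z.2 : ℝ) ^ (1 - t) := by positivity
  rw [abs_of_nonneg (by positivity)]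
  nlinarith

lemma inv_gap_sq_mul_relBound_isBigO_target (hβ : 0 < β) (hβα : β < α) (hα : α < 1) (ha : 0 < a)
    (n : ℕ) {c t : ℝ} (hc : 0 < c) (C : ℝ) (ht : β ≤ t) :
    (fun z : ℝ × ℕ => (1 / (1 - z.1)) ^ 2 * relBound n c C (2 * t) z.2)
      =O[𝓟 (regime β a)] target α β := by
  refine ((isBigO_refl (fun z : ℝ × ℕ => (1 / (1 - z.1)) ^ 2) _).mul
    (relBound_isBigO_regime n hc C (2 * t))).trans ?_
  refine (isBigO_target_of_le
    (f := fun z => (1 / (1 - z.1)) ^ 2 * (1 + (z.2 : ℝ) ^ (1 - 2 * t))) ((1 / a) ^ β * 2)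
    (fun z hz => ?_) (by linarith)).congr_left fun z => by ring
  obtain ⟨h0, h1, h2, h7⟩ := hz
  have hK : (1 : ℝ) ≤ z.2 := by exact_mod_cast h2
  have hσ := one_le_one_div h0 h1
  obtain ⟨-, -, h3, h4⟩ := rpow_le_mul_rate (α := α) (β := β) (by linarith) h0 h1 h2
  have h5 := sq_le_of_regime hβ ha h1 h7
  have h8 : (z.2 : ℝ) ^ β * (z.2 : ℝ) ^ (1 - 2 * t) ≤ (z.2 : ℝ) ^ (1 - β) := by
    rw [← Real.rpow_add (by linarith)]
    exact Real.rpow_le_rpow_of_exponent_le hK (by linarith)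
  have h9 : (z.2 : ℝ) ^ (1 - β) ≤ 1 / (1 - z.1) * (z.2 : ℝ) ^ (1 - β) :=
    le_mul_of_one_le_left (by positivity) hσ
  have hpos : 0 ≤ 1 + (z.2 : ℝ) ^ (1 - 2 * t) := by positivity
  rw [abs_of_nonneg (by positivity)]
  calc (1 / (1 - z.1)) ^ 2 * (1 + (z.2 : ℝ) ^ (1 - 2 * t))
      ≤ ((1 / a) ^ β * (z.2 : ℝ) ^ β) * (1 + (z.2 : ℝ) ^ (1 - 2 * t)) := by gcongr
    _ = (1 / a) ^ β * ((z.2 : ℝ) ^ β + (z.2 : ℝ) ^ β * (z.2 : ℝ) ^ (1 - 2 * t)) := by ring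
    _ ≤ (1 / a) ^ β * (2 * (z.2 * rate α β z.1 z.2)) := by gcongr; linarith
    _ = _ := by ring

end Orders

section Bounds

variable {α β a b : ℝ}

lemma two_offset_rpow_isBigO (hb : 1 ≤ b) {r : ℝ} {m : ℕ} (hr : r ≤ m) :
    (fun z : ℝ × ℕ => (2 * (b / (1 - z.1))) ^ r) =O[𝓟 (regime β a)]
      fun z => (1 / (1 - z.1)) ^ m := by
  refine IsBigO.of_bound ((2 * b) ^ m) (eventually_principal.2 fun z hz => ?_)
  obtain ⟨h0, h1, -, -⟩ := hz
  have hs : 0 < 1 - z.1 := by linarith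
  have hσ := one_le_one_div h0 h1
  have h2 : 1 ≤ 2 * (b / (1 - z.1)) := by
    rw [div_eq_mul_one_div]; nlinarith
  rw [Real.norm_of_nonneg (by positivity), Real.norm_of_nonneg (by positivity), ← mul_pow]
  calc (2 * (b / (1 - z.1))) ^ r ≤ (2 * (b / (1 - z.1))) ^ (m : ℝ) :=
        Real.rpow_le_rpow_of_exponent_le h2 hr
    _ = _ := by rw [Real.rpow_natCast]; ring

lemma offset_add_rpow_isBigO (hb : 1 ≤ b) {c : ℝ} (hc : 0 < c) (hβ1 : β ≤ 1) :
    (fun z : ℝ × ℕ => (b / (1 - z.1) + c) ^ β) =O[𝓟 (regime β a)]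
      fun z => 1 / (1 - z.1) := by
  refine IsBigO.of_bound (b + c) (eventually_principal.2 fun z hz => ?_)
  obtain ⟨h0, h1, -, -⟩ := hz
  have hs : 0 < 1 - z.1 := by linarith
  have hσ := one_le_one_div h0 h1
  have h2 : 1 ≤ b / (1 - z.1) + c := by
    rw [div_eq_mul_one_div]; nlinarith
  rw [Real.norm_of_nonneg (by positivity), Real.norm_of_nonneg (by positivity)]
  refine (Real.rpow_le_rpow_of_exponent_le h2 hβ1).trans ?_
  rw [Real.rpow_one, div_eq_mul_one_div, add_mul]
  nlinarith

lemma offset_add_linear_rpow_isBigO_target (hβ : 0 < β) (hβα : β < α) (hα : α < 1) (ha : 0 < a)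
    (hb : 1 ≤ b) {c : ℝ} (hc : 0 < c) (C : ℝ) :
    (fun z : ℝ × ℕ => (b / (1 - z.1) + (c + z.2 * C ^ 2)) ^ α) =O[𝓟 (regime β a)]
      target α β := by
  refine IsBigO.trans (IsBigO.rpow (g := fun z : ℝ × ℕ => (z.2 : ℝ)) (hβ.trans hβα).le
    (eventually_principal.2 fun z hz => Nat.cast_nonneg _)
    (IsBigO.of_bound (b * (1 / a) ^ β + (c + C ^ 2)) (eventually_principal.2 fun z hz => ?_)))
    (rpow_isBigO_target hβ hβα)
  obtain ⟨h0, h1, h2, h3⟩ := hz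
  have hs : 0 < 1 - z.1 := by linarith
  have hσ := one_le_one_div h0 h1
  have hK : (1 : ℝ) ≤ z.2 := by exact_mod_cast h2
  have h4 := sq_le_of_regime hβ ha h1 h3
  have h5 : (z.2 : ℝ) ^ β ≤ z.2 :=
    (Real.rpow_le_rpow_of_exponent_le hK (by linarith)).trans_eq (Real.rpow_one _)
  have h6 : 1 / (1 - z.1) ≤ (1 / a) ^ β * z.2 :=
    (le_self_pow₀ hσ two_ne_zero).trans (h4.trans (by gcongr))
  rw [Real.norm_of_nonneg (by positivity), Real.norm_of_nonneg (by positivity)]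
  have h7 : b / (1 - z.1) ≤ b * ((1 / a) ^ β * z.2) := by
    rw [div_eq_mul_one_div]; gcongr
  nlinarith [sq_nonneg C]

lemma stepBound_isBigO_target (hβ : 0 < β) (hβα : β < α) (hα : α < 1) (ha : 0 < a) (hb : 1 ≤ b)
    (n : ℕ) {c t : ℝ} (hc : 0 < c) (C : ℝ) (ht : β ≤ t) (ht1 : t ≤ 1) :
    (fun z : ℝ × ℕ => stepBound n c C t (b / (1 - z.1)) z.2) =O[𝓟 (regime β a)] target α β := by
  simp only [stepBound]
  refine (relBound_isBigO_target hβ hβα hα n hc C ht).add ?_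
  refine IsBigO.trans ?_ (inv_gap_sq_mul_relBound_isBigO_target hβ hβα hα ha n hc C ht)
  exact (two_offset_rpow_isBigO hb (by push_cast; linarith)).mul (isBigO_refl _ _)

lemma spreadBoundX_isBigO_target (hβ : 0 < β) (hβα : β < α) (hα : α < 1) (ha : 0 < a)
    (n : ℕ) (γx : ℝ) {c : ℝ} (hc : 0 < c) (C R : ℝ) :
    (fun z : ℝ × ℕ => spreadBoundX n γx c C R α z.1 z.2) =O[𝓟 (regime β a)] target α β := by
  refine (((inv_gap_isBigO_target hβ hβα hα).const_mul_left (2 * (n * R ^ 2))).add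
    ((inv_gap_sq_mul_relBound_isBigO_target hβ hβα hα ha n hc C hβα.le).const_mul_left
      (4 * γx ^ 2))).congr_left fun z => ?_
  rw [spreadBoundX]
  ring

lemma spreadBoundY_isBigO_target (hβ : 0 < β) (hβα : β < α) (hα : α < 1) (ha : 0 < a)
    (n : ℕ) (γy : ℝ) {c : ℝ} (hc : 0 < c) (μ C : ℝ) :
    (fun z : ℝ × ℕ => spreadBoundY n γy c μ C β z.1 z.2) =O[𝓟 (regime β a)] target α β := by
  refine (((inv_gap_isBigO_target hβ hβα hα).const_mul_left (2 * (n * (2 * C / μ) ^ 2))).add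
    ((inv_gap_sq_mul_relBound_isBigO_target hβ hβα hα ha n hc C le_rfl).const_mul_left
      (4 * γy ^ 2))).congr_left fun z => ?_
  rw [spreadBoundY]
  ring

/-- It matters that `2 S` enters this bound with the power `β`: with `2 β` its product with the
remaining factor `1 / (1 - ρ)` could exceed `1 / (1 - ρ) ^ 2`. -/
lemma gap_mul_weightedSpreadBound_isBigO_target (hβ : 0 < β) (hβα : β < α) (hα : α < 1)
    (ha : 0 < a) (hb : 1 ≤ b) (n : ℕ) (γy : ℝ) {c : ℝ} (hc : 0 < c) (μ C : ℝ) :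
    (fun z : ℝ × ℕ => (1 - z.1) * weightedSpreadBound n γy c μ C β z.1 (b / (1 - z.1)) z.2)
      =O[𝓟 (regime β a)] target α β := by
  have h1 := ((offset_add_rpow_isBigO (β := β) (a := a) hb hc (by linarith)).trans
    (inv_gap_isBigO_target hβ hβα hα)).const_mul_left (4 * (n * (2 * C / μ) ^ 2))
  have h2 := (inv_gap_mul_relBound_isBigO_target (a := a) hβ hβα hα n hc C).const_mul_left
    (16 * γy ^ 2)
  have h3 : (fun z : ℝ × ℕ => 1 / (1 - z.1) * ((2 * (b / (1 - z.1))) ^ β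
      * relBound n c C (2 * β) z.2)) =O[𝓟 (regime β a)] target α β := by
    refine IsBigO.trans ?_ (inv_gap_sq_mul_relBound_isBigO_target hβ hβα hα ha n hc C le_rfl)
    simp only [sq, mul_assoc]
    refine (isBigO_refl _ _).mul (IsBigO.mul ?_ (isBigO_refl _ _))
    simpa using two_offset_rpow_isBigO (β := β) (a := a) hb (r := β) (m := 1)
      (by push_cast; linarith)
  refine IsBigO.congr' ((h1.add h2).add (h3.const_mul_left (16 * γy ^ 2)))
    (eventually_principal.2 fun z hz => ?_) EventuallyEq.rfl
  have hs : 1 - z.1 ≠ 0 := by linarith [hz.2.1]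
  simp only [weightedSpreadBound]
  field_simp
  ring

lemma descentBound_isBigO_target (hβ : 0 < β) (hβα : β < α) (hα : α < 1) (ha : 0 < a)
    (hb : 1 ≤ b) (n : ℕ) (γx : ℝ) {c : ℝ} (hc : 0 < c) (μ L C M : ℝ) :
    (fun z : ℝ × ℕ => descentBound n γx c μ L C M α (b / (1 - z.1)) z.2)
      =O[𝓟 (regime β a)] target α β := by
  refine (((offset_add_linear_rpow_isBigO_target hβ hβα hα ha hb hc C).const_mul_left
    (M / γx)).add ((stepBound_isBigO_target hβ hβα hα ha hb n hc C hβα.le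
      hα.le).const_mul_left (1 + L * (2 + L / μ) * γx))).congr_left fun z => ?_
  rw [descentBound]
  ring

lemma dualBound_isBigO_target (hβ : 0 < β) (hβα : β < α) (hα : α < 1) (ha : 0 < a)
    (hb : 1 ≤ b) (n : ℕ) (γx γy : ℝ) {c : ℝ} (hc : 0 < c) (μ L C R : ℝ) :
    (fun z : ℝ × ℕ => dualBound n γx γy c μ L C R α β z.1 (b / (1 - z.1)) z.2)
      =O[𝓟 (regime β a)] target α β := by
  have h1 := ((offset_add_rpow_isBigO (β := β) (a := a) hb hc (by linarith)).trans
    (inv_gap_isBigO_target hβ hβα hα)).const_mul_left (1 / γy * (n * (2 * C / μ) ^ 2))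
  have h2 := (((spreadBoundX_isBigO_target hβ hβα hα ha n γx hc C R).const_mul_left 8).add
    ((spreadBoundY_isBigO_target hβ hβα hα ha n γy hc μ C).const_mul_left 4)).const_mul_left
    (2 * L ^ 2 / μ + L / 2)
  have h3 := (inv_gap_mul_relBound_isBigO_target (a := a) hβ hβα hα n hc C).const_mul_left 2
  have h4 := (gap_mul_weightedSpreadBound_isBigO_target hβ hβα hα ha hb n γy hc
    μ C).const_mul_left 2
  have h5 := (stepBound_isBigO_target hβ hβα hα ha hb n hc C le_rfl (by linarith)).const_mul_left
    (8 / μ + 2 * γy)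
  refine ((((h1.add h2).add h3).add h4).add h5).congr_left fun z => ?_
  rw [dualBound]
  ring

end Bounds

/-! ### The convergence rate and the number of iterations -/

/-- The convergence rate beyond the transient phase. -/
lemma exists_rate_bound (n : ℕ) (hn : 0 < n) (γx γy c μ L C M R α β a : ℝ) (hγx : 0 < γx)
    (hγy : 0 < γy) (hc : 0 < c) (hμ : 0 < μ) (hL : 0 < L) (hC : 0 < C) (hβ : 0 < β)
    (hβα : β < α) (hα : α < 1) (ha : 0 < a) :
    ∃ B ≥ 0, ∀ (p d : ℕ) (Ξ Ω : Type*) [MeasurableSpace Ξ] [MeasurableSpace Ω]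
      (I : Instance n p d Ξ Ω), I.Admissible μ L C M R → ∀ K : ℕ, 1 ≤ K →
      a * (1 / (1 - rho I.W) ^ 2) ^ (1 / β) ≤ K →
      I.avgGradSq α β γx γy c K ≤ B * (1 + Real.log K) * rate α β (rho I.W) K := by
  obtain ⟨ε, hε, cX, hcX, cA, hcA, cB, hcB, cC, hcC, h⟩ :=
    exists_expectation_bound n hn γx γy c μ L C M R hγx hγy hc hμ hL hC
  obtain ⟨b, hb, hO⟩ := exists_offset n (C := C) hβ hβα hα hγx hγy hμ hε
  have hbig := ((((spreadBoundX_isBigO_target hβ hβα hα ha n γx hc C R).const_mul_left cX).add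
    ((descentBound_isBigO_target hβ hβα hα ha hb n γx hc μ L C M).const_mul_left cA)).add
    ((dualBound_isBigO_target hβ hβα hα ha hb n γx γy hc μ L C R).const_mul_left cB)).add
    ((stepBound_isBigO_target hβ hβα hα ha hb n hc C hβα.le hα.le).const_mul_left
      (cC * (4 / μ * ε ^ 2 + ε * γx)))
  obtain ⟨B, hB, hbound⟩ := hbig.exists_nonneg
  refine ⟨B, hB, fun p d Ξ Ω _ _ I hI K hK hKa => ?_⟩
  have hρ0 := rho_nonneg I.W
  have hz : (rho I.W, K) ∈ regime β a := ⟨hρ0, hI.rho_lt_one, hK, hKa⟩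
  have h1 := eventually_principal.1 hbound.bound _ hz
  have h2 := h p d Ξ Ω I α β _ hI hβ hβα hα (hO _ hρ0 hI.rho_lt_one) K
  have hK' : (1 : ℝ) ≤ K := by exact_mod_cast hK
  have h3 : 0 ≤ Real.log K := Real.log_nonneg hK'
  have h4 : 0 ≤ (K : ℝ) * rate α β (rho I.W) K :=
    le_trans (by positivity)
      (rpow_le_mul_rate (α := α) (β := β) (by linarith) hρ0 hI.rho_lt_one hK).1
  have h5 : 0 ≤ target α β (rho I.W, K) := mul_nonneg (by linarith) h4
  rw [Real.norm_of_nonneg h5] at h1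
  rw [Instance.avgGradSq, one_div, ← div_eq_inv_mul, div_le_iff₀ (by linarith)]
  refine h2.trans (le_trans ?_ ((le_abs_self _).trans (h1.trans_eq ?_)))
  · rw [mul_assoc cC]
  · rw [target]
    ring

/-- Inverting `(1 + log K) / K ^ β ≤ x⁻²`, where `x` stands for `1 / ε`: a number of iterations of
the order `x ^ (2 / β)`, up to a power of `log x`, is enough. -/
lemma exists_iteration_bound {β : ℝ} (hβ : 0 < β) (D : ℝ) (hD : 0 ≤ D) :
    ∃ (A : ℝ) (m : ℕ), 1 ≤ A ∧ ∀ x : ℝ, 1 ≤ x →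
      ∀ K : ℝ, A * x ^ (2 / β) * (1 + Real.log x) ^ m ≤ K →
        D * (1 + Real.log K) * (1 / K ^ β) ≤ (1 / x) ^ 2 := by
  obtain ⟨m, hm⟩ := exists_nat_ge (1 / β)
  set E := 1 + 1 / β + 2 / β + m
  have hlim : Tendsto (fun A : ℝ => (D * (E + Real.log A)) / A ^ β) atTop (𝓝 0) :=
    (((isLittleO_const_left.2 (Or.inr (tendsto_norm_atTop_atTop.comp
      (tendsto_rpow_atTop hβ)))).add (isLittleO_log_rpow_atTop hβ)).const_mul_left
        D).tendsto_div_nhds_zero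
  obtain ⟨A, hA1, hA⟩ := ((eventually_ge_atTop (1 : ℝ)).and
    (hlim.eventually_le_const one_pos)).exists
  refine ⟨A, m, hA1, fun x hx K hK => ?_⟩
  have hlx : 0 ≤ Real.log x := Real.log_nonneg hx
  have hlA : 0 ≤ Real.log A := Real.log_nonneg hA1
  set l := 1 + Real.log x with hl
  have hl1 : 1 ≤ l := by linarith
  set T := A * x ^ (2 / β) * l ^ m with hT
  have hx0 : 0 < x := by linarith
  have hxs := Real.rpow_pos_of_pos hx0 (2 / β)
  have hT0 : 0 < T := by positivity
  have hK0 : 0 < K := hT0.trans_le hK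
  have hu : 1 ≤ K / T := by rwa [le_div_iff₀ hT0, one_mul]
  have hlogK : Real.log K = Real.log T + Real.log (K / T) := by
    rw [Real.log_div hK0.ne' hT0.ne']; ring
  have hTlog : Real.log T ≤ Real.log A + (2 / β + m) * l := by
    rw [hT, Real.log_mul (by positivity) (by positivity), Real.log_mul (by positivity)
      (by positivity), Real.log_rpow hx0, Real.log_pow]
    have h1 : Real.log l ≤ l := (Real.log_le_sub_one_of_pos (by linarith)).trans (by linarith)
    have h2 := mul_le_mul_of_nonneg_left h1 (Nat.cast_nonneg (α := ℝ) m)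
    have h3 : 2 / β * Real.log x ≤ 2 / β * l := by gcongr; linarith
    linarith
  -- the ratio `K / T` loses its logarithm to the power `β`
  have hulog : Real.log (K / T) ≤ (K / T) ^ β / β := Real.log_le_rpow_div (by positivity) hβ
  have hub : 1 ≤ (K / T) ^ β := Real.one_le_rpow hu hβ.le
  have hTb : 0 < T ^ β := Real.rpow_pos_of_pos hT0 _
  have hKb : K ^ β = T ^ β * (K / T) ^ β := by
    rw [← Real.mul_rpow hT0.le (by positivity), mul_div_cancel₀ _ hT0.ne']
  have hEl : 1 + Real.log K ≤ (E + Real.log A) * l * (K / T) ^ β := by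
    have h1 : 1 + Real.log T + 1 / β ≤ (E + Real.log A) * l := by
      have : 0 < 1 / β := by positivity
      have h2 : 0 ≤ (1 / β + 1 + Real.log A) * (l - 1) :=
        mul_nonneg (by positivity) (by linarith)
      simp only [E]
      nlinarith
    have h0 : 0 ≤ 1 + Real.log T := by
      have h5 : 1 ≤ T := by
        have h3 : 1 ≤ x ^ (2 / β) := Real.one_le_rpow hx (by positivity)
        have h4 : 1 ≤ l ^ m := one_le_pow₀ hl1
        exact one_le_mul_of_one_le_of_one_le (one_le_mul_of_one_le_of_one_le hA1 h3) h4
      linarith [Real.log_nonneg h5]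
    calc 1 + Real.log K ≤ (1 + Real.log T) * (K / T) ^ β + 1 / β * (K / T) ^ β := by
          rw [hlogK, ← add_assoc]
          refine add_le_add (le_mul_of_one_le_right h0 hub) (hulog.trans_eq (by ring))
      _ = (1 + Real.log T + 1 / β) * (K / T) ^ β := by ring
      _ ≤ _ := by gcongr
  have hTpow : A ^ β * x ^ 2 * l ≤ T ^ β := by
    rw [hT, Real.mul_rpow (by positivity) (by positivity), Real.mul_rpow (by positivity)
      (by positivity), ← Real.rpow_mul hx0.le, div_mul_cancel₀ _ hβ.ne', Real.rpow_two]
    gcongr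
    rw [← Real.rpow_natCast, ← Real.rpow_mul (by linarith)]
    have : 1 ≤ m * β := by rwa [div_le_iff₀ hβ] at hm
    exact (Real.rpow_one l).symm.trans_le (Real.rpow_le_rpow_of_exponent_le hl1 this)
  have hAb : 0 < A ^ β := by positivity
  rw [div_le_one hAb] at hA
  rw [mul_one_div, div_le_iff₀ (by positivity), one_div_pow, one_div, ← div_eq_inv_mul,
    le_div_iff₀ (by positivity), hKb]
  calc D * (1 + Real.log K) * x ^ 2 ≤ D * ((E + Real.log A) * l * (K / T) ^ β) * x ^ 2 := by
        gcongr
    _ = (D * (E + Real.log A)) * (x ^ 2 * l) * (K / T) ^ β := by ring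
    _ ≤ A ^ β * (x ^ 2 * l) * (K / T) ^ β := by gcongr
    _ = (A ^ β * x ^ 2 * l) * (K / T) ^ β := by ring
    _ ≤ T ^ β * (K / T) ^ β := by gcongr

/-- When `α + β = 1` and `ρ ≤ r`, the rate is of the order `K ^ (-β)`. -/
lemma rate_le {α β ρ r : ℝ} {K : ℕ} (hβ : 0 < β) (hβα : β ≤ α) (hαβ : α + β = 1) (hρ0 : 0 ≤ ρ)
    (hρ : ρ ≤ r) (hr : r < 1) (hK : 1 ≤ K) :
    rate α β ρ K ≤ 4 / (1 - r) * (1 / (K : ℝ) ^ β) := by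
  have hK' : (1 : ℝ) ≤ K := by exact_mod_cast hK
  have hs : 0 < 1 - r := by linarith
  have hsρ : 1 - r ≤ 1 - ρ := by linarith
  have hKβ : 0 < (K : ℝ) ^ β := by positivity
  have hσ : 1 ≤ 1 / (1 - r) := one_le_one_div (hρ0.trans hρ) hr
  have hα : (K : ℝ) ^ β ≤ (K : ℝ) ^ α := Real.rpow_le_rpow_of_exponent_le hK' hβα
  have hsα : 1 - r ≤ (1 - ρ) ^ α :=
    hsρ.trans (Real.self_le_rpow_of_le_one (by linarith) (by linarith) (by linarith))
  have hsα0 := hs.le.trans hsα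
  rw [rate, show 1 - α = β by linarith, show 1 - β = α by linarith]
  have h1 : 1 / (K : ℝ) ^ α ≤ 1 / (K : ℝ) ^ β := one_div_le_one_div_of_le hKβ hα
  have h2 : 1 / ((1 - ρ) ^ α * (K : ℝ) ^ α) ≤ 1 / (1 - r) * (1 / (K : ℝ) ^ β) := by
    rw [one_div_mul_one_div]
    exact one_div_le_one_div_of_le (by positivity) (by gcongr)
  have h3 : 1 / ((1 - ρ) * (K : ℝ) ^ β) ≤ 1 / (1 - r) * (1 / (K : ℝ) ^ β) := by
    rw [one_div_mul_one_div]
    exact one_div_le_one_div_of_le (by positivity) (by gcongr)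
  have h4 : 1 / (K : ℝ) ^ β ≤ 1 / (1 - r) * (1 / (K : ℝ) ^ β) :=
    le_mul_of_one_le_left (by positivity) hσ
  calc _ ≤ 4 * (1 / (1 - r) * (1 / (K : ℝ) ^ β)) := by linarith
    _ = _ := by ring

end DAdaST

theorem theorem2 (n : ℕ) (γx γy c μ L C M R : ℝ) (hn : 0 < n) (hγx : 0 < γx) (hγy : 0 < γy)
    (hc : 0 < c) (hμ : 0 < μ) (hL : 0 < L) (hC : 0 < C) :
    -- the convergence rate; `a` is the constant hidden in the lower bound on `K`,
    -- `B` and `q` are the constant and the power of the logarithm hidden in the rate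
    (∀ α β a : ℝ, 0 < β → β < α → α < 1 → 0 < a →
      ∃ (B : ℝ) (q : ℕ),
        ∀ (p d : ℕ) (Ξ Ω : Type*) [MeasurableSpace Ξ] [MeasurableSpace Ω]
          (I : DAdaST.Instance n p d Ξ Ω), I.Admissible μ L C M R →
          (∀ x, ∃! y, y ∈ I.Y ∧ IsMaxOn (I.obj x) I.Y y) ∧
          Differentiable ℝ I.Phi ∧
          (∀ k, Integrable
            (fun ω => ‖gradient I.Phi (I.xbar α β γx γy c k ω)‖ ^ 2) I.P) ∧
          ∀ K : ℕ, a * DAdaST.transient α β γx γy (L / μ) (DAdaST.rho I.W) ≤ (K : ℝ) →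
            I.avgGradSq α β γx γy c K
              ≤ B * (1 + Real.log K) ^ q * DAdaST.rate α β (DAdaST.rho I.W) K) ∧
    -- the sample complexity; an iteration draws two samples at each of the `n` nodes
    (∀ δ r : ℝ, 0 < δ → r < 1 →
      ∃ (B : ℝ) (q : ℕ), ∀ ε : ℝ, 0 < ε → ε < 1 →
        ∃ K₀ : ℕ, 0 < K₀ ∧
          2 * (n : ℝ) * K₀ ≤ B * (1 / ε) ^ (4 + δ) * (1 + Real.log (1 / ε)) ^ q ∧
          ∀ (p d : ℕ) (Ξ Ω : Type*) [MeasurableSpace Ξ] [MeasurableSpace Ω]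
            (I : DAdaST.Instance n p d Ξ Ω), I.Admissible μ L C M R →
            DAdaST.rho I.W ≤ r → ∀ K : ℕ, K₀ ≤ K →
              I.avgGradSq (1 / 2 + δ / (8 + 2 * δ)) (1 / 2 - δ / (8 + 2 * δ)) γx γy c K
                ≤ ε ^ 2) := by
  refine ⟨fun α β a hβ hβα hα ha => ?_, fun δ r hδ hr => ?_⟩
  · obtain ⟨B, -, h⟩ := DAdaST.exists_rate_bound n hn γx γy c μ L C M R α β a hγx hγy hc hμ hL hC
      hβ hβα hα ha
    refine ⟨B, 1, fun p d Ξ Ω _ _ I hI => ?_⟩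
    have hA := hI.regular hn hμ hL hC
    refine ⟨hA.existsUnique_maximizer, hA.differentiable_Phi,
      hI.integrable_norm_gradient_Phi_sq hn hμ hL hC α β γx γy c, fun K hK => ?_⟩
    have hs : 0 < 1 - DAdaST.rho I.W := by linarith [hI.rho_lt_one]
    have hmax : max (1 / α) (1 / β) = 1 / β :=
      max_eq_right (one_div_le_one_div_of_le hβ hβα.le)
    have h1 : a * (1 / (1 - DAdaST.rho I.W) ^ 2) ^ (1 / β) ≤ K := by
      refine le_trans (mul_le_mul_of_nonneg_left ?_ ha.le) hK
      rw [DAdaST.transient, hmax]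
      exact le_max_right _ _
    have h2 : 1 ≤ K := by
      have : (0 : ℝ) < K := lt_of_lt_of_le (by positivity) h1
      exact_mod_cast this
    rw [pow_one]
    exact h p d Ξ Ω I hI K h2 h1
  · set α := 1 / 2 + δ / (8 + 2 * δ) with hαd
    set β := 1 / 2 - δ / (8 + 2 * δ) with hβd
    have hβe : β = 2 / (4 + δ) := by rw [hβd]; field_simp; ring
    have hβ : 0 < β := by rw [hβe]; positivity
    have hpos : 0 < δ / (8 + 2 * δ) := by positivity
    have hαβ : α + β = 1 := by rw [hαd, hβd]; ring
    have hβα : β < α := by rw [hαd, hβd]; linarith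
    have hs : 0 < 1 - r := by linarith
    -- with this `a` the condition on the transient phase holds for every `K ≥ 1`
    obtain ⟨B, hB, h⟩ := DAdaST.exists_rate_bound n hn γx γy c μ L C M R α β
      (((1 - r) ^ 2) ^ (1 / β)) hγx hγy hc hμ hL hC hβ hβα (by linarith) (by positivity)
    obtain ⟨A, m, hA, hit⟩ := DAdaST.exists_iteration_bound hβ (B * (4 / (1 - r)))
      (by positivity)
    refine ⟨4 * n * A, m, fun ε hε hε1 => ?_⟩
    have hx : 1 ≤ 1 / ε := by rw [le_div_iff₀ hε]; linarith
    have hlog : 1 ≤ 1 + Real.log (1 / ε) := by linarith [Real.log_nonneg hx]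
    have hexp : 2 / β = 4 + δ := by rw [hβe]; field_simp
    have hT : 1 ≤ A * (1 / ε) ^ (4 + δ) * (1 + Real.log (1 / ε)) ^ m :=
      one_le_mul_of_one_le_of_one_le (one_le_mul_of_one_le_of_one_le hA
        (Real.one_le_rpow hx (by linarith))) (one_le_pow₀ hlog)
    refine ⟨⌈A * (1 / ε) ^ (4 + δ) * (1 + Real.log (1 / ε)) ^ m⌉₊, Nat.ceil_pos.2 (by linarith),
      ?_, fun p d Ξ Ω _ _ I hI hρ K hK => ?_⟩
    · have h1 := (Nat.ceil_lt_add_one (zero_le_one.trans hT)).le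
      calc _ ≤ 2 * (n : ℝ) * (2 * (A * (1 / ε) ^ (4 + δ) * (1 + Real.log (1 / ε)) ^ m)) := by
            gcongr; linarith
        _ = _ := by ring
    · have hKT := Nat.ceil_le.1 hK
      have hK1 : 1 ≤ K := by exact_mod_cast hT.trans hKT
      have hρ0 := DAdaST.rho_nonneg I.W
      have hcond : ((1 - r) ^ 2) ^ (1 / β) * (1 / (1 - DAdaST.rho I.W) ^ 2) ^ (1 / β) ≤ K := by
        rw [← Real.mul_rpow (by positivity) (by positivity)]
        refine le_trans (Real.rpow_le_one (by positivity) ?_ (by positivity))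
          (by exact_mod_cast hK1)
        rw [mul_one_div]
        have : 1 - r ≤ 1 - DAdaST.rho I.W := by linarith
        exact div_le_one_of_le₀ (by gcongr) (by positivity)
      have h1 := h p d Ξ Ω I hI K hK1 hcond
      have h2 := DAdaST.rate_le hβ hβα.le hαβ hρ0 hρ hr hK1
      have h3 : 0 ≤ Real.log K := Real.log_nonneg (by exact_mod_cast hK1)
      have h4 := hit (1 / ε) hx K (by rwa [hexp])
      rw [one_div_one_div] at h4
      calc _ ≤ B * (1 + Real.log K) * DAdaST.rate α β (DAdaST.rho I.W) K := h1
        _ ≤ B * (1 + Real.log K) * (4 / (1 - r) * (1 / (K : ℝ) ^ β)) := by gcongr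
        _ = B * (4 / (1 - r)) * (1 + Real.log K) * (1 / (K : ℝ) ^ β) := by ring
        _ ≤ ε ^ 2 := h4
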